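/- Let $2<p<6$ and $\mu>0$. For $\ell>0$ let $\mathcal G_\ell$ be the metric graph consisting of three halflines $[0,\infty)$ and one terminal edge $[0,\ell]$, all glued at their endpoints $0$ to a single common vertex. Let $H^1(\mathcal G_\ell)$ be the space of continuous functions $u:\mathcal G_\ell\to\mathbb C$ (in particular, $u$ takes a single value at the common vertex) whose restriction $u_e$ to each edge $e$, identified with its interval $I_e$, belongs to $H^1(I_e)$. A ground state of $\mathcal G_\ell$ at mass $\mu$ is a minimizer of the energy $$E(u,\mathcal G_\ell)=\frac12\int_{\mathcal G_\ell}|u'|^2\,dx-\frac1p\int_{\mathcal G_\ell}|u|^p\,dx$$ over all $u\in H^1(\mathcal G_\ell)$ with $\int_{\mathcal G_\ell}|u|^2\,dx=\mu$, where the integrals are sums of the integrals over the four edges. Then there exists a critical length $\ell^*>0$ (depending on $p$ and $\mu$) such that, for every $\ell>0$, the graph $\mathcal G_\ell$ has a ground state at mass $\mu$ if and only if $\ell\ge\ell^*$. -/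

import Mathlib

open MeasureTheory
open scoped ENNReal ContDiff

/-- A noncompact metric graph with finitely many vertices and edges (multiple edges and self-loops
are allowed). The edge `e` starts at `src e` and ends at `tgt e`, and is identified with the
interval `[0, length e]`, or with `[0, ∞)` if `length e = ∞`; the coordinate `0` corresponds to
`src e`. The vertices at infinity have degree one and are not connected with each other; the edges
that end there are the halflines, which are exactly the edges of infinite length. -/
structure MetricGraph where
  Vertex : Type
  Edge : Type
  [fintypeVertex : Fintype Vertex]
  [fintypeEdge : Fintype Edge]
  src : Edge → Vertex
  tgt : Edge → Vertex
  /-- the set of vertices at infinity -/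
  infinity : Set Vertex
  length : Edge → ℝ≥0∞
  infinity_nonempty : infinity.Nonempty
  src_notMem_infinity : ∀ e, src e ∉ infinity
  degree_infinity : ∀ v ∈ infinity, ∃! e, tgt e = v
  length_eq_top_iff : ∀ e, length e = ⊤ ↔ tgt e ∈ infinity

attribute [instance] MetricGraph.fintypeVertex MetricGraph.fintypeEdge

/-- On the interior of `I ⊆ ℝ`, the function `g` is a weak derivative of `u`. -/
def HasWeakDerivOn (u g : ℝ → ℂ) (I : Set ℝ) : Prop :=
  ∀ φ : ℝ → ℝ, ContDiff ℝ ∞ φ → HasCompactSupport φ → tsupport φ ⊆ interior I →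
    ∫ x in I, deriv φ x • u x = -∫ x in I, φ x • g x

namespace MetricGraph

/-- The interval `[0, ℓ_e]` (or `[0, ∞)`) with which the edge `e` is identified. -/
def interval (G : MetricGraph) (e : G.Edge) : Set ℝ :=
  {x | 0 ≤ x ∧ ENNReal.ofReal x ≤ G.length e}

/-- A bunch of functions `u = (u_e)`, one on each edge, is continuous on the graph: every `u_e` is
continuous on its interval, and at each vertex (not at infinity) the value is independent of the
edge chosen to reach the vertex. -/
def IsContinuous (G : MetricGraph) (u : G.Edge → ℝ → ℂ) : Prop :=
  (∀ e, ContinuousOn (u e) (G.interval e)) ∧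
    ∃ value : G.Vertex → ℂ, ∀ e,
      u e 0 = value (G.src e) ∧
        (G.tgt e ∉ G.infinity → u e (G.length e).toReal = value (G.tgt e))

/-- The space `H¹(G)`: continuous functions on `G` whose restriction to every edge is in `L²` and
has a weak derivative in `L²`. The weak derivative, which is unique up to null sets, is recorded
along with the function. Only the values on the intervals of the edges matter. -/
structure H1 (G : MetricGraph) where
  toFun : G.Edge → ℝ → ℂ
  weakDeriv : G.Edge → ℝ → ℂ
  continuous : G.IsContinuous toFun
  memLp : ∀ e, MemLp (toFun e) 2 (volume.restrict (G.interval e))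
  memLp_weakDeriv : ∀ e, MemLp (weakDeriv e) 2 (volume.restrict (G.interval e))
  hasWeakDerivOn : ∀ e, HasWeakDerivOn (toFun e) (weakDeriv e) (G.interval e)

/-- The integral over the graph `G` of a function given edge by edge. -/
noncomputable def integral (G : MetricGraph) (f : G.Edge → ℝ → ℝ) : ℝ :=
  ∑ e, ∫ x in G.interval e, f e x

/-- The mass `‖u‖²` in `L²(G)`. -/
noncomputable def mass {G : MetricGraph} (u : G.H1) : ℝ :=
  G.integral fun e x => ‖u.toFun e x‖ ^ 2

/-- The NLS energy `E(u, G) = ½ ∫ |u'|² - (1/p) ∫ |u|^p`. -/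
noncomputable def energy {G : MetricGraph} (p : ℝ) (u : G.H1) : ℝ :=
  1 / 2 * G.integral (fun e x => ‖u.weakDeriv e x‖ ^ 2) -
    1 / p * G.integral (fun e x => ‖u.toFun e x‖ ^ p)

/-- `G` has a ground state at mass `μ`: a minimizer of the energy among the functions of `H¹(G)`
with mass `μ`. -/
def HasGroundState (G : MetricGraph) (p μ : ℝ) : Prop :=
  ∃ u : G.H1, mass u = μ ∧ ∀ v : G.H1, mass v = μ → energy p u ≤ energy p v

/-- Three halflines and one terminal edge of length `ℓ` (for `0 < ℓ`), all emanating from a common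
vertex. The edge `some i` is a halfline and the edge `none` is the terminal edge; the vertex `none`
is the common vertex and `some e` is the other endpoint of the edge `e`. -/
noncomputable def threeHalflinesWithPendant (ℓ : ℝ) : MetricGraph where
  Vertex := Option (Option (Fin 3))
  Edge := Option (Fin 3)
  src _ := none
  tgt e := some e
  infinity := {v | ∃ i : Fin 3, v = some (some i)}
  length e := e.elim (ENNReal.ofReal ℓ) fun _ => ⊤
  infinity_nonempty := ⟨some (some 0), 0, rfl⟩
  src_notMem_infinity := by simp
  degree_infinity := by
    rintro _ ⟨i, rfl⟩
    exact ⟨some i, rfl, fun e he => Option.some.inj he⟩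
  length_eq_top_iff := by
    rintro (_ | i) <;> simp

end MetricGraph

/-! Rearrange |u| into a nonincreasing function `w` on (0,∞), a profile. Mass and L^p norm are
preserved. Where the levels of |u| are crossed at least N times, Cauchy–Schwarz shows that the
kinetic energy of u is at least N² times that of `w` (`exists_weightedKinetic_rearrangement_le`).

If |u| attains its maximum on the pendant, every level is crossed at least once. A level whose
superlevel set has measure more than ℓ is crossed three times, because that set spills onto a
halfline. So E(u) is at least the energy of a profile with kinetic weight 1 on (0,ℓ) and 9 beyond.
Every such profile energy is realised (`exists_H1_pendant`): the pendant carries the part on (0,ℓ)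
with the maximum at its tip, and the three halflines share the rest.

Otherwise some halfline carries the highest values, and every level is crossed at least twice. The
weight is then 4, that of x ↦ w(2|x|) on the real line, so E(u) is at least `lineLevel`. Bumps moved
far out on a halfline approach this level (`exists_H1_far`).

Hence a ground state exists if and only if some profile with weights 1 and 9 has energy at most
`lineLevel`. If such a profile exists, the infimum over profiles is attained
(`ProfileEnergyLE.of_forall_pos`): monotonicity gives uniform decay, and mass lost in the limit is
restored by scaling up, which does not raise a negative energy. Conversely, the maximum of a ground
state must lie on the pendant. If it did not and u were nonzero at the vertex, the levels below its
value there would be crossed three times, so E(u) would exceed `lineLevel` strictly. If u vanishes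
at the vertex, minimality forces u = 0 on the halflines (`eq_zero_of_zero`), a contradiction.

The admissible lengths form a closed halfline (`exists_critical_length`). A longer pendant lowers
the weight. For large ℓ the weight is essentially 1 < 4, for small ℓ essentially 9 > 4. A dilation
gives closedness from the right.

Both the passage to the limit and the rearrangement rest on the inequality m (w s - w t)² ≤ (t -
s)(Φ t - Φ s) with Φ monotone. It yields absolute continuity and the bound of the derivative
(`integral_deriv_of_sq_sub_le`), in place of weak compactness and the coarea formula. -/

open Set Filter Topology

/-! ### Functions whose squared increments are controlled by a monotone function -/

/-- Increments of a monotone function over disjoint intervals add up to at most the total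
increment. -/
theorem MonotoneOn.sum_dist_le_of_mem_disjWithin {f : ℝ → ℝ} {a b : ℝ} (hab : a ≤ b)
    (hf : MonotoneOn f (Icc a b)) {E : ℕ × (ℕ → ℝ × ℝ)}
    (hE : E ∈ AbsolutelyContinuousOnInterval.disjWithin a b) :
    ∑ i ∈ Finset.range E.1, dist (f (E.2 i).1) (f (E.2 i).2) ≤ f b - f a := by
  obtain ⟨hmem, hdisj⟩ := hE
  rw [uIcc_of_le hab] at hmem
  have hab' : f a ≤ f b := hf ⟨le_rfl, hab⟩ ⟨hab, le_rfl⟩ hab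
  -- The images under a monotone map of disjoint intervals are again disjoint, so the increments add
  -- up as Lebesgue measures inside (f a, f b].
  have key : volume (⋃ i ∈ Finset.range E.1, uIoc (f (E.2 i).1) (f (E.2 i).2)) =
      ∑ i ∈ Finset.range E.1, volume (uIoc (f (E.2 i).1) (f (E.2 i).2)) := by
    refine measure_biUnion_finset (fun i hi j hj hij => ?_) fun i _ => measurableSet_uIoc
    have hd : Disjoint (uIoc (E.2 i).1 (E.2 i).2) (uIoc (E.2 j).1 (E.2 j).2) := hdisj hi hj hij
    have hm : ∀ x ∈ Icc a b, ∀ y ∈ Icc a b, f (min x y) = min (f x) (f y) ∧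
        f (max x y) = max (f x) (f y) := fun x hx y hy => by
      rcases le_total x y with h | h
      · have := hf hx hy h
        simp [h, this]
      · have := hf hy hx h
        simp [h, this]
    obtain ⟨h1, h2⟩ := hm _ (hmem i hi).1 _ (hmem i hi).2
    obtain ⟨h3, h4⟩ := hm _ (hmem j hj).1 _ (hmem j hj).2
    have mm : ∀ x ∈ Icc a b, ∀ y ∈ Icc a b, min x y ∈ Icc a b ∧ max x y ∈ Icc a b :=
      fun x hx y hy => ⟨⟨le_min hx.1 hy.1, (min_le_left _ _).trans hx.2⟩,
        ⟨hx.1.trans (le_max_left _ _), max_le hx.2 hy.2⟩⟩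
    obtain ⟨m1, m2⟩ := mm _ (hmem i hi).1 _ (hmem i hi).2
    obtain ⟨m3, m4⟩ := mm _ (hmem j hj).1 _ (hmem j hj).2
    change Disjoint (uIoc _ _) (uIoc _ _)
    simp only [uIoc] at hd ⊢
    rw [← h1, ← h2, ← h3, ← h4]
    generalize min (E.2 i).1 (E.2 i).2 = x at *
    generalize max (E.2 i).1 (E.2 i).2 = y at *
    generalize min (E.2 j).1 (E.2 j).2 = x' at *
    generalize max (E.2 j).1 (E.2 j).2 = y' at *
    rw [Set.Ioc_disjoint_Ioc] at hd ⊢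
    rcases le_total y y' with h | h
    · rw [min_eq_left h] at hd
      rcases le_max_iff.1 hd with h' | h'
      · exact (min_le_left _ _).trans ((hf m2 m1 h').trans (le_max_left _ _))
      · exact (min_le_left _ _).trans ((hf m2 m3 h').trans (le_max_right _ _))
    · rw [min_eq_right h] at hd
      rcases le_max_iff.1 hd with h' | h'
      · exact (min_le_right _ _).trans ((hf m4 m1 h').trans (le_max_left _ _))
      · exact (min_le_right _ _).trans ((hf m4 m3 h').trans (le_max_right _ _))
  have hle : volume (⋃ i ∈ Finset.range E.1, uIoc (f (E.2 i).1) (f (E.2 i).2)) ≤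
      volume (Ioc (f a) (f b)) := by
    refine measure_mono (iUnion₂_subset fun i hi => ?_)
    have A := hmem i hi
    refine Ioc_subset_Ioc (le_min ?_ ?_) (max_le ?_ ?_)
    · exact hf ⟨le_rfl, hab⟩ A.1 A.1.1
    · exact hf ⟨le_rfl, hab⟩ A.2 A.2.1
    · exact hf A.1 ⟨hab, le_rfl⟩ A.1.2
    · exact hf A.2 ⟨hab, le_rfl⟩ A.2.2
  rw [key, Real.volume_Ioc] at hle
  have e : ∀ i, volume (uIoc (f (E.2 i).1) (f (E.2 i).2)) =
      ENNReal.ofReal (dist (f (E.2 i).1) (f (E.2 i).2)) := fun i => by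
    simp [uIoc, Real.dist_eq, max_sub_min_eq_abs']
  simp_rw [e] at hle
  rw [← ENNReal.ofReal_sum_of_nonneg (fun _ _ => dist_nonneg)] at hle
  exact (ENNReal.ofReal_le_ofReal_iff (sub_nonneg.2 hab')).1 hle

/-- Cauchy–Schwarz over disjoint intervals: m (Σ|Δw|)² ≤ (ΣΔt)(ΣΔΦ), and ΣΔΦ never exceeds the total
increment of Φ. -/
theorem absolutelyContinuousOnInterval_of_sq_sub_le {w Φ : ℝ → ℝ} {a b m : ℝ} (hab : a ≤ b)
    (hm : 0 < m) (hΦ : MonotoneOn Φ (Icc a b))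
    (h : ∀ s t, a ≤ s → s ≤ t → t ≤ b → m * (w s - w t) ^ 2 ≤ (t - s) * (Φ t - Φ s)) :
    AbsolutelyContinuousOnInterval w a b := by
  rw [absolutelyContinuousOnInterval_iff]
  intro ε hε
  set T := Φ b - Φ a with hT
  have hT0 : 0 ≤ T := sub_nonneg.2 (hΦ ⟨le_rfl, hab⟩ ⟨hab, le_rfl⟩ hab)
  -- `T + 1` instead of `T`, since Φ may be constant.
  refine ⟨m * ε ^ 2 / (T + 1), by positivity, fun E hE hlt => ?_⟩
  have hsum := hΦ.sum_dist_le_of_mem_disjWithin hab hE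
  have hmem := hE.1
  rw [uIcc_of_le hab] at hmem
  have hterm : ∀ i ∈ Finset.range E.1, m * dist (w (E.2 i).1) (w (E.2 i).2) ^ 2 ≤
      dist (E.2 i).1 (E.2 i).2 * dist (Φ (E.2 i).1) (Φ (E.2 i).2) := by
    intro i hi
    obtain ⟨⟨h1, h2⟩, h3, h4⟩ := hmem i hi
    have key : ∀ s t, a ≤ s → s ≤ t → t ≤ b → m * dist (w s) (w t) ^ 2 ≤
        dist s t * dist (Φ s) (Φ t) := by
      intro s t hs hst ht
      have e1 : dist (Φ s) (Φ t) = Φ t - Φ s := by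
        rw [dist_comm, Real.dist_eq, abs_of_nonneg]
        exact sub_nonneg.2 (hΦ ⟨hs, hst.trans ht⟩ ⟨hs.trans hst, ht⟩ hst)
      have e2 : dist s t = t - s := by
        rw [dist_comm, Real.dist_eq, abs_of_nonneg (sub_nonneg.2 hst)]
      rw [e1, e2, Real.dist_eq, sq_abs]
      exact h s t hs hst ht
    rcases le_total (E.2 i).1 (E.2 i).2 with hle | hle
    · exact key _ _ h1 hle h4
    · rw [dist_comm, dist_comm (E.2 i).1, dist_comm (Φ _)]
      exact key _ _ h3 hle h2
  set W := ∑ i ∈ Finset.range E.1, dist (w (E.2 i).1) (w (E.2 i).2) with hW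
  have hW0 : 0 ≤ W := Finset.sum_nonneg fun _ _ => dist_nonneg
  have hCS : m * W ^ 2 ≤ (∑ i ∈ Finset.range E.1, dist (E.2 i).1 (E.2 i).2) *
      ∑ i ∈ Finset.range E.1, dist (Φ (E.2 i).1) (Φ (E.2 i).2) := by
    have h1 : W ≤ ∑ i ∈ Finset.range E.1, √(dist (E.2 i).1 (E.2 i).2 / m) *
        √(dist (Φ (E.2 i).1) (Φ (E.2 i).2)) := by
      refine Finset.sum_le_sum fun i hi => ?_
      rw [← Real.sqrt_mul (by positivity)]
      refine Real.le_sqrt_of_sq_le ?_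
      rw [div_mul_eq_mul_div, le_div_iff₀ hm, mul_comm]
      exact hterm i hi
    have h2 := (pow_le_pow_left₀ hW0 h1 2).trans
      (Finset.sum_mul_sq_le_sq_mul_sq (Finset.range E.1) _ _)
    simp only [Real.sq_sqrt, dist_nonneg, div_nonneg, hm.le, ← Finset.sum_div] at h2
    calc m * W ^ 2 ≤ m * ((∑ i ∈ Finset.range E.1, dist (E.2 i).1 (E.2 i).2) / m *
      ∑ i ∈ Finset.range E.1, dist (Φ (E.2 i).1) (Φ (E.2 i).2)) := by gcongr
      _ = _ := by field_simp
  have : m * W ^ 2 < m * ε ^ 2 := by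
    have hd0 : 0 ≤ ∑ i ∈ Finset.range E.1, dist (E.2 i).1 (E.2 i).2 :=
      Finset.sum_nonneg fun _ _ => dist_nonneg
    calc m * W ^ 2 ≤ (∑ i ∈ Finset.range E.1, dist (E.2 i).1 (E.2 i).2) * (T + 1) :=
          hCS.trans (by gcongr; linarith)
      _ < m * ε ^ 2 / (T + 1) * (T + 1) := by gcongr
      _ = m * ε ^ 2 := by field_simp
  have h3 : W ^ 2 < ε ^ 2 := lt_of_mul_lt_mul_left this hm.le
  exact lt_of_pow_lt_pow_left₀ 2 hε.le h3

/-- A function whose squared increments are controlled by `(t - s) (Φ t - Φ s)` with `Φ` monotone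
satisfies the fundamental theorem of calculus, and the square of its derivative is controlled by
the total increment of `Φ`. -/
theorem integral_deriv_of_sq_sub_le {w Φ : ℝ → ℝ} {a b m : ℝ} (hab : a ≤ b)
    (hm : 0 < m) (hΦ : MonotoneOn Φ (Icc a b))
    (h : ∀ s t, a ≤ s → s ≤ t → t ≤ b → m * (w s - w t) ^ 2 ≤ (t - s) * (Φ t - Φ s)) :
    (∫ x in a..b, deriv w x = w b - w a) ∧ IntegrableOn (deriv w) (Ioc a b) ∧
      IntegrableOn (fun x => deriv w x ^ 2) (Ioc a b) ∧
      m * ∫ x in Ioc a b, deriv w x ^ 2 ≤ Φ b - Φ a := by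
  have hac := absolutelyContinuousOnInterval_of_sq_sub_le hab hm hΦ h
  have hΦ' : MonotoneOn Φ (uIcc a b) := by rwa [uIcc_of_le hab]
  have hΦi : IntegrableOn (deriv Φ) (Ioc a b) := by
    have := hΦ'.intervalIntegrable_deriv
    rwa [intervalIntegrable_iff_integrableOn_Ioc_of_le hab] at this
  -- Only an inequality, as the singular part of Φ is lost; this is the direction needed.
  have hΦle : ∫ x in Ioc a b, deriv Φ x ≤ Φ b - Φ a := by
    have h1 := hΦ'.intervalIntegral_deriv_mem_uIcc
    rw [intervalIntegral.integral_of_le hab, uIcc_of_le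
      (sub_nonneg.2 (hΦ ⟨le_rfl, hab⟩ ⟨hab, le_rfl⟩ hab))] at h1
    exact h1.2
  -- Dividing the hypothesis by (y - x)² and letting y decrease to x gives m (w')² ≤ Φ' almost
  -- everywhere.
  have hpt : ∀ᵐ x ∂volume.restrict (Ioc a b), m * deriv w x ^ 2 ≤ deriv Φ x := by
    rw [← restrict_Ioo_eq_restrict_Ioc, ae_restrict_iff' measurableSet_Ioo]
    filter_upwards [hac.ae_differentiableAt, hΦ.ae_differentiableWithinAt_of_mem] with x h1 h2 hx
    have hx' : x ∈ Icc a b := Ioo_subset_Icc_self hx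
    have d1 := (h1 (by rwa [uIcc_of_le hab])).hasDerivAt
    have d2 := ((h2 hx').differentiableAt (Icc_mem_nhds hx.1 hx.2)).hasDerivAt
    rw [hasDerivAt_iff_tendsto_slope] at d1 d2
    have hle : (𝓝[>] x) ≤ 𝓝[≠] x := nhdsWithin_mono _ fun y hy => ne_of_gt hy
    refine le_of_tendsto_of_tendsto (((d1.mono_left hle).pow 2).const_mul m) (d2.mono_left hle) ?_
    filter_upwards [Ioc_mem_nhdsGT hx.2] with y hy
    have hy0 : 0 < y - x := sub_pos.2 hy.1
    have := h x y hx.1.le hy.1.le hy.2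
    rw [slope_def_field, slope_def_field, div_pow, le_div_iff₀ hy0]
    calc m * ((w y - w x) ^ 2 / (y - x) ^ 2) * (y - x) = m * (w x - w y) ^ 2 / (y - x) := by
          field_simp; ring
      _ ≤ (y - x) * (Φ y - Φ x) / (y - x) := by gcongr
      _ = Φ y - Φ x := by field_simp
  have hint : IntegrableOn (fun x => deriv w x ^ 2) (Ioc a b) := by
    refine Integrable.mono' (hΦi.div_const m)
        ((measurable_deriv w).pow_const 2).aestronglyMeasurable ?_
    filter_upwards [hpt] with x hx
    rw [Real.norm_of_nonneg (sq_nonneg _), le_div_iff₀ hm, mul_comm]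
    exact hx
  refine ⟨hac.integral_deriv_eq_sub, ?_, hint, ?_⟩
  · have := hac.intervalIntegrable_deriv
    rwa [intervalIntegrable_iff_integrableOn_Ioc_of_le hab] at this
  · rw [← integral_const_mul]
    exact (integral_mono_ae (hint.const_mul m) hΦi hpt).trans hΦle

/-- The kinetic energy on `(0, ∞)` with weight `a` up to `ℓ` and weight `b` beyond. -/
noncomputable def weightedKinetic (a b ℓ : ℝ) (g : ℝ → ℝ) : ℝ :=
  a * (∫ x in Ioc 0 ℓ, g x ^ 2) + b * ∫ x in Ioi ℓ, g x ^ 2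

/-- The increment of Φ on [0, ℓ] pays for the part with weight `a`, the increment on [ℓ, ∞) for the
part with weight `b`. Together they are at most `K`. Applied to the limit of a minimizing sequence
and to rearrangements. -/
theorem exists_weightedKinetic_le {w Φ : ℝ → ℝ} {a b ℓ K : ℝ} (hℓ : 0 ≤ ℓ) (ha : 0 < a)
    (hb : 0 < b) (hΦ : MonotoneOn Φ (Ici 0)) (hΦ0 : 0 ≤ Φ 0) (hΦK : ∀ s, 0 ≤ s → Φ s ≤ K)
    (h₁ : ∀ s t, 0 ≤ s → s ≤ t → t ≤ ℓ → a * (w s - w t) ^ 2 ≤ (t - s) * (Φ t - Φ s))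
    (h₂ : ∀ s t, ℓ ≤ s → s ≤ t → b * (w s - w t) ^ 2 ≤ (t - s) * (Φ t - Φ s)) :
    ∃ g : ℝ → ℝ, (∀ x, 0 ≤ x → w x = w 0 + ∫ t in (0)..x, g t) ∧
      MemLp g 2 (volume.restrict (Ioi 0)) ∧ weightedKinetic a b ℓ g ≤ K := by
  have I₁ := fun x (hx : 0 ≤ x) (hxℓ : x ≤ ℓ) => integral_deriv_of_sq_sub_le hx ha
    (hΦ.mono fun y hy => hy.1) fun s t hs hst ht => h₁ s t hs hst (ht.trans hxℓ)
  have I₂ := fun x (hx : ℓ ≤ x) => integral_deriv_of_sq_sub_le hx hb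
    (hΦ.mono fun y hy => hℓ.trans hy.1) fun s t hs hst _ => h₂ s t hs hst
  have hsq : IntegrableOn (fun x => deriv w x ^ 2) (Ioi ℓ) := by
    refine integrableOn_Ioi_of_intervalIntegral_norm_bounded (K / b) ℓ
      (b := id) (l := atTop) (fun x => ?_) tendsto_id ?_
    · rcases le_total ℓ x with hx | hx
      · exact (I₂ x hx).2.2.1
      · simp [Ioc_eq_empty_of_le hx]
    · filter_upwards [eventually_ge_atTop ℓ] with x hx
      rw [id, intervalIntegral.integral_of_le hx, le_div_iff₀ hb, mul_comm]
      simp only [norm_pow, Real.norm_eq_abs, sq_abs]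
      have := (I₂ x hx).2.2.2
      have := hΦK x (hℓ.trans hx)
      have := hΦ (mem_Ici.2 le_rfl) (mem_Ici.2 hℓ) hℓ
      linarith
  refine ⟨deriv w, fun x hx => ?_, ?_, ?_⟩
  · rcases le_total x ℓ with hxℓ | hxℓ
    · rw [(I₁ x hx hxℓ).1]; ring
    · have h0 := (I₁ ℓ hℓ le_rfl)
      have h1 := (I₂ x hxℓ)
      rw [← intervalIntegral.integral_add_adjacent_intervals (b := ℓ)
        ((intervalIntegrable_iff_integrableOn_Ioc_of_le hℓ).2 h0.2.1)
        ((intervalIntegrable_iff_integrableOn_Ioc_of_le hxℓ).2 h1.2.1), h0.1, h1.1]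
      ring
  · rw [memLp_two_iff_integrable_sq (measurable_deriv w).aestronglyMeasurable]
    have := ((I₁ ℓ hℓ le_rfl).2.2.1).union hsq
    rwa [Ioc_union_Ioi_eq_Ioi hℓ] at this
  · have h0 := (I₁ ℓ hℓ le_rfl).2.2.2
    have h1 : b * ∫ x in Ioi ℓ, deriv w x ^ 2 ≤ K - Φ ℓ := by
      have ht := (intervalIntegral_tendsto_integral_Ioi ℓ hsq tendsto_id).const_mul b
      refine le_of_tendsto ht ?_
      filter_upwards [eventually_ge_atTop ℓ] with x hx
      rw [id, intervalIntegral.integral_of_le hx]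
      have := (I₂ x hx).2.2.2
      have := hΦK x (hℓ.trans hx)

      linarith
    unfold weightedKinetic
    linarith

/-! ### The fundamental theorem of calculus for weak derivatives -/

namespace Real.smoothTransition

theorem deriv_eq_zero_of_notMem {x : ℝ} (hx : x ∉ Icc (0 : ℝ) 1) :
    deriv smoothTransition x = 0 := by
  rw [mem_Icc, not_and_or, not_le, not_le] at hx
  rcases hx with hx | hx
  · have : smoothTransition =ᶠ[𝓝 x] fun _ => 0 := by
      filter_upwards [Iio_mem_nhds hx] with y hy
      exact zero_of_nonpos (le_of_lt hy)
    rw [this.deriv_eq, deriv_const]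
  · have : smoothTransition =ᶠ[𝓝 x] fun _ => 1 := by
      filter_upwards [Ioi_mem_nhds hx] with y hy
      exact one_of_one_le (le_of_lt hy)
    rw [this.deriv_eq, deriv_const]

theorem continuous_deriv : Continuous (deriv smoothTransition) :=
  (Real.smoothTransition.contDiff (n := 1)).continuous_deriv le_rfl

theorem differentiable : Differentiable ℝ smoothTransition :=
  (Real.smoothTransition.contDiff (n := 1)).differentiable (by simp)

theorem integral_deriv : ∫ x, deriv smoothTransition x = 1 := by
  have h1 : ∫ x in Icc (0 : ℝ) 1, deriv smoothTransition x = ∫ x, deriv smoothTransition x :=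
    setIntegral_eq_integral_of_forall_compl_eq_zero fun x hx => deriv_eq_zero_of_notMem hx
  rw [← h1, integral_Icc_eq_integral_Ioc, ← intervalIntegral.integral_of_le zero_le_one,
    intervalIntegral.integral_eq_sub_of_hasDerivAt
      (fun x _ => (differentiable x).hasDerivAt) (continuous_deriv.intervalIntegrable _ _)]
  simp

end Real.smoothTransition

/-- The derivative of the smooth step is a compactly supported density of integral 1, so its
rescalings form an approximate identity at `x`. -/
theorem tendsto_integral_deriv_smoothTransition_smul {u : ℝ → ℂ} {x : ℝ} (hu : Integrable u)
    (hc : ContinuousAt u x) :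
    Tendsto (fun c : ℝ => ∫ s, (c * deriv Real.smoothTransition (c * (s - x))) • u s) atTop
      (𝓝 (u x)) := by
  have h := tendsto_integral_comp_smul_smul_of_integrable (μ := (volume : Measure ℝ))
    (φ := deriv Real.smoothTransition) (fun x => Real.smoothTransition.monotone.deriv_nonneg)
    Real.smoothTransition.integral_deriv (g := fun s => u (s + x)) ?_ (hu.comp_add_right x) ?_
  · simp only [zero_add] at h
    refine h.congr fun c => ?_
    rw [← integral_add_right_eq_self (μ := (volume : Measure ℝ))
      (fun s => (c * deriv Real.smoothTransition (c * (s - x))) • u s) x]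
    simp
  · have hz : ∀ᶠ x in Bornology.cobounded ℝ,
        ‖x‖ ^ Module.finrank ℝ ℝ * deriv Real.smoothTransition x = 0 := by
      filter_upwards [Bornology.isBounded_def.1
        (isCompact_Icc (a := (0 : ℝ)) (b := 1)).isBounded] with x hx
      rw [Real.smoothTransition.deriv_eq_zero_of_notMem hx, mul_zero]
    exact tendsto_const_nhds.congr' (hz.mono fun _ h => h.symm)
  · exact ContinuousAt.comp (g := u) (f := fun s => s + x) (by simpa using hc) (by fun_prop)

/-- The fundamental theorem of calculus for a continuous function with an integrable weak
derivative, in the interior of the interval. -/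
theorem HasWeakDerivOn.sub_eq_integral_of_mem_interior {u g : ℝ → ℂ} {I : Set ℝ}
    [hIc : I.OrdConnected] (hI : MeasurableSet I)
    (hu : ContinuousOn u I) (hg : LocallyIntegrableOn g I) (h : HasWeakDerivOn u g I) {x y : ℝ}
    (hxy : x ≤ y) (hx : x ∈ interior I) (hy : y ∈ interior I) :
    u y - u x = ∫ s in x..y, g s := by
  have hoc : (interior I).OrdConnected := hIc.convex.interior.ordConnected
  obtain ⟨δ, hδ, hδI⟩ : ∃ δ > 0, Icc x (y + δ) ⊆ interior I := by
    obtain ⟨δ, hδ, hb⟩ := Metric.isOpen_iff.1 isOpen_interior y hy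
    have hmem : y + δ / 2 ∈ interior I := hb (by
      rw [Metric.mem_ball, Real.dist_eq, add_sub_cancel_left, abs_of_pos (by linarith)]; linarith)
    exact ⟨δ / 2, by linarith, hoc.out hx hmem⟩
  obtain ⟨δ', hδ', hδI'⟩ : ∃ δ > 0, x - δ ∈ interior I := by
    obtain ⟨δ, hδ, hb⟩ := Metric.isOpen_iff.1 isOpen_interior x hx
    exact ⟨δ / 2, by linarith, hb (by
      rw [Metric.mem_ball, Real.dist_eq, sub_sub_cancel_left, abs_neg, abs_of_pos (by linarith)]
      linarith)⟩
  have hJ : Icc (x - δ') (y + δ) ⊆ interior I :=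
    hoc.out hδI' (hδI ⟨by linarith, le_rfl⟩)
  set J := Icc (x - δ') (y + δ) with hJdef
  set σ := Real.smoothTransition with hσ
  -- As c → ∞ this test function tends to the indicator of (x, y], and its derivative to the
  -- difference of the point masses at x and y. The weak identity then becomes the claim.
  set φ : ℝ → ℝ → ℝ := fun c s => σ (c * (s - x)) - σ (c * (s - y)) with hφ
  -- The descending step has width 1/c and starts at y; for c > 1/δ it ends before y + δ.
  have hφ0 : ∀ c, δ⁻¹ < c → ∀ s, s ∉ Icc x (y + δ) → φ c s = 0 := by
    intro c hc s hs
    have hc0 : 0 < c := (inv_pos.2 hδ).trans hc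
    rw [mem_Icc, not_and_or, not_le, not_le] at hs
    rcases hs with hs | hs
    · simp only [hφ]
      rw [hσ, Real.smoothTransition.zero_of_nonpos, Real.smoothTransition.zero_of_nonpos, sub_zero]
      · exact mul_nonpos_of_nonneg_of_nonpos hc0.le (by linarith)
      · exact mul_nonpos_of_nonneg_of_nonpos hc0.le (by linarith)
    · have : 1 < c * δ := by rwa [inv_lt_iff_one_lt_mul₀ hδ] at hc
      simp only [hφ]
      rw [hσ, Real.smoothTransition.one_of_one_le, Real.smoothTransition.one_of_one_le, sub_self]
      · nlinarith
      · nlinarith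
  have hφd : ∀ c s, HasDerivAt (φ c) (c * deriv σ (c * (s - x)) - c * deriv σ (c * (s - y))) s := by
    intro c s
    have : ∀ z, HasDerivAt (fun s => σ (c * (s - z))) (c * deriv σ (c * (s - z))) s := fun z => by
      have h1 : HasDerivAt (fun s => c * (s - z)) (c * 1) s :=
        ((hasDerivAt_id s).sub_const z).const_mul c
      have h2 := (Real.smoothTransition.differentiable (c * (s - z))).hasDerivAt.comp s h1
      rw [mul_one, mul_comm] at h2
      exact h2
    exact (this x).sub (this y)
  have hφs : ∀ c, ContDiff ℝ ∞ (φ c) := fun c => by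
    have : ∀ z, ContDiff ℝ ∞ (fun s => σ (c * (s - z))) := fun z =>
      (Real.smoothTransition.contDiff (n := ⊤)).comp
          (contDiff_const.mul (contDiff_id.sub contDiff_const))
    exact (this x).sub (this y)
  have hφsupp : ∀ c, δ⁻¹ < c → tsupport (φ c) ⊆ Icc x (y + δ) := fun c hc =>
    closure_minimal (fun s hs => by_contra fun h => hs (hφ0 c hc s h)) isClosed_Icc
  have hId : Icc x (y + δ) ⊆ J := Icc_subset_Icc_left (by linarith)
  have hJI : J ⊆ I := hJ.trans interior_subset
  set v := J.indicator u with hv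
  have hvint : Integrable v :=
    ((hu.mono hJI).integrableOn_compact isCompact_Icc).integrable_indicator measurableSet_Icc
  have hvc : ∀ z ∈ Ioo (x - δ') (y + δ), ContinuousAt v z := fun z hz => by
    have hn : J ∈ 𝓝 z := Icc_mem_nhds hz.1 hz.2
    have : v =ᶠ[𝓝 z] u := by
      filter_upwards [hn] with s hs
      exact indicator_of_mem hs u
    exact (hu.continuousAt (mem_of_superset hn hJI)).congr this.symm
  have hxJ : x ∈ Ioo (x - δ') (y + δ) := ⟨by linarith, by linarith⟩
  have hyJ : y ∈ Ioo (x - δ') (y + δ) := ⟨by linarith, by linarith⟩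
  have hlim := (tendsto_integral_deriv_smoothTransition_smul hvint (hvc x hxJ)).sub
    (tendsto_integral_deriv_smoothTransition_smul hvint (hvc y hyJ))
  have hint : ∀ c z, Integrable fun s => (c * deriv σ (c * (s - z))) • v s := fun c z => by
    have h1 : Continuous fun s => c * deriv σ (c * (s - z)) := by
      have := Real.smoothTransition.continuous_deriv
      fun_prop
    have h2 := ((h1.continuousOn (s := J)).smul (hu.mono hJI)).integrableOn_compact isCompact_Icc
      (μ := volume)
    have h3 := h2.integrable_indicator measurableSet_Icc
    refine h3.congr (ae_of_all _ fun s => ?_)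
    change J.indicator _ s = _
    by_cases hs : s ∈ J
    · simp [hv, hs]
    · simp [hv, hs]
  have hgJ : IntegrableOn g J := hg.integrableOn_compact_subset hJI isCompact_Icc
  have hgint : Integrable (J.indicator g) := hgJ.integrable_indicator measurableSet_Icc
  have heq : ∀ᶠ c in atTop, (∫ s, (c * deriv σ (c * (s - x))) • v s) -
      (∫ s, (c * deriv σ (c * (s - y))) • v s) = -∫ s, φ c s • J.indicator g s := by
    filter_upwards [eventually_gt_atTop δ⁻¹] with c hc
    have ht := h (φ c) (hφs c) (HasCompactSupport.of_support_subset_isCompact isCompact_Icc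
      ((subset_tsupport _).trans (hφsupp c hc))) ((hφsupp c hc).trans (hId.trans hJ))
    rw [← integral_sub (hint c x) (hint c y)]
    have hd0 : ∀ s, s ∉ J → deriv (φ c) s = 0 := fun s hs => by
      by_contra hne
      exact hs (hId (hφsupp c hc (tsupport_deriv_subset (subset_tsupport _ hne))))
    have e1 : ∫ s in I, deriv (φ c) s • u s = ∫ s, (c * deriv σ (c * (s - x))) • v s -
        (c * deriv σ (c * (s - y))) • v s := by
      rw [← integral_indicator hI]
      refine integral_congr_ae (ae_of_all _ fun s => ?_)
      by_cases hs : s ∈ J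
      · simp only [indicator_of_mem (hJI hs), hv, indicator_of_mem hs, (hφd c s).deriv, sub_smul]
      · have : v s = 0 := indicator_of_notMem hs u
        simp [this, hd0 s hs, indicator]
    have e2 : ∫ s in I, φ c s • g s = ∫ s, φ c s • J.indicator g s := by
      rw [← integral_indicator hI]
      refine integral_congr_ae (ae_of_all _ fun s => ?_)
      by_cases hs : s ∈ J
      · simp only [indicator_of_mem (hJI hs), indicator_of_mem hs]
      · simp [hs, hφ0 c hc s fun h => hs (hId h), indicator]
    rw [← e1, ht, e2]
  have hdct : Tendsto (fun c => ∫ s, φ c s • J.indicator g s) atTop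
      (𝓝 (∫ s, (Ioc x y).indicator g s)) := by
    refine tendsto_integral_filter_of_dominated_convergence (fun s => ‖J.indicator g s‖)
      (Eventually.of_forall fun c => ((hφs c).continuous.aestronglyMeasurable).smul
        hgint.aestronglyMeasurable) ?_ hgint.norm (ae_of_all _ fun s => ?_)
    · refine Eventually.of_forall fun c => ae_of_all _ fun s => ?_
      rw [norm_smul]
      refine mul_le_of_le_one_left (norm_nonneg _) ?_
      have := Real.smoothTransition.nonneg (c * (s - x))
      have := Real.smoothTransition.nonneg (c * (s - y))
      have := Real.smoothTransition.le_one (c * (s - x))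
      have := Real.smoothTransition.le_one (c * (s - y))
      rw [Real.norm_eq_abs, abs_le]
      simp only [hφ, hσ]
      constructor <;> linarith
    · have hone : ∀ z, z < s → ∀ᶠ c in atTop, σ (c * (s - z)) = 1 := fun z hz => by
        filter_upwards [eventually_ge_atTop (s - z)⁻¹] with c hc
        refine Real.smoothTransition.one_of_one_le ?_
        rwa [inv_le_iff_one_le_mul₀ (sub_pos.2 hz)] at hc
      have hzero : ∀ z, s ≤ z → ∀ᶠ c in atTop, σ (c * (s - z)) = 0 := fun z hz => by
        filter_upwards [eventually_ge_atTop 0] with c hc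
        exact Real.smoothTransition.zero_of_nonpos
          (mul_nonpos_of_nonneg_of_nonpos hc (sub_nonpos.2 hz))
      refine tendsto_const_nhds.congr' ?_
      by_cases hs : s ∈ Ioc x y
      · have hsJ : s ∈ J := hId ⟨hs.1.le, hs.2.trans (by linarith)⟩
        filter_upwards [hone x hs.1, hzero y hs.2] with c h1 h2
        simp [hφ, h1, h2, hs, hsJ]
      · rw [mem_Ioc, not_and_or, not_lt, not_le] at hs
        rw [indicator_of_notMem (by rw [mem_Ioc, not_and_or, not_lt, not_le]; exact hs)]
        rcases hs with hs | hs
        · filter_upwards [hzero x hs, hzero y (hs.trans hxy)] with c h1 h2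
          simp [hφ, h1, h2]
        · filter_upwards [hone x (hxy.trans_lt hs), hone y hs] with c h1 h2
          simp [hφ, h1, h2]
  have := tendsto_nhds_unique (hlim.congr' heq) hdct.neg
  rw [hv, indicator_of_mem (hId ⟨le_rfl, by linarith⟩), indicator_of_mem (hId ⟨hxy, by linarith⟩),
    integral_indicator measurableSet_Ioc, ← intervalIntegral.integral_of_le hxy] at this
  linear_combination -this

/-- Both sides are continuous up to the endpoints, and an interval with nonempty interior lies in
the closure of that interior. -/
theorem HasWeakDerivOn.sub_eq_integral {u g : ℝ → ℂ} {I : Set ℝ} [hIc : I.OrdConnected]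
    (hI : IsClosed I) (hne : (interior I).Nonempty)
    (hu : ContinuousOn u I) (hg : LocallyIntegrableOn g I) (h : HasWeakDerivOn u g I) {x y : ℝ}
    (hx : x ∈ I) (hy : y ∈ I) :
    u y - u x = ∫ s in x..y, g s := by
  obtain ⟨z, hz⟩ := hne
  have hgi : ∀ a ∈ I, ∀ b ∈ I, IntervalIntegrable g volume a b := fun a ha b hb =>
    (hg.integrableOn_compact_subset (hIc.uIcc_subset ha hb) isCompact_uIcc).intervalIntegrable
  have hzI := interior_subset hz
  have key : ∀ y ∈ interior I, u y = u z + ∫ s in z..y, g s := fun y hy => by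
    rcases le_total z y with hle | hle
    · rw [← h.sub_eq_integral_of_mem_interior hI.measurableSet hu hg hle hz hy]; ring
    · rw [intervalIntegral.integral_symm,
        ← h.sub_eq_integral_of_mem_interior hI.measurableSet hu hg hle hy hz]; ring
  have hcl : I ⊆ closure (interior I) := by
    have hconv : Convex ℝ I := hIc.convex
    rw [hconv.closure_interior_eq_closure_of_nonempty_interior ⟨z, hz⟩]
    exact subset_closure
  have key' : ∀ y ∈ I, u y = u z + ∫ s in z..y, g s := fun y hy => by
    have hc2 : ContinuousOn (fun y => u z + ∫ s in z..y, g s) (uIcc z y) :=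
      continuousOn_const.add (intervalIntegral.continuousOn_primitive_interval
        (hg.integrableOn_compact_subset (hIc.uIcc_subset hzI hy) isCompact_uIcc))
    have hc1 : ContinuousOn u (uIcc z y) := hu.mono (hIc.uIcc_subset hzI hy)
    rcases eq_or_ne z y with rfl | hne
    · simp
    · have hsub : uIoo z y ⊆ interior I :=
        interior_maximal ((Ioo_subset_Icc_self).trans (hIc.uIcc_subset hzI hy)) isOpen_Ioo
      have hyc : y ∈ closure (uIoo z y) := by
        rw [uIoo, closure_Ioo (by simpa using hne)]
        exact right_mem_uIcc
      have hmono : uIoo z y ⊆ uIcc z y := Ioo_subset_Icc_self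
      have := mem_closure_iff_nhdsWithin_neBot.1 hyc
      have t1 := (hc1 y right_mem_uIcc).mono_left (nhdsWithin_mono y hmono)
      have t2 := (hc2 y right_mem_uIcc).mono_left (nhdsWithin_mono y hmono)
      refine tendsto_nhds_unique t1 (t2.congr' ?_)
      filter_upwards [self_mem_nhdsWithin] with s hs
      exact (key s (hsub hs)).symm
  rw [key' x hx, key' y hy, ← intervalIntegral.integral_add_adjacent_intervals (hgi x hx z hzI)
    (hgi z hzI y hy), intervalIntegral.integral_symm z x]
  ring

/-- A primitive of `g` has the weak derivative `g`. -/
theorem hasWeakDerivOn_of_eq_integral {u g : ℝ → ℂ} {I : Set ℝ} [hIc : I.OrdConnected]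
    (hI : MeasurableSet I) (hg : LocallyIntegrableOn g I) {x₀ : ℝ} (hx₀ : x₀ ∈ I)
    (hu : ∀ x ∈ I, u x = u x₀ + ∫ s in x₀..x, g s) : HasWeakDerivOn u g I := by
  intro φ hφ hφc hφs
  have hφI : tsupport φ ⊆ I := hφs.trans interior_subset
  obtain ⟨a, b, hab, ha, hb, hsupp⟩ : ∃ a b, a ≤ b ∧ a ∈ I ∧ b ∈ I ∧
      ∀ s, s ∉ Ioc a b → φ s = 0 ∧ deriv φ s = 0 := by
    rcases (tsupport φ).eq_empty_or_nonempty with he | hne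
    · refine ⟨x₀, x₀, le_rfl, hx₀, hx₀, fun s _ => ?_⟩
      have : φ = 0 := tsupport_eq_empty_iff.1 he
      simp [this]
    · have hK : IsCompact (tsupport φ) := hφc
      obtain ⟨m, hm, hmle⟩ := hK.exists_isLeast hne
      obtain ⟨M, hM, hMge⟩ := hK.exists_isGreatest hne
      obtain ⟨δ, hδ, hball⟩ := Metric.isOpen_iff.1 isOpen_interior m (hφs hm)
      have hmem : m - δ / 2 ∈ I := interior_subset (hball (by
        rw [Metric.mem_ball, Real.dist_eq, sub_sub_cancel_left, abs_neg, abs_of_pos (by linarith)]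
        linarith))
      have hmM := hmle hM
      refine ⟨m - δ / 2, M, by linarith, hmem, hφI hM, fun s hs => ?_⟩
      have hs' : s ∉ tsupport φ := fun h => hs ⟨by have := hmle h; linarith, hMge h⟩
      exact ⟨image_eq_zero_of_notMem_tsupport hs', by_contra fun hne =>
        hs' (tsupport_deriv_subset (subset_tsupport _ hne))⟩
  have hsub : Icc a b ⊆ I := hIc.out ha hb
  have hgab : IntegrableOn g (Icc a b) := hg.integrableOn_compact_subset hsub isCompact_Icc
  have hgi : IntervalIntegrable g volume a b := by
    rw [intervalIntegrable_iff_integrableOn_Icc_of_le hab]; exact hgab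
  have hgi' : ∀ a ∈ I, ∀ b ∈ I, IntervalIntegrable g volume a b := fun a ha b hb =>
    (hg.integrableOn_compact_subset (hIc.uIcc_subset ha hb) isCompact_uIcc).intervalIntegrable
  have e : ∀ f : ℝ → ℂ, ∀ ψ : ℝ → ℝ, (∀ s, s ∉ Ioc a b → ψ s = 0) →
      ∫ s in I, ψ s • f s = ∫ s in a..b, ψ s • f s := fun f ψ hψ => by
    rw [intervalIntegral.integral_of_le hab]
    refine setIntegral_eq_of_subset_of_forall_sdiff_eq_zero hI
      (Ioc_subset_Icc_self.trans hsub) fun s hs => ?_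
    rw [hψ s hs.2, zero_smul]
  rw [e _ _ fun s hs => (hsupp s hs).2, e _ _ fun s hs => (hsupp s hs).1]
  have hu' : ∀ x ∈ Icc a b, u x = u a + ∫ s in a..x, g s := fun x hx => by
    rw [hu x (hsub hx), hu a ha, ← intervalIntegral.integral_add_adjacent_intervals
      (hgi' x₀ hx₀ a ha) (hgi' a ha x (hsub hx))]
    ring
  have hcu : ContinuousOn u (Icc a b) := by
    have := intervalIntegral.continuousOn_primitive_interval (μ := volume)
      (f := g) (a := a) (b := b) (by rwa [uIcc_of_le hab])
    rw [uIcc_of_le hab] at this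
    exact (continuousOn_const.add this).congr hu'
  have hφa : φ a = 0 := (hsupp a fun h => lt_irrefl _ h.1).1
  -- The point b belongs to `Ioc a b`, so φ b = 0 comes from the values to its right.
  have hφb : φ b = 0 := by
    have hc : ContinuousWithinAt φ (Ioi b) b := hφ.continuous.continuousWithinAt
    refine tendsto_nhds_unique hc (tendsto_const_nhds.congr' ?_)
    filter_upwards [self_mem_nhdsWithin] with s hs
    exact ((hsupp s fun h => not_le.2 hs h.2).1).symm
  have hφcont : Continuous φ := hφ.continuous
  have hφd : Continuous (deriv φ) := hφ.continuous_deriv (by simp)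
  have hφac : AbsolutelyContinuousOnInterval φ a b :=
    (hφ.of_le (by simp) : ContDiff ℝ 1 φ).contDiffOn.absolutelyContinuousOnInterval
  -- Integration by parts for absolutely continuous real functions, applied to the real and
  -- imaginary parts.
  have hpart : ∀ L : ℂ →L[ℝ] ℝ, L (∫ s in a..b, deriv φ s • u s) =
      L (-∫ s in a..b, φ s • g s) := fun L => by
    have hLg : IntervalIntegrable (fun s => L (g s)) volume a b := by
      rw [intervalIntegrable_iff_integrableOn_Icc_of_le hab]
      exact L.integrable_comp hgab
    set G : ℝ → ℝ := fun x => ∫ s in a..x, L (g s) with hG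
    have hGac : AbsolutelyContinuousOnInterval (fun x => ∫ s in a..x, L (g s)) a b :=
      hLg.absolutelyContinuousOnInterval_intervalIntegral (by simp)
    have hGu : ∀ x ∈ Icc a b, L (u x) = L (u a) + G x := fun x hx => by
      rw [hu' x hx, map_add, ← L.intervalIntegral_comp_comm (hgi' a ha x (hsub hx))]
    have hGi : IntervalIntegrable (fun s => deriv φ s * G s) volume a b := by
      refine ContinuousOn.intervalIntegrable ?_
      exact hφd.continuousOn.mul hGac.continuousOn
    have ibp := hGac.integral_mul_deriv_eq_deriv_mul hφac
    rw [hφa, hφb, mul_zero, mul_zero, sub_zero, zero_sub] at ibp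
    have hGd : ∫ x in a..b, deriv (fun x => ∫ s in a..x, L (g s)) x * φ x =
        ∫ x in a..b, φ x * L (g x) := by
      refine intervalIntegral.integral_congr_ae ?_
      filter_upwards [hLg.ae_hasDerivAt_integral] with x hx hxI
      rw [(hx (uIoc_subset_uIcc hxI) a left_mem_uIcc).deriv, mul_comm]
    have hdu : IntervalIntegrable (fun s => deriv φ s • u s) volume a b := by
      refine ContinuousOn.intervalIntegrable ?_
      rw [uIcc_of_le hab]
      exact hφd.continuousOn.smul hcu
    have hφg : IntervalIntegrable (fun s => φ s • g s) volume a b :=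
      hgi.continuousOn_smul hφcont.continuousOn
    rw [map_neg, ← L.intervalIntegral_comp_comm hdu, ← L.intervalIntegral_comp_comm hφg]
    have e1 : ∫ x in a..b, L (deriv φ x • u x) =
        (∫ x in a..b, deriv φ x * L (u a)) + ∫ x in a..b, deriv φ x * G x := by
      rw [← intervalIntegral.integral_add ((hφd.intervalIntegrable _ _).mul_const _) hGi]
      refine intervalIntegral.integral_congr fun x hx => ?_
      rw [uIcc_of_le hab] at hx
      simp only [map_smul, smul_eq_mul]
      rw [hGu x hx]
      ring
    have e2 : ∫ x in a..b, deriv φ x = 0 := by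
      rw [hφac.integral_deriv_eq_sub, hφa, hφb, sub_zero]
    have e3 : ∫ x in a..b, deriv φ x * G x = -∫ x in a..b, φ x * L (g x) := by
      rw [← hGd, ← ibp]
      exact intervalIntegral.integral_congr fun x _ => mul_comm _ _
    rw [e1, intervalIntegral.integral_mul_const, e2, zero_mul, zero_add, e3]
    simp only [map_smul, smul_eq_mul]
  exact Complex.ext (hpart Complex.reCLM) (hpart Complex.imCLM)

/-- The quadratic polynomial t ↦ ∫ (h - t)² is nonnegative, so its discriminant is not positive. -/
theorem sq_integral_le_measure_mul_integral_sq {α : Type*} [MeasurableSpace α] {ν : Measure α}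
    [IsFiniteMeasure ν] {h : α → ℝ} (hh : MemLp h 2 ν) :
    (∫ x, h x ∂ν) ^ 2 ≤ ν.real univ * ∫ x, h x ^ 2 ∂ν := by
  have h1 : Integrable h ν := hh.integrable (by norm_num)
  have h2 : Integrable (fun x => h x ^ 2) ν := hh.integrable_sq
  have key : ∀ t : ℝ, 0 ≤ ν.real univ * (t * t) + (-2 * ∫ x, h x ∂ν) * t + ∫ x, h x ^ 2 ∂ν := by
    intro t
    have : 0 ≤ ∫ x, (h x - t) ^ 2 ∂ν := integral_nonneg fun _ => sq_nonneg _
    have e : ∫ x, (h x - t) ^ 2 ∂ν = ∫ x, (h x ^ 2 + ((-2 * t) * h x + t * t)) ∂ν := by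
      congr 1; ext x; ring
    have i1 : Integrable (fun x => -2 * t * h x + t * t) ν :=
      (h1.const_mul _).add (integrable_const _)
    rw [e, integral_add h2 i1, integral_add (h1.const_mul _) (integrable_const _),
        integral_const_mul, integral_const,
      smul_eq_mul] at this
    linarith
  have := discrim_le_zero key
  rw [discrim] at this
  nlinarith

/-! ### Profiles: a priori bounds and scaling -/

/-- A nonincreasing nonnegative function `w` in `H¹(0, ∞)`, with derivative `g`. -/
structure IsProfile (w g : ℝ → ℝ) : Prop where
  anti : AntitoneOn w (Ici 0)
  nonneg : ∀ x, 0 ≤ x → 0 ≤ w x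
  eq_integral : ∀ x, 0 ≤ x → w x = w 0 + ∫ t in (0)..x, g t
  memLp : MemLp w 2 (volume.restrict (Ioi 0))
  memLp_deriv : MemLp g 2 (volume.restrict (Ioi 0))

noncomputable def profileMass (w : ℝ → ℝ) : ℝ := ∫ x in Ioi 0, w x ^ 2

noncomputable def profilePotential (p : ℝ) (w : ℝ → ℝ) : ℝ := ∫ x in Ioi 0, w x ^ p

/-- The energy of a profile, the kinetic part being weighted by `a` on `(0, ℓ)` and by `b` on
`(ℓ, ∞)`. -/
noncomputable def profileEnergy (p a b ℓ : ℝ) (w g : ℝ → ℝ) : ℝ :=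
  1 / 2 * weightedKinetic a b ℓ g - 1 / p * profilePotential p w

namespace IsProfile

variable {w g : ℝ → ℝ}

theorem le_zero (h : IsProfile w g) {x : ℝ} (hx : 0 ≤ x) : w x ≤ w 0 :=
  h.anti (mem_Ici.2 le_rfl) hx hx

theorem zero_nonneg (h : IsProfile w g) : 0 ≤ w 0 := h.nonneg 0 le_rfl

theorem integrable_sq (h : IsProfile w g) : IntegrableOn (fun x => w x ^ 2) (Ioi 0) :=
  h.memLp.integrable_sq

theorem integrable_deriv_sq (h : IsProfile w g) : IntegrableOn (fun x => g x ^ 2) (Ioi 0) :=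
  h.memLp_deriv.integrable_sq

theorem memLp_deriv_Ioc (h : IsProfile w g) {x y : ℝ} (hx : 0 ≤ x) :
    MemLp g 2 (volume.restrict (Ioc x y)) :=
  h.memLp_deriv.mono_measure (Measure.restrict_mono (fun _ hz => hx.trans_lt hz.1) le_rfl)

theorem integrableOn_deriv (h : IsProfile w g) {x y : ℝ} (hx : 0 ≤ x) :
    IntegrableOn g (Ioc x y) :=
  (h.memLp_deriv_Ioc hx).integrable (by norm_num)

theorem sub_eq_integral (h : IsProfile w g) {x y : ℝ} (hx : 0 ≤ x) (hxy : x ≤ y) :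
    w y - w x = ∫ t in Ioc x y, g t := by
  rw [h.eq_integral y (hx.trans hxy), h.eq_integral x hx,
    ← intervalIntegral.integral_add_adjacent_intervals (b := x)
      ((intervalIntegrable_iff_integrableOn_Ioc_of_le hx).2 (h.integrableOn_deriv le_rfl))
      ((intervalIntegrable_iff_integrableOn_Ioc_of_le hxy).2 (h.integrableOn_deriv hx)),
    intervalIntegral.integral_of_le hxy]
  ring

theorem sq_sub_le (h : IsProfile w g) {x y : ℝ} (hx : 0 ≤ x) (hxy : x ≤ y) :
    (w x - w y) ^ 2 ≤ (y - x) * ∫ t in Ioc x y, g t ^ 2 := by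
  have := sq_integral_le_measure_mul_integral_sq (h.memLp_deriv_Ioc (y := y) hx)
  rw [← h.sub_eq_integral hx hxy, measureReal_restrict_apply_univ, Real.volume_real_Ioc_of_le hxy]
    at this
  linarith [sq_nonneg (w x - w y)]

theorem continuousOn (h : IsProfile w g) : ContinuousOn w (Ici 0) := by
  have : ∀ R, 0 ≤ R → ContinuousOn w (Icc 0 R) := fun R hR => by
    have h1 := intervalIntegral.continuousOn_primitive_interval (μ := volume) (f := g)
      (a := 0) (b := R) (by
        rw [uIcc_of_le hR, integrableOn_Icc_iff_integrableOn_Ioc]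
        exact h.integrableOn_deriv le_rfl)
    rw [uIcc_of_le hR] at h1
    exact (continuousOn_const.add h1).congr fun x hx => h.eq_integral x hx.1
  intro x hx
  refine (this (x + 1) (by linarith [mem_Ici.1 hx]) x ⟨hx, by linarith⟩).mono_of_mem_nhdsWithin ?_
  have : Iio (x + 1) ∈ 𝓝[Ici 0] x := mem_nhdsWithin_of_mem_nhds (Iio_mem_nhds (by linarith))
  filter_upwards [this, self_mem_nhdsWithin] with y h1 h2
  exact ⟨h2, (le_of_lt h1)⟩

theorem mass_nonneg (w : ℝ → ℝ) : 0 ≤ profileMass w := integral_nonneg fun _ => sq_nonneg _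

theorem potential_nonneg (h : IsProfile w g) (p : ℝ) : 0 ≤ profilePotential p w :=
  setIntegral_nonneg measurableSet_Ioi fun x hx => Real.rpow_nonneg (h.nonneg x (le_of_lt hx)) p

theorem rpow_le (h : IsProfile w g) {p : ℝ} (hp : 2 < p) {x : ℝ} (hx : 0 ≤ x) :
    w x ^ p ≤ w 0 ^ (p - 2) * w x ^ 2 := by
  rcases (h.nonneg x hx).eq_or_lt with h0 | h0
  · rw [← h0, Real.zero_rpow (by linarith)]; simp
  · have : w x ^ p = w x ^ (p - 2) * w x ^ 2 := by
      rw [← Real.rpow_natCast (w x) 2, ← Real.rpow_add h0]; norm_num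
    rw [this]
    gcongr
    · exact h.le_zero hx

theorem aestronglyMeasurable_rpow (h : IsProfile w g) (p : ℝ) :
    AEStronglyMeasurable (fun x => w x ^ p) (volume.restrict (Ioi 0)) :=
  (h.memLp.aestronglyMeasurable.aemeasurable.pow_const p).aestronglyMeasurable

theorem integrable_rpow (h : IsProfile w g) {p : ℝ} (hp : 2 < p) :
    IntegrableOn (fun x => w x ^ p) (Ioi 0) := by
  refine Integrable.mono' (h.integrable_sq.const_mul (w 0 ^ (p - 2)))
    (h.aestronglyMeasurable_rpow p) ?_
  refine (ae_restrict_iff' measurableSet_Ioi).2 (ae_of_all _ fun x hx => ?_)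
  rw [Real.norm_of_nonneg (Real.rpow_nonneg (h.nonneg x (le_of_lt hx)) p)]
  exact h.rpow_le hp (le_of_lt hx)

theorem potential_le (h : IsProfile w g) {p : ℝ} (hp : 2 < p) :
    profilePotential p w ≤ w 0 ^ (p - 2) * profileMass w := by
  rw [profileMass, ← integral_const_mul]
  exact setIntegral_mono_on (h.integrable_rpow hp) (h.integrable_sq.const_mul _) measurableSet_Ioi
    fun x hx => h.rpow_le hp (le_of_lt hx)

/-- On (0, x) the profile is at least w x. This decay w(x)² ≤ mass / x, uniform at fixed mass, is
the source of compactness. -/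
theorem mul_sq_le_mass (h : IsProfile w g) {x : ℝ} (hx : 0 ≤ x) : x * w x ^ 2 ≤ profileMass w := by
  have h1 : ∫ t in Ioc 0 x, w x ^ 2 ≤ ∫ t in Ioc 0 x, w t ^ 2 := by
    refine setIntegral_mono_on (integrableOn_const (by simp))
      (h.integrable_sq.mono_set fun y hy => hy.1) measurableSet_Ioc fun y hy => ?_
    exact pow_le_pow_left₀ (h.nonneg x hx) (h.anti (mem_Ici.2 hy.1.le) hx hy.2) 2
  rw [setIntegral_const, Real.volume_real_Ioc_of_le hx, sub_zero, smul_eq_mul] at h1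
  exact h1.trans (setIntegral_mono_set h.integrable_sq (ae_of_all _ fun _ => sq_nonneg _)
    (Eventually.of_forall fun y hy => hy.1))

theorem weightedKinetic_eq (h : IsProfile w g) (a : ℝ) {ℓ : ℝ} (hℓ : 0 ≤ ℓ) :
    weightedKinetic a a ℓ g = a * ∫ x in Ioi 0, g x ^ 2 := by
  rw [weightedKinetic, ← mul_add, ← setIntegral_union (Ioc_disjoint_Ioi le_rfl) measurableSet_Ioi
    (h.integrable_deriv_sq.mono_set fun y hy => hy.1)
    (h.integrable_deriv_sq.mono_set fun y hy => hℓ.trans_lt hy), Ioc_union_Ioi_eq_Ioi hℓ]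

theorem weightedKinetic_mono {a b a' b' : ℝ} (ha : a ≤ a') (hb : b ≤ b') (ℓ : ℝ) (g : ℝ → ℝ) :
    weightedKinetic a b ℓ g ≤ weightedKinetic a' b' ℓ g := by
  have h1 : 0 ≤ ∫ x in Ioc 0 ℓ, g x ^ 2 := integral_nonneg fun _ => sq_nonneg _
  have h2 : 0 ≤ ∫ x in Ioi ℓ, g x ^ 2 := integral_nonneg fun _ => sq_nonneg _
  unfold weightedKinetic
  gcongr

theorem weightedKinetic_nonneg {a b : ℝ} (ha : 0 ≤ a) (hb : 0 ≤ b) (ℓ : ℝ) (g : ℝ → ℝ) :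
    0 ≤ weightedKinetic a b ℓ g := by
  have h1 : 0 ≤ ∫ x in Ioc 0 ℓ, g x ^ 2 := integral_nonneg fun _ => sq_nonneg _
  have h2 : 0 ≤ ∫ x in Ioi ℓ, g x ^ 2 := integral_nonneg fun _ => sq_nonneg _
  unfold weightedKinetic
  positivity

/-- A Gagliardo–Nirenberg inequality. For every x > 0 the Hölder bound and the decay give w(0)² ≤
2(w(0) - w(x))² + 2w(x)² ≤ 2xK + 2m/x; the choice x = √(m/K) balances the terms. If K or m vanishes,
x tends to ∞ or to 0 instead. -/
theorem zero_pow_four_le (h : IsProfile w g) :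
    w 0 ^ 4 ≤ 16 * profileMass w * ∫ x in Ioi 0, g x ^ 2 := by
  set m := profileMass w
  set K := ∫ x in Ioi 0, g x ^ 2 with hK
  have hm : 0 ≤ m := mass_nonneg w
  have hK0 : 0 ≤ K := integral_nonneg fun _ => sq_nonneg _
  have key : ∀ x, 0 < x → w 0 ^ 2 ≤ 2 * (x * K) + 2 * (m / x) := fun x hx => by
    have h1 := h.sq_sub_le le_rfl hx.le
    have h2 : ∫ t in Ioc 0 x, g t ^ 2 ≤ K :=
      setIntegral_mono_set h.integrable_deriv_sq (ae_of_all _ fun _ => sq_nonneg _)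
        (Eventually.of_forall fun y hy => hy.1)
    have h3 : w x ^ 2 ≤ m / x := by
      rw [le_div_iff₀ hx, mul_comm]; exact h.mul_sq_le_mass hx.le
    have h4 : (w 0 - w x) ^ 2 ≤ x * K := by
      refine h1.trans ?_
      rw [sub_zero]
      gcongr
    nlinarith [sq_nonneg (w 0 - 2 * w x)]
  rcases hK0.eq_or_lt with hK0 | hK0
  · have : w 0 ^ 2 ≤ 0 := by
      have ht : Tendsto (fun x : ℝ => 2 * (x * K) + 2 * (m / x)) atTop (𝓝 (2 * 0 + 2 * 0)) := by
        refine Tendsto.add ?_ ((tendsto_const_nhds.div_atTop tendsto_id).const_mul 2)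
        simp [← hK0]
      rw [mul_zero, add_zero] at ht
      exact ge_of_tendsto ht (by filter_upwards [eventually_gt_atTop 0] with x hx using key x hx)
    have h0 : w 0 = 0 := by nlinarith
    rw [h0, ← hK0]; simp
  · rcases hm.eq_or_lt with hm0 | hm0
    · have : w 0 ^ 2 ≤ 0 := by
        have ht : Tendsto (fun x : ℝ => 2 * (x * K) + 2 * (m / x)) (𝓝[>] 0)
            (𝓝 (2 * (0 * K) + 2 * 0)) := by
          refine Tendsto.add ?_ (Tendsto.const_mul 2 ?_)
          · exact (Continuous.tendsto (by fun_prop) _).mono_left nhdsWithin_le_nhds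
          · exact tendsto_const_nhds.congr fun x => by rw [← hm0, zero_div]
        rw [zero_mul, mul_zero, add_zero] at ht
        exact ge_of_tendsto ht (by filter_upwards [self_mem_nhdsWithin] with x hx using key x hx)
      have h0 : w 0 = 0 := by nlinarith
      rw [h0, ← hm0]; simp
    · have hs : 0 < √(m / K) := Real.sqrt_pos.2 (by positivity)
      have h1 := key _ hs
      set x := √(m / K)
      have hx2 : x * x = m / K := Real.mul_self_sqrt (by positivity)
      have e : m / x = x * K := by
        rw [div_eq_iff hs.ne', mul_right_comm, hx2]; field_simp
      rw [e] at h1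
      have h2 : (w 0 ^ 2) ^ 2 ≤ (4 * (x * K)) ^ 2 := by
        refine pow_le_pow_left₀ (sq_nonneg _) (by linarith) 2
      calc w 0 ^ 4 = (w 0 ^ 2) ^ 2 := by ring
        _ ≤ (4 * (x * K)) ^ 2 := h2
        _ = 16 * (x * x) * K ^ 2 := by ring
        _ = 16 * m * K := by rw [hx2]; field_simp

/-- A bound of the supremum of the profiles of mass at most `μ` with nonpositive energy. -/
theorem zero_le_of_energy_nonpos (h : IsProfile w g) {p μ a b ℓ : ℝ} (hp : 2 < p) (hp6 : p < 6)
    (hμ : profileMass w ≤ μ) (ha : 1 ≤ a) (hb : 1 ≤ b) (hℓ : 0 ≤ ℓ)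
    (hE : profileEnergy p a b ℓ w g ≤ 0) : w 0 ≤ (32 * μ ^ 2) ^ (1 / (6 - p)) := by
  rcases h.zero_nonneg.eq_or_lt with h0 | h0
  · rw [← h0]; positivity
  have hm := mass_nonneg w
  have h1 := h.zero_pow_four_le
  have h2 := h.potential_le hp
  have h3 := weightedKinetic_mono ha hb ℓ g
  rw [h.weightedKinetic_eq 1 hℓ, one_mul] at h3
  rw [profileEnergy] at hE
  have hpot := h.potential_nonneg p
  have h4 : 1 / p * profilePotential p w ≤ profilePotential p w := by
    refine mul_le_of_le_one_left hpot ?_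
    rw [div_le_one (by linarith)]; linarith
  -- Nonpositive energy gives K ≤ 2 w(0)^(p-2) m. Inserted into the Gagliardo–Nirenberg inequality,
  -- this bounds w(0)^(6-p), which is a bound on w(0) since p < 6.
  have h5 : w 0 ^ 4 ≤ 32 * μ ^ 2 * w 0 ^ (p - 2) := by
    have hA : ∫ x in Ioi 0, g x ^ 2 ≤ 2 * (w 0 ^ (p - 2) * profileMass w) := by linarith
    calc w 0 ^ 4 ≤ 16 * profileMass w * ∫ x in Ioi 0, g x ^ 2 := h1
      _ ≤ 16 * profileMass w * (2 * (w 0 ^ (p - 2) * profileMass w)) := by gcongr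
      _ = 32 * profileMass w ^ 2 * w 0 ^ (p - 2) := by ring
      _ ≤ 32 * μ ^ 2 * w 0 ^ (p - 2) := by gcongr
  have h6 : w 0 ^ (6 - p) ≤ 32 * μ ^ 2 := by
    have e : w 0 ^ 4 = w 0 ^ (6 - p) * w 0 ^ (p - 2) := by
      rw [← Real.rpow_natCast, ← Real.rpow_add h0]; norm_num
    rw [e] at h5
    exact le_of_mul_le_mul_right h5 (Real.rpow_pos_of_pos h0 _)
  have := Real.rpow_le_rpow (by positivity) h6 (z := 1 / (6 - p)) (by
    apply div_nonneg zero_le_one; linarith)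
  rwa [← Real.rpow_mul h0.le, mul_one_div, div_self (by linarith), Real.rpow_one] at this

theorem const_mul (h : IsProfile w g) {c : ℝ} (hc : 0 ≤ c) :
    IsProfile (fun x => c * w x) fun x => c * g x where
  anti := fun x hx y hy hxy => mul_le_mul_of_nonneg_left (h.anti hx hy hxy) hc
  nonneg x hx := mul_nonneg hc (h.nonneg x hx)
  eq_integral x hx := by rw [intervalIntegral.integral_const_mul, h.eq_integral x hx, mul_add]
  memLp := h.memLp.const_mul c
  memLp_deriv := h.memLp_deriv.const_mul c

theorem profileMass_const_mul (c : ℝ) (w : ℝ → ℝ) :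
    profileMass (fun x => c * w x) = c ^ 2 * profileMass w := by
  simp_rw [profileMass, mul_pow, integral_const_mul]

theorem weightedKinetic_const_mul (a b ℓ c : ℝ) (g : ℝ → ℝ) :
    weightedKinetic a b ℓ (fun x => c * g x) = c ^ 2 * weightedKinetic a b ℓ g := by
  simp_rw [weightedKinetic, mul_pow, integral_const_mul]
  ring

theorem profilePotential_const_mul (h : IsProfile w g) (p : ℝ) {c : ℝ} (hc : 0 ≤ c) :
    profilePotential p (fun x => c * w x) = c ^ p * profilePotential p w := by
  rw [profilePotential, profilePotential, ← integral_const_mul]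
  refine setIntegral_congr_fun measurableSet_Ioi fun x hx => ?_
  exact Real.mul_rpow hc (h.nonneg x (le_of_lt hx))

theorem integral_Ioi_comp_mul (f : ℝ → ℝ) {r : ℝ} (hr : 0 < r) (a : ℝ) :
    ∫ x in Ioi a, f (r * x) = r⁻¹ * ∫ x in Ioi (r * a), f x := by
  simpa using integral_comp_mul_left_Ioi f a hr

theorem integral_Ioc_comp_mul (f : ℝ → ℝ) {r : ℝ} (hr : 0 < r) {a : ℝ} (ha : 0 ≤ a) :
    ∫ x in Ioc 0 a, f (r * x) = r⁻¹ * ∫ x in Ioc 0 (r * a), f x := by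
  rw [← intervalIntegral.integral_of_le ha, ← intervalIntegral.integral_of_le (by positivity),
    intervalIntegral.integral_comp_mul_left f hr.ne']
  simp

theorem memLp_comp_mul {E : Type*} [NormedAddCommGroup E] {f : ℝ → E}
    (hf : MemLp f 2 (volume.restrict (Ioi 0))) {r : ℝ} (hr : 0 < r) :
    MemLp (fun x => f (r * x)) 2 (volume.restrict (Ioi 0)) := by
  have hq : Measure.QuasiMeasurePreserving (fun x : ℝ => r * x) (volume.restrict (Ioi 0))
      (volume.restrict (Ioi 0)) := by
    refine Measure.QuasiMeasurePreserving.restrict ?_ ?_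
    · refine ⟨by fun_prop, ?_⟩
      rw [Real.map_volume_mul_left hr.ne']
      exact Measure.smul_absolutelyContinuous
    · exact fun x hx => mul_pos hr hx
  have hm : AEStronglyMeasurable (fun x => f (r * x)) (volume.restrict (Ioi 0)) :=
    hf.aestronglyMeasurable.comp_quasiMeasurePreserving hq
  rw [memLp_two_iff_integrable_sq_norm hm]
  have := (integrableOn_Ioi_comp_mul_left_iff (fun x => ‖f x‖ ^ 2) 0 hr).2
    (by rw [mul_zero]; exact (memLp_two_iff_integrable_sq_norm hf.aestronglyMeasurable).1 hf)
  exact this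

theorem comp_mul (h : IsProfile w g) {r : ℝ} (hr : 0 < r) :
    IsProfile (fun x => w (r * x)) fun x => r * g (r * x) where
  anti := fun x hx y hy hxy => h.anti (mul_nonneg hr.le hx) (mul_nonneg hr.le hy)
    (mul_le_mul_of_nonneg_left hxy hr.le)
  nonneg x hx := h.nonneg _ (by positivity)
  eq_integral x hx := by
    rw [intervalIntegral.integral_const_mul, intervalIntegral.integral_comp_mul_left g hr.ne',
      h.eq_integral _ (by positivity)]
    simp [hr.ne']
  memLp := memLp_comp_mul h.memLp hr
  memLp_deriv := (memLp_comp_mul h.memLp_deriv hr).const_mul r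

theorem profileMass_comp_mul (w : ℝ → ℝ) {r : ℝ} (hr : 0 < r) :
    profileMass (fun x => w (r * x)) = r⁻¹ * profileMass w := by
  rw [profileMass, integral_Ioi_comp_mul (fun x => w x ^ 2) hr, mul_zero, profileMass]

theorem profilePotential_comp_mul (p : ℝ) (w : ℝ → ℝ) {r : ℝ} (hr : 0 < r) :
    profilePotential p (fun x => w (r * x)) = r⁻¹ * profilePotential p w := by
  rw [profilePotential, integral_Ioi_comp_mul (fun x => w x ^ p) hr, mul_zero, profilePotential]

theorem weightedKinetic_comp_mul (a b : ℝ) {ℓ : ℝ} (hℓ : 0 ≤ ℓ) (g : ℝ → ℝ) {r : ℝ} (hr : 0 < r) :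
    weightedKinetic a b ℓ (fun x => r * g (r * x)) = r * weightedKinetic a b (r * ℓ) g := by
  simp_rw [weightedKinetic, mul_pow, integral_const_mul]
  rw [integral_Ioi_comp_mul (fun x => g x ^ 2) hr, integral_Ioc_comp_mul (fun x => g x ^ 2) hr hℓ]
  field_simp

theorem measurePreserving_add_Ioi (d : ℝ) : MeasurePreserving (fun x : ℝ => d + x)
    (volume.restrict (Ioi 0)) (volume.restrict (Ioi d)) := by
  have := (measurePreserving_add_left (volume : Measure ℝ) d).restrict_preimage
    (measurableSet_Ioi (a := d))
  simpa using this

theorem integral_Ioi_comp_add (f : ℝ → ℝ) (d : ℝ) :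
    ∫ x in Ioi 0, f (d + x) = ∫ x in Ioi d, f x :=
  (measurePreserving_add_Ioi d).integral_comp (measurableEmbedding_addLeft d) f

theorem comp_add (h : IsProfile w g) {d : ℝ} (hd : 0 ≤ d) :
    IsProfile (fun x => w (d + x)) fun x => g (d + x) where
  anti := fun x hx y hy hxy => h.anti (add_nonneg hd hx) (add_nonneg hd hy) (by linarith)
  nonneg x hx := h.nonneg _ (by positivity)
  eq_integral x hx := by
    have := h.sub_eq_integral hd (show d ≤ d + x by linarith)
    rw [← intervalIntegral.integral_of_le (by linarith)] at this
    rw [intervalIntegral.integral_comp_add_left g]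
    simp only [add_zero]
    linarith
  memLp := (h.memLp.mono_measure
    (Measure.restrict_mono (Ioi_subset_Ioi hd) le_rfl)).comp_measurePreserving
      (measurePreserving_add_Ioi d)
  memLp_deriv := (h.memLp_deriv.mono_measure
    (Measure.restrict_mono (Ioi_subset_Ioi hd) le_rfl)).comp_measurePreserving
      (measurePreserving_add_Ioi d)

end IsProfile

/-- Some profile of mass `μ` has energy at most `e`. -/
def ProfileEnergyLE (p μ a b ℓ e : ℝ) : Prop :=
  ∃ w g : ℝ → ℝ, IsProfile w g ∧ profileMass w = μ ∧ profileEnergy p a b ℓ w g ≤ e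

theorem ProfileEnergyLE.mono {p μ a b ℓ e e' : ℝ} (h : ProfileEnergyLE p μ a b ℓ e) (he : e ≤ e') :
    ProfileEnergyLE p μ a b ℓ e' := by
  obtain ⟨w, g, hw, hm, hE⟩ := h
  exact ⟨w, g, hw, hm, hE.trans he⟩

namespace IsProfile

variable {w g : ℝ → ℝ}

theorem mass_pos_of_energy_neg (h : IsProfile w g) {p a b ℓ : ℝ} (hp : 2 < p) (ha : 0 ≤ a)
    (hb : 0 ≤ b) (hE : profileEnergy p a b ℓ w g < 0) : 0 < profileMass w := by
  refine (mass_nonneg w).lt_of_ne fun h0 => ?_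
  have h1 := h.potential_le hp
  rw [← h0, mul_zero] at h1
  have h2 := weightedKinetic_nonneg ha hb ℓ g
  have h3 : 1 / p * profilePotential p w ≤ 0 :=
    mul_nonpos_of_nonneg_of_nonpos (by positivity) h1
  rw [profileEnergy] at hE
  linarith

/-- The potential term is multiplied by c^p ≥ c², the kinetic term only by c². -/
theorem energy_const_mul_le (h : IsProfile w g) {p a b ℓ c : ℝ} (hp : 2 < p) (hc : 1 ≤ c) :
    profileEnergy p a b ℓ (fun x => c * w x) (fun x => c * g x) ≤
      c ^ 2 * profileEnergy p a b ℓ w g := by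
  rw [profileEnergy, profileEnergy, weightedKinetic_const_mul,
    h.profilePotential_const_mul p (by linarith)]
  have h1 : c ^ 2 ≤ c ^ p := by
    rw [← Real.rpow_natCast c 2]
    exact Real.rpow_le_rpow_of_exponent_le hc (by push_cast; linarith)
  have h2 : c ^ 2 * profilePotential p w ≤ c ^ p * profilePotential p w :=
    mul_le_mul_of_nonneg_right h1 (h.potential_nonneg p)
  have h3 := mul_le_mul_of_nonneg_left h2 (show 0 ≤ 1 / p by positivity)
  nlinarith

/-- Scaling up the mass of a profile of negative energy. -/
theorem profileEnergyLE (h : IsProfile w g) {p μ a b ℓ e : ℝ} (hp : 2 < p) (ha : 0 ≤ a)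
    (hb : 0 ≤ b) (hm : profileMass w ≤ μ) (he : e < 0) (hE : profileEnergy p a b ℓ w g ≤ e) :
    ProfileEnergyLE p μ a b ℓ e := by
  have hpos := h.mass_pos_of_energy_neg hp ha hb (hE.trans_lt he)
  set m := profileMass w with hmdef
  have hc : 1 ≤ √(μ / m) := by
    rw [Real.one_le_sqrt, one_le_div hpos]; exact hm
  have hc2 : √(μ / m) ^ 2 = μ / m := Real.sq_sqrt (div_nonneg (hpos.le.trans hm) hpos.le)
  refine ⟨_, _, h.const_mul (zero_le_one.trans hc), ?_, (h.energy_const_mul_le hp hc).trans ?_⟩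
  · rw [profileMass_const_mul, hc2, ← hmdef, div_mul_cancel₀ _ hpos.ne']
  · have : 1 ≤ √(μ / m) ^ 2 := one_le_pow₀ hc
    nlinarith

theorem energy_comp_mul (p a b : ℝ) {ℓ : ℝ} (hℓ : 0 ≤ ℓ) (w g : ℝ → ℝ) {r : ℝ} (hr : 0 < r) :
    profileEnergy p a b ℓ (fun x => w (r * x)) (fun x => r * g (r * x)) =
      1 / 2 * (r * weightedKinetic a b (r * ℓ) g) - 1 / p * (r⁻¹ * profilePotential p w) := by
  rw [profileEnergy, weightedKinetic_comp_mul a b hℓ g hr, profilePotential_comp_mul p w hr]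

/-- The mass-preserving dilation `√r w(r x)`. -/
theorem exists_dilation (h : IsProfile w g) {p : ℝ} {r : ℝ} (hr : 0 < r) :
    ∃ w' g', IsProfile w' g' ∧ profileMass w' = profileMass w ∧
      (∀ a b, ∀ ℓ, 0 ≤ ℓ → weightedKinetic a b ℓ g' = r ^ 2 * weightedKinetic a b (r * ℓ) g) ∧
      profilePotential p w' = r ^ ((p - 2) / 2) * profilePotential p w := by
  refine ⟨_, _, (h.comp_mul hr).const_mul (Real.sqrt_nonneg r), ?_, fun a b ℓ hℓ => ?_, ?_⟩
  · rw [profileMass_const_mul, profileMass_comp_mul w hr, Real.sq_sqrt hr.le, ← mul_assoc,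
      mul_inv_cancel₀ hr.ne', one_mul]
  · rw [weightedKinetic_const_mul, weightedKinetic_comp_mul a b hℓ g hr, Real.sq_sqrt hr.le]
    ring
  · rw [(h.comp_mul hr).profilePotential_const_mul p (Real.sqrt_nonneg r),
      profilePotential_comp_mul p w hr, ← mul_assoc, Real.sqrt_eq_rpow, ← Real.rpow_mul hr.le,
      ← Real.rpow_neg_one, ← Real.rpow_add hr]
    congr 2; ring

theorem exp_neg_sq (x : ℝ) : Real.exp (-1 * x) ^ 2 = Real.exp (-2 * x) := by
  rw [← Real.exp_nat_mul]; congr 1; push_cast; ring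

theorem exp_neg : IsProfile (fun x => Real.exp (-1 * x)) fun x => -Real.exp (-1 * x) where
  anti := fun x _ y _ hxy => Real.exp_le_exp.2 (by linarith)
  nonneg x _ := (Real.exp_pos _).le
  eq_integral x _ := by
    rw [intervalIntegral.integral_eq_sub_of_hasDerivAt (f := fun x => Real.exp (-1 * x))]
    · ring
    · intro y _
      have := ((hasDerivAt_id y).const_mul (-1)).exp
      exact this.congr_deriv (by simp)
    · exact Continuous.intervalIntegrable (by fun_prop) _ _
  memLp := by
    rw [memLp_two_iff_integrable_sq (Continuous.aestronglyMeasurable (by fun_prop))]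
    have := integrableOn_exp_mul_Ioi (a := -2) (by norm_num) 0
    exact this.congr_fun (fun x _ => (exp_neg_sq x).symm) measurableSet_Ioi
  memLp_deriv := by
    rw [memLp_two_iff_integrable_sq (Continuous.aestronglyMeasurable (by fun_prop))]
    have := integrableOn_exp_mul_Ioi (a := -2) (by norm_num) 0
    exact this.congr_fun (fun x _ => ((neg_sq _).trans (exp_neg_sq x)).symm) measurableSet_Ioi

theorem potential_exp_neg_pos {p : ℝ} (hp : 0 < p) :
    0 < profilePotential p fun x => Real.exp (-1 * x) := by
  have : profilePotential p (fun x => Real.exp (-1 * x)) = ∫ x in Ioi (0 : ℝ), Real.exp (-p * x) :=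
      by
    refine setIntegral_congr_fun measurableSet_Ioi fun x _ => ?_
    beta_reduce
    rw [← Real.exp_mul]; congr 1; ring
  rw [this, integral_exp_mul_Ioi (by linarith)]
  simp
  positivity

theorem mass_exp_neg_pos : 0 < profileMass fun x => Real.exp (-1 * x) := by
  have : profileMass (fun x => Real.exp (-1 * x)) = ∫ x in Ioi (0 : ℝ), Real.exp (-2 * x) :=
    setIntegral_congr_fun measurableSet_Ioi fun x _ => exp_neg_sq x
  rw [this, integral_exp_mul_Ioi (by norm_num)]
  norm_num

/-- Every mass supports a profile of negative energy. -/
theorem exists_energy_neg {p μ : ℝ} (hp : 2 < p) (hp6 : p < 6) (hμ : 0 < μ) (a : ℝ) :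
    ∃ e < 0, ProfileEnergyLE p μ a a 0 e := by
  set m := profileMass (fun x => Real.exp (-1 * x))
  have hm : 0 < m := mass_exp_neg_pos
  have hc0 : 0 < √(μ / m) := Real.sqrt_pos.2 (by positivity)
  have h := exp_neg.const_mul hc0.le
  have hmass : profileMass (fun x => √(μ / m) * Real.exp (-1 * x)) = μ := by
    rw [profileMass_const_mul, Real.sq_sqrt (by positivity)]
    exact div_mul_cancel₀ _ hm.ne'
  have hpot : 0 < profilePotential p (fun x => √(μ / m) * Real.exp (-1 * x)) := by
    rw [exp_neg.profilePotential_const_mul p hc0.le]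
    exact mul_pos (Real.rpow_pos_of_pos hc0 p) (potential_exp_neg_pos (by linarith))
  set K := weightedKinetic a a 0 fun x => √(μ / m) * -Real.exp (-1 * x) with hK
  set P := profilePotential p (fun x => √(μ / m) * Real.exp (-1 * x)) with hP
  -- This is the energy of the dilation divided by r^((p-2)/2). The remaining power of r on the
  -- kinetic term is (6-p)/2 > 0, so the potential dominates for small r.
  have ht : Tendsto (fun r : ℝ => 1 / 2 * (r ^ (2 - (p - 2) / 2) * K) - 1 / p * P) (𝓝[>] 0)
      (𝓝 (1 / 2 * (0 * K) - 1 / p * P)) := by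
    have hz : Tendsto (fun r : ℝ => r ^ (2 - (p - 2) / 2)) (𝓝[>] 0) (𝓝 0) := by
      have := (Real.continuousAt_rpow_const 0 (2 - (p - 2) / 2) (Or.inr (by linarith))).tendsto
      rw [Real.zero_rpow (by linarith)] at this
      exact this.mono_left nhdsWithin_le_nhds
    exact ((hz.mul_const K).const_mul _).sub_const _
  have hneg : 1 / 2 * (0 * K) - 1 / p * P < 0 := by
    have : 0 < 1 / p * P := by positivity
    linarith
  obtain ⟨r, hr, hr0⟩ := ((ht.eventually (gt_mem_nhds hneg)).and self_mem_nhdsWithin).exists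
  have hr0 : 0 < r := hr0
  obtain ⟨w', g', hw', hm', hk', hp'⟩ := h.exists_dilation (p := p) hr0
  have hE : profileEnergy p a a 0 w' g' < 0 := by
    rw [profileEnergy, hk' _ _ _ le_rfl, hp', mul_zero, ← hK, ← hP]
    have e1 : r ^ 2 = r ^ ((p - 2) / 2) * r ^ (2 - (p - 2) / 2) := by
      rw [← Real.rpow_add hr0, ← Real.rpow_natCast]; congr 1; push_cast; ring
    rw [e1]
    have h1 : 0 < r ^ ((p - 2) / 2) := Real.rpow_pos_of_pos hr0 _
    have := mul_neg_of_pos_of_neg h1 hr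
    linarith
  exact ⟨_, hE, w', g', hw', hm'.trans hmass, le_rfl⟩

/-- The energy is bounded below. -/
theorem le_energy (h : IsProfile w g) {p μ a b ℓ : ℝ} (hp : 2 < p) (hp6 : p < 6)
    (hμ : profileMass w ≤ μ) (ha : 1 ≤ a) (hb : 1 ≤ b) (hℓ : 0 ≤ ℓ) :
    -(((32 * μ ^ 2) ^ (1 / (6 - p))) ^ (p - 2) * μ) ≤ profileEnergy p a b ℓ w g := by
  have hμ0 : 0 ≤ μ := (mass_nonneg w).trans hμ
  have hM : 0 ≤ ((32 * μ ^ 2) ^ (1 / (6 - p))) ^ (p - 2) * μ := by positivity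
  rcases le_total 0 (profileEnergy p a b ℓ w g) with hE | hE
  · linarith
  have h1 := h.zero_le_of_energy_nonpos hp hp6 hμ ha hb hℓ hE
  have h2 := h.potential_le hp
  have h3 : w 0 ^ (p - 2) * profileMass w ≤ ((32 * μ ^ 2) ^ (1 / (6 - p))) ^ (p - 2) * μ := by
    have := h.zero_nonneg
    have := mass_nonneg w
    gcongr
  have hk := weightedKinetic_nonneg (zero_le_one.trans ha) (zero_le_one.trans hb) ℓ g
  have h4 : 1 / p * profilePotential p w ≤ profilePotential p w := by
    refine mul_le_of_le_one_left (h.potential_nonneg p) ?_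
    rw [div_le_one (by linarith)]; linarith
  rw [profileEnergy]
  linarith

/-- The kinetic energy of profiles of nonpositive energy is bounded. -/
theorem weightedKinetic_le (h : IsProfile w g) {p μ a b ℓ : ℝ} (hp : 2 < p) (hp6 : p < 6)
    (hμ : profileMass w ≤ μ) (ha : 1 ≤ a) (hb : 1 ≤ b) (hℓ : 0 ≤ ℓ)
    (hE : profileEnergy p a b ℓ w g ≤ 0) :
    weightedKinetic a b ℓ g ≤ 2 * (((32 * μ ^ 2) ^ (1 / (6 - p))) ^ (p - 2) * μ) ∧
      profilePotential p w ≤ ((32 * μ ^ 2) ^ (1 / (6 - p))) ^ (p - 2) * μ := by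
  have h1 := h.zero_le_of_energy_nonpos hp hp6 hμ ha hb hℓ hE
  have h2 := h.potential_le hp
  have h3 : w 0 ^ (p - 2) * profileMass w ≤ ((32 * μ ^ 2) ^ (1 / (6 - p))) ^ (p - 2) * μ := by
    have := h.zero_nonneg
    have := mass_nonneg w
    gcongr
  have h4 : 1 / p * profilePotential p w ≤ profilePotential p w := by
    refine mul_le_of_le_one_left (h.potential_nonneg p) ?_
    rw [div_le_one (by linarith)]; linarith
  rw [profileEnergy] at hE
  constructor <;> linarith

theorem integrable_weight_sq (h : IsProfile w g) (a b ℓ : ℝ) :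
    IntegrableOn (fun x => (if x ≤ ℓ then a else b) * g x ^ 2) (Ioi 0) := by
  refine Integrable.bdd_mul (c := max |a| |b|) h.integrable_deriv_sq ?_ (ae_of_all _ fun x => ?_)
  · exact (Measurable.ite measurableSet_Iic measurable_const measurable_const).aestronglyMeasurable
  · split_ifs
    · exact le_max_left _ _
    · exact le_max_right _ _

theorem integral_weight_sq (h : IsProfile w g) (a b : ℝ) {ℓ : ℝ} (hℓ : 0 ≤ ℓ) :
    ∫ x in Ioi 0, (if x ≤ ℓ then a else b) * g x ^ 2 = weightedKinetic a b ℓ g := by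
  have hi := h.integrable_weight_sq a b ℓ
  rw [← Ioc_union_Ioi_eq_Ioi hℓ] at hi ⊢
  rw [setIntegral_union (Ioc_disjoint_Ioi le_rfl) measurableSet_Ioi hi.left_of_union
    hi.right_of_union, weightedKinetic, ← integral_const_mul, ← integral_const_mul]
  congr 1
  · exact setIntegral_congr_fun measurableSet_Ioc fun x hx => by simp [hx.2]
  · exact setIntegral_congr_fun measurableSet_Ioi fun x hx => by simp [not_le.2 (mem_Ioi.1 hx)]

end IsProfile

/-! ### Compactness of minimizing sequences of profiles -/

/-- Nonincreasing functions in `[0, M]` that are uniformly `1/2`-Hölder have a subsequence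
converging pointwise on `[0, ∞)`. -/
theorem exists_subseq_tendsto_of_sq_sub_le {f : ℕ → ℝ → ℝ} {M B : ℝ}
    (hf : ∀ n x, 0 ≤ x → f n x ∈ Icc 0 M)
    (hB : ∀ n x y, 0 ≤ x → x ≤ y → (f n x - f n y) ^ 2 ≤ (y - x) * B) :
    ∃ (φ : ℕ → ℕ) (w : ℝ → ℝ), StrictMono φ ∧
      ∀ x, 0 ≤ x → Tendsto (fun n => f (φ n) x) atTop (𝓝 (w x)) := by
  have hK : IsCompact (univ.pi fun _ : ℚ => Icc (0 : ℝ) M) :=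
    isCompact_univ_pi fun _ => isCompact_Icc
  -- Compactness of a countable product replaces the diagonal argument; `|q|` keeps the sample
  -- points in [0, ∞). The uniform Hölder bound carries convergence over to all points.
  obtain ⟨v, -, φ, hφ, hv⟩ := hK.tendsto_subseq (x := fun n (q : ℚ) => f n |(q : ℝ)|)
    fun n q _ => hf n _ (abs_nonneg _)
  rw [tendsto_pi_nhds] at hv
  have hB0 : 0 ≤ B := by
    have := (sq_nonneg _).trans (hB 0 0 1 le_rfl zero_le_one)
    linarith
  have key : ∀ x, 0 ≤ x → ∃ l, Tendsto (fun n => f (φ n) x) atTop (𝓝 l) := by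
    intro x hx
    refine cauchySeq_tendsto_of_complete (Metric.cauchySeq_iff.2 fun ε hε => ?_)
    obtain ⟨q, hxq, hq⟩ := exists_rat_btwn
      (show x < x + (ε / 4) ^ 2 / (B + 1) by have : 0 < (ε / 4) ^ 2 / (B + 1) := by positivity
                                             linarith)
    have hclose : ∀ n, |f n x - f n q| ≤ ε / 4 := fun n => by
      refine abs_le_of_sq_le_sq ((hB n x q hx hxq.le).trans ?_) (by positivity)
      have : (q : ℝ) - x ≤ (ε / 4) ^ 2 / (B + 1) := by linarith
      calc ((q : ℝ) - x) * B ≤ (ε / 4) ^ 2 / (B + 1) * (B + 1) := by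
            have : 0 ≤ (q : ℝ) - x := by linarith
            gcongr
            linarith
        _ = _ := by field_simp
    have hc := (hv q).cauchySeq
    obtain ⟨N, hN⟩ := Metric.cauchySeq_iff.1 hc (ε / 4) (by positivity)
    refine ⟨N, fun m hm n hn => ?_⟩
    have h1 := hN m hm n hn
    simp only [Function.comp_apply, abs_of_nonneg (hx.trans hxq.le), Real.dist_eq] at h1
    have h2 := hclose (φ m)
    have h3 := hclose (φ n)
    rw [Real.dist_eq]
    rw [abs_lt] at *
    rw [abs_le] at h2 h3
    constructor <;> linarith
  choose! w hw using key
  exact ⟨φ, w, hφ, hw⟩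

/-- The infimum of the energy over the profiles of a given mass is attained if it is negative. -/
theorem ProfileEnergyLE.of_forall_pos {p μ a b ℓ e : ℝ} (hp : 2 < p) (hp6 : p < 6)
    (ha : 1 ≤ a) (hb : 1 ≤ b) (hℓ : 0 ≤ ℓ) (he : e < 0)
    (h : ∀ ε, 0 < ε → ProfileEnergyLE p μ a b ℓ (e + ε)) : ProfileEnergyLE p μ a b ℓ e := by
  have h' : ∀ n : ℕ, ProfileEnergyLE p μ a b ℓ (e + -e / (n + 1)) := fun n =>
    h _ (div_pos (neg_pos.2 he) (by positivity))
  choose w g hw hmass hE using h'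
  have hεle : ∀ n : ℕ, e + -e / (n + 1) ≤ 0 := fun n => by
    have : -e / ((n : ℝ) + 1) ≤ -e := by
      refine div_le_self (by linarith) ?_
      have : (0 : ℝ) ≤ n := n.cast_nonneg
      linarith
    linarith
  have hεlim : Tendsto (fun n : ℕ => e + -e / ((n : ℝ) + 1)) atTop (𝓝 e) := by
    have h1 : Tendsto (fun n : ℕ => (n : ℝ) + 1) atTop atTop :=
      tendsto_atTop_add_const_right _ _ tendsto_natCast_atTop_atTop
    simpa using (tendsto_const_nhds (x := -e)).div_atTop h1 |>.const_add e
  set M := (32 * μ ^ 2) ^ (1 / (6 - p)) with hM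
  have hμ0 : 0 ≤ μ := hmass 0 ▸ IsProfile.mass_nonneg _
  have hM0 : 0 ≤ M := by positivity
  set B := 2 * (M ^ (p - 2) * μ) with hB
  have hbd : ∀ n, w n 0 ≤ M := fun n =>
    (hw n).zero_le_of_energy_nonpos hp hp6 (hmass n).le ha hb hℓ ((hE n).trans (hεle n))
  have hkin : ∀ n, weightedKinetic a b ℓ (g n) ≤ B := fun n =>
    ((hw n).weightedKinetic_le hp hp6 (hmass n).le ha hb hℓ ((hE n).trans (hεle n))).1
  have hgB : ∀ n, ∫ x in Ioi 0, g n x ^ 2 ≤ B := fun n => by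
    have := IsProfile.weightedKinetic_mono ha hb ℓ (g n)
    rw [(hw n).weightedKinetic_eq 1 hℓ, one_mul] at this
    exact this.trans (hkin n)
  obtain ⟨φ, v, hφ, hv⟩ := exists_subseq_tendsto_of_sq_sub_le (f := w) (M := M) (B := B)
    (fun n x hx => ⟨(hw n).nonneg x hx, ((hw n).le_zero hx).trans (hbd n)⟩)
    fun n x y hx hxy => ((hw n).sq_sub_le hx hxy).trans <| by
      refine mul_le_mul_of_nonneg_left (le_trans ?_ (hgB n)) (sub_nonneg.2 hxy)
      exact setIntegral_mono_set (hw n).integrable_deriv_sq (ae_of_all _ fun _ => sq_nonneg _)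
        (Eventually.of_forall fun y hy => hx.trans_lt hy.1)
  have hvanti : AntitoneOn v (Ici 0) := fun x hx y hy hxy =>
    le_of_tendsto_of_tendsto' (hv y hy) (hv x hx) fun n => (hw (φ n)).anti hx hy hxy
  have hvnonneg : ∀ x, 0 ≤ x → 0 ≤ v x := fun x hx =>
    ge_of_tendsto' (hv x hx) fun n => (hw (φ n)).nonneg x hx
  have hvmeas : AEMeasurable v (volume.restrict (Ioi 0)) :=
    aemeasurable_restrict_of_antitoneOn measurableSet_Ioi (hvanti.mono Ioi_subset_Ici_self)
  -- the mass
  have hfatou := lintegral_enorm_le_liminf_of_tendsto (μ := volume.restrict (Ioi 0))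
    (G := fun n x => w (φ n) x ^ 2) (f := fun x => v x ^ 2)
    ((ae_restrict_iff' measurableSet_Ioi).2 (ae_of_all _ fun x hx => (hv x (le_of_lt hx)).pow 2))
    fun n => (hw (φ n)).integrable_sq.aestronglyMeasurable.aemeasurable.enorm
  have hmassn : ∀ n, ∫⁻ x in Ioi 0, ‖w n x ^ 2‖ₑ = ENNReal.ofReal μ := fun n => by
    rw [← ofReal_integral_norm_eq_lintegral_enorm (hw n).integrable_sq, ← hmass n, profileMass]
    simp
  simp only [hmassn, liminf_const] at hfatou
  have hvsq : IntegrableOn (fun x => v x ^ 2) (Ioi 0) :=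
    ⟨(hvmeas.pow_const 2).aestronglyMeasurable, hfatou.trans_lt ENNReal.ofReal_lt_top⟩
  have hvmass : profileMass v ≤ μ := by
    rw [← ofReal_integral_norm_eq_lintegral_enorm hvsq, ENNReal.ofReal_le_ofReal_iff hμ0] at hfatou
    simpa [profileMass] using hfatou
  -- the potential energy
  have hpot : Tendsto (fun n => profilePotential p (w (φ n))) atTop (𝓝 (profilePotential p v)) := by
    -- The dominating function is M^p on (0, 1] and, by the decay w(x)² ≤ μ/x, (μ/x)^(p/2) beyond;
    -- the latter is integrable since p > 2.
    refine tendsto_integral_of_dominated_convergence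
      (fun x => (Ioc 0 1).indicator (fun _ => M ^ p) x +
        (Ioi 1).indicator (fun x => μ ^ (p / 2) * x ^ (-(p / 2))) x)
      (fun n => (hw (φ n)).aestronglyMeasurable_rpow p) ?_ (fun n => ?_) ?_
    · refine Integrable.add (Integrable.mono_measure ?_ Measure.restrict_le_self)
        (Integrable.mono_measure ?_ Measure.restrict_le_self)
      · exact (integrableOn_const (by simp)).integrable_indicator measurableSet_Ioc
      · have : IntegrableOn (fun x : ℝ => μ ^ (p / 2) * x ^ (-(p / 2))) (Ioi 1) :=
          (integrableOn_Ioi_rpow_of_lt (by linarith) one_pos).const_mul _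
        exact this.integrable_indicator measurableSet_Ioi
    · refine (ae_restrict_iff' measurableSet_Ioi).2 (ae_of_all _ fun x hx => ?_)
      have hx0 : 0 < x := hx
      have h0 := (hw (φ n)).nonneg x hx0.le
      rw [Real.norm_of_nonneg (Real.rpow_nonneg h0 p)]
      rcases le_or_gt x 1 with hx1 | hx1
      · rw [indicator_of_mem (show x ∈ Ioc (0 : ℝ) 1 from ⟨hx0, hx1⟩),
          indicator_of_notMem (by simpa using hx1), add_zero]
        exact Real.rpow_le_rpow h0 (((hw (φ n)).le_zero hx0.le).trans (hbd _)) (by linarith)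
      · rw [indicator_of_notMem (fun h => not_le.2 hx1 h.2), indicator_of_mem (mem_Ioi.2 hx1),
          zero_add]
        have h1 : w (φ n) x ^ 2 ≤ μ / x := by
          rw [le_div_iff₀ hx0, mul_comm]
          exact ((hw (φ n)).mul_sq_le_mass hx0.le).trans (hmass _).le
        have h2 : w (φ n) x ^ p = (w (φ n) x ^ 2) ^ (p / 2) := by
          rw [← Real.rpow_natCast, ← Real.rpow_mul h0]; congr 1; push_cast; ring
        rw [h2, Real.rpow_neg hx0.le, ← div_eq_mul_inv, ← Real.div_rpow hμ0 hx0.le]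
        exact Real.rpow_le_rpow (sq_nonneg _) h1 (by linarith)
    · exact (ae_restrict_iff' measurableSet_Ioi).2 (ae_of_all _ fun x hx =>
        (hv x (le_of_lt hx)).rpow_const (Or.inr (by linarith)))
  -- the kinetic energy
  set wt : ℝ → ℝ := fun x => if x ≤ ℓ then a else b with hwt
  have hwt0 : ∀ x, 0 ≤ wt x := fun x => by simp only [hwt]; split_ifs <;> linarith
  set Ψ : ℕ → ℝ → ℝ := fun n s => ∫ x in Ioc 0 s, wt x * g n x ^ 2 with hΨ
  have hint : ∀ n, IntegrableOn (fun x => wt x * g n x ^ 2) (Ioi 0) := fun n =>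
    (hw n).integrable_weight_sq a b ℓ
  have hnn : ∀ n x, 0 ≤ wt x * g n x ^ 2 := fun n x => mul_nonneg (hwt0 x) (sq_nonneg _)
  have hΨsub : ∀ n s t, 0 ≤ s → s ≤ t → Ψ n t - Ψ n s = ∫ x in Ioc s t, wt x * g n x ^ 2 := by
    intro n s t hs hst
    have i1 : IntegrableOn (fun x => wt x * g n x ^ 2) (Ioc 0 s) :=
      (hint n).mono_set fun x hx => hx.1
    have i2 : IntegrableOn (fun x => wt x * g n x ^ 2) (Ioc s t) :=
      (hint n).mono_set fun x hx => hs.trans_lt hx.1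
    simp only [hΨ]
    rw [← Ioc_union_Ioc_eq_Ioc hs hst, setIntegral_union
        (Ioc_disjoint_Ioc_of_le le_rfl) measurableSet_Ioc i1 i2]
    ring
  have hΨkin : ∀ n s, Ψ n s ≤ weightedKinetic a b ℓ (g n) := fun n s => by
    rw [← (hw n).integral_weight_sq a b hℓ]
    exact setIntegral_mono_set (hint n) (ae_of_all _ (hnn n))
        (Eventually.of_forall fun y hy => hy.1)
  have hΨ0 : ∀ n s, 0 ≤ Ψ n s := fun n s => integral_nonneg (hnn n)
  -- Along an ultrafilter the bounded quantities Ψ (φ n) s converge for all s at once, so no further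
  -- extraction is needed.
  set U : Ultrafilter ℕ := hyperfilter ℕ
  have hU : (U : Filter ℕ) ≤ atTop := Nat.hyperfilter_le_atTop
  have hlim : ∀ s, ∃ l, Tendsto (fun n => Ψ (φ n) s) U (𝓝 l) := fun s => by
    obtain ⟨l, -, hl⟩ := (isCompact_Icc (a := (0 : ℝ)) (b := B)).ultrafilter_le_nhds
      (U.map fun n => Ψ (φ n) s) (by
        rw [le_principal_iff, Ultrafilter.mem_coe, Ultrafilter.mem_map]
        exact univ_mem' fun n => ⟨hΨ0 _ _, (hΨkin _ _).trans (hkin _)⟩)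
    exact ⟨l, hl⟩
  choose Φ hΦ using hlim
  -- Cauchy–Schwarz for each member of the sequence, passed to the limit. The limit Φ need not be
  -- the kinetic energy of v, but it controls the increments of v.
  have hinc : ∀ s t, 0 ≤ s → s ≤ t → ∀ c, (∀ x ∈ Ioc s t, wt x = c) → 0 ≤ c →
      c * (v s - v t) ^ 2 ≤ (t - s) * (Φ t - Φ s) := by
    intro s t hs hst c hc hc0
    refine le_of_tendsto_of_tendsto'
      (((((hv s hs).sub (hv t (hs.trans hst))).pow 2).const_mul c).mono_left hU)
      (((hΦ t).sub (hΦ s)).const_mul (t - s)) fun n => ?_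
    rw [hΨsub _ s t hs hst, setIntegral_congr_fun measurableSet_Ioc
      (g := fun x => c * g (φ n) x ^ 2) fun x hx => by simp only [hc x hx], integral_const_mul,
      mul_left_comm]
    exact mul_le_mul_of_nonneg_left ((hw _).sq_sub_le hs hst) hc0
  -- The bound `K` is the limit of the bounds on the kinetic energies that follow from `hE`.
  obtain ⟨γ, hγ1, hγ2, hγ3⟩ := exists_weightedKinetic_le (w := v) (Φ := Φ) (a := a) (b := b)
      (ℓ := ℓ)
    (K := 2 * (e + 1 / p * profilePotential p v)) hℓ (by linarith) (by linarith)
    (fun s hs t ht hst => le_of_tendsto_of_tendsto' (hΦ s) (hΦ t) fun n => by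
      rw [← sub_nonneg, hΨsub _ s t hs hst]
      exact integral_nonneg (hnn _))
    (ge_of_tendsto' (hΦ 0) fun n => hΨ0 _ _)
    (fun s _ => le_of_tendsto_of_tendsto' (hΦ s)
      ((((hεlim.comp hφ.tendsto_atTop).add (hpot.const_mul (1 / p))).const_mul 2).mono_left hU)
      fun n => by
        have h1 := hE (φ n)
        have h2 := hΨkin (φ n) s
        rw [profileEnergy] at h1
        simp only [Function.comp_apply]
        linarith)
    (fun s t hs hst ht => hinc s t hs hst a (fun x hx => if_pos (hx.2.trans ht)) (by linarith))
    (fun s t hs hst => hinc s t (hℓ.trans hs) hst b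
      (fun x hx => if_neg (not_le.2 (hs.trans_lt hx.1))) (by linarith))
  have hprof : IsProfile v γ := ⟨hvanti, hvnonneg, hγ1,
    (memLp_two_iff_integrable_sq hvmeas.aestronglyMeasurable).2 hvsq, hγ2⟩
  -- The limit may have lost mass. As its energy is negative, scaling it up to mass μ does not raise
  -- the energy.
  refine hprof.profileEnergyLE hp (by linarith) (by linarith) hvmass he ?_
  rw [profileEnergy]
  linarith

/-! ### The energy level of the line -/

/-- The ground state energy level of the real line at mass `μ`, in terms of the nonincreasing
rearrangement. -/
noncomputable def lineLevel (p μ : ℝ) : ℝ := sInf {e | ProfileEnergyLE p μ 4 4 0 e}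

section LineLevel

variable {p μ : ℝ} (hp : 2 < p) (hp6 : p < 6) (hμ : 0 < μ)
include hp hp6

theorem bddBelow_profileEnergyLE : BddBelow {e | ProfileEnergyLE p μ 4 4 0 e} := by
  refine ⟨-(((32 * μ ^ 2) ^ (1 / (6 - p))) ^ (p - 2) * μ), ?_⟩
  rintro e ⟨w, g, hw, hm, hE⟩
  exact (hw.le_energy hp hp6 hm.le (by norm_num) (by norm_num) le_rfl).trans hE

include hμ

theorem lineLevel_neg : lineLevel p μ < 0 := by
  obtain ⟨e, he, h⟩ := IsProfile.exists_energy_neg hp hp6 hμ 4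
  exact (csInf_le (bddBelow_profileEnergyLE hp hp6) h).trans_lt he

/-- A smaller mass cannot do better: a profile of negative energy can be scaled up to mass μ, and a
nonnegative energy exceeds the negative level anyway. -/
theorem lineLevel_le {w g : ℝ → ℝ} (hw : IsProfile w g) (hm : profileMass w ≤ μ) :
    lineLevel p μ ≤ profileEnergy p 4 4 0 w g := by
  rcases lt_or_ge (profileEnergy p 4 4 0 w g) 0 with h | h
  · exact csInf_le (bddBelow_profileEnergyLE hp hp6)
      (hw.profileEnergyLE hp (by norm_num) (by norm_num) hm h le_rfl)
  · exact (lineLevel_neg hp hp6 hμ).le.trans h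

theorem profileEnergyLE_of_lineLevel_lt {e : ℝ} (he : lineLevel p μ < e) :
    ProfileEnergyLE p μ 4 4 0 e := by
  obtain ⟨e', h, hlt⟩ := exists_lt_of_csInf_lt
    (let ⟨e, _, h⟩ := IsProfile.exists_energy_neg hp hp6 hμ 4; ⟨e, h⟩) he
  exact ProfileEnergyLE.mono h hlt.le

end LineLevel

/-! ### Dependence on the length of the pendant; the critical length -/

namespace IsProfile

variable {w g : ℝ → ℝ}

theorem weightedKinetic_eq_sub (h : IsProfile w g) (a b : ℝ) {ℓ : ℝ} (hℓ : 0 ≤ ℓ) :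
    weightedKinetic a b ℓ g = b * (∫ x in Ioi 0, g x ^ 2) - (b - a) * ∫ x in Ioc 0 ℓ, g x ^ 2 := by
  rw [← h.weightedKinetic_eq b hℓ, weightedKinetic, weightedKinetic]
  ring

/-- Moving from ℓ to ℓ' replaces the weight `b` by the smaller `a` between them. -/
theorem energy_antitone (h : IsProfile w g) {p a b : ℝ} (hab : a ≤ b) {ℓ ℓ' : ℝ} (hℓ : 0 ≤ ℓ)
    (hℓ' : ℓ ≤ ℓ') : profileEnergy p a b ℓ' w g ≤ profileEnergy p a b ℓ w g := by
  rw [profileEnergy, profileEnergy, h.weightedKinetic_eq_sub a b hℓ,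
    h.weightedKinetic_eq_sub a b (hℓ.trans hℓ')]
  have : ∫ x in Ioc 0 ℓ, g x ^ 2 ≤ ∫ x in Ioc 0 ℓ', g x ^ 2 :=
    setIntegral_mono_set (h.integrable_deriv_sq.mono_set fun y hy => hy.1)
      (ae_of_all _ fun _ => sq_nonneg _) (Eventually.of_forall fun y hy => ⟨hy.1, hy.2.trans hℓ'⟩)
  have := mul_le_mul_of_nonneg_left this (sub_nonneg.2 hab)
  linarith

theorem tendsto_energy_atTop (h : IsProfile w g) (p a b : ℝ) :
    Tendsto (fun ℓ => profileEnergy p a b ℓ w g) atTop (𝓝 (profileEnergy p a a 0 w g)) := by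
  have h1 := intervalIntegral_tendsto_integral_Ioi 0 h.integrable_deriv_sq tendsto_id
  have h2 : Tendsto (fun ℓ : ℝ => 1 / 2 * (b * (∫ x in Ioi 0, g x ^ 2) -
      (b - a) * ∫ x in (0)..ℓ, g x ^ 2) - 1 / p * profilePotential p w) atTop
      (𝓝 (1 / 2 * (b * (∫ x in Ioi 0, g x ^ 2) -
      (b - a) * ∫ x in Ioi 0, g x ^ 2) - 1 / p * profilePotential p w)) :=
    (((h1.const_mul (b - a)).const_sub _).const_mul _).sub_const _
  rw [profileEnergy, h.weightedKinetic_eq a le_rfl]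
  refine Tendsto.congr' ?_ (h2.trans_eq ?_)
  · filter_upwards [eventually_ge_atTop 0] with ℓ hℓ
    rw [profileEnergy, h.weightedKinetic_eq_sub a b hℓ, intervalIntegral.integral_of_le hℓ]
  · congr 1; ring

end IsProfile

section CriticalLength

variable {p μ : ℝ} (hp : 2 < p) (hp6 : p < 6) (hμ : 0 < μ)
include hp hp6 hμ

/-- With weight 1 everywhere the infimum lies strictly below that with weight 4. Dilating an almost
optimal profile by 2 turns the weight 4 into 1 and multiplies the potential by q > 1, so the energy
becomes at most q times the old one. A large ℓ realises weight 1 up to a small error. -/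
theorem exists_length_profileEnergyLE : ∃ ℓ, 0 < ℓ ∧ ProfileEnergyLE p μ 1 9 ℓ (lineLevel p μ) := by
  have hneg := lineLevel_neg hp hp6 hμ
  set q : ℝ := 2 ^ ((p - 2) / 2) with hq
  have hq1 : 1 < q := Real.one_lt_rpow (by norm_num) (by linarith)
  have hlt : lineLevel p μ < lineLevel p μ / q := by
    rw [lt_div_iff₀ (by linarith)]; nlinarith
  obtain ⟨w, g, hw, hm, hE⟩ := profileEnergyLE_of_lineLevel_lt hp hp6 hμ
    (show lineLevel p μ < (lineLevel p μ + lineLevel p μ / q) / 2 by linarith)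
  obtain ⟨w', g', hw', hm', hk', hp'⟩ := hw.exists_dilation (p := p) (r := 2) (by norm_num)
  have hE' : profileEnergy p 1 1 0 w' g' < lineLevel p μ := by
    have h1 := hk' 1 1 0 le_rfl
    rw [mul_zero, hw.weightedKinetic_eq 1 le_rfl] at h1
    rw [profileEnergy, hw.weightedKinetic_eq 4 le_rfl] at hE
    rw [profileEnergy, h1, hp', ← hq]
    have hK : 0 ≤ ∫ x in Ioi 0, g x ^ 2 := integral_nonneg fun _ => sq_nonneg _
    have e : lineLevel p μ / q * q = lineLevel p μ := div_mul_cancel₀ _ (by linarith)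
    have h2 : (1 / 2 * (4 * ∫ x in Ioi 0, g x ^ 2) - 1 / p * profilePotential p w) * q <
        lineLevel p μ := by
      rw [← e]
      exact mul_lt_mul_of_pos_right (by linarith) (by linarith)
    have h3 : (∫ x in Ioi 0, g x ^ 2) * 1 ≤ (∫ x in Ioi 0, g x ^ 2) * q := by gcongr
    linarith
  obtain ⟨ℓ, h1, h2⟩ := (((hw'.tendsto_energy_atTop p 1 9).eventually (gt_mem_nhds hE')).and
    (eventually_gt_atTop 0)).exists
  exact ⟨ℓ, h2, w', g', hw', hm'.trans hm, le_of_lt h1⟩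

/-- With weight 9 everywhere the infimum is at least `lineLevel p μ / q`, strictly above `lineLevel
p μ`. Cutting off the part of a profile on (0, ℓ) leaves a shifted profile with weight 9 and loses
at most ℓ M^p of potential energy, so a very small ℓ cannot reach the level of the line. -/
theorem exists_pos_le_length : ∃ δ, 0 < δ ∧ ∀ ℓ, 0 ≤ ℓ →
    ProfileEnergyLE p μ 1 9 ℓ (lineLevel p μ) → δ ≤ ℓ := by
  have hneg := lineLevel_neg hp hp6 hμ
  -- The dilation by 3/2 turns the weight 9 into 4, since 4 (3/2)² = 9.
  set q : ℝ := (3 / 2) ^ ((p - 2) / 2) with hq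
  have hq1 : 1 < q := Real.one_lt_rpow (by norm_num) (by linarith)
  have hlt : lineLevel p μ < lineLevel p μ / q := by
    rw [lt_div_iff₀ (by linarith)]; nlinarith
  set M := (32 * μ ^ 2) ^ (1 / (6 - p)) with hM
  have hM0 : 0 < M := Real.rpow_pos_of_pos (by positivity) _
  have hMp : 0 < M ^ p := Real.rpow_pos_of_pos hM0 _
  refine ⟨(lineLevel p μ / q - lineLevel p μ) / M ^ p, div_pos (by linarith) hMp, ?_⟩
  rintro ℓ hℓ ⟨w, g, hw, hm, hE⟩
  have hw0 := hw.zero_le_of_energy_nonpos hp hp6 hm.le le_rfl (by norm_num) hℓ (hE.trans hneg.le)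
  have hs := hw.comp_add hℓ
  have hms : profileMass (fun x => w (ℓ + x)) ≤ μ := by
    rw [profileMass, IsProfile.integral_Ioi_comp_add (fun x => w x ^ 2), ← hm]
    exact setIntegral_mono_set hw.integrable_sq (ae_of_all _ fun _ => sq_nonneg _)
      (Eventually.of_forall fun y hy => hℓ.trans_lt hy)
  have hks : weightedKinetic 1 1 0 (fun x => g (ℓ + x)) = ∫ x in Ioi ℓ, g x ^ 2 := by
    rw [hs.weightedKinetic_eq 1 le_rfl, IsProfile.integral_Ioi_comp_add (fun x => g x ^ 2), one_mul]
  have hpot : profilePotential p w ≤ ℓ * M ^ p + profilePotential p (fun x => w (ℓ + x)) := by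
    rw [profilePotential, profilePotential, IsProfile.integral_Ioi_comp_add (fun x => w x ^ p),
      ← Ioc_union_Ioi_eq_Ioi hℓ, setIntegral_union (Ioc_disjoint_Ioi le_rfl) measurableSet_Ioi
        ((hw.integrable_rpow hp).mono_set fun y hy => hy.1)
        ((hw.integrable_rpow hp).mono_set fun y hy => hℓ.trans_lt hy)]
    gcongr
    have : ∫ x in Ioc 0 ℓ, w x ^ p ≤ ∫ x in Ioc 0 ℓ, M ^ p :=
      setIntegral_mono_on ((hw.integrable_rpow hp).mono_set fun y hy => hy.1)
        (integrableOn_const (by simp)) measurableSet_Ioc fun y hy =>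
          Real.rpow_le_rpow (hw.nonneg y hy.1.le) ((hw.le_zero hy.1.le).trans hw0) (by linarith)
    simpa [hℓ] using this
  obtain ⟨w', g', hw', hm', hk', hp'⟩ := hs.exists_dilation (p := p) (r := 3 / 2) (by norm_num)
  have h1 := lineLevel_le hp hp6 hμ hw' (hm'.le.trans hms)
  have h2 := hk' 1 1 0 le_rfl
  rw [mul_zero, hks, hw'.weightedKinetic_eq 1 le_rfl] at h2
  rw [profileEnergy, hw'.weightedKinetic_eq 4 le_rfl, hp', ← hq] at h1
  set P := profilePotential p fun x => w (ℓ + x)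
  set K := ∫ x in Ioi ℓ, g x ^ 2
  have hK0 : 0 ≤ K := integral_nonneg fun _ => sq_nonneg _
  have hP0 : 0 ≤ P := hs.potential_nonneg p
  have h3 : lineLevel p μ / q ≤ 9 / 2 * K - 1 / p * P := by
    rw [div_le_iff₀ (by linarith)]
    have : K * 1 ≤ K * q := by gcongr
    nlinarith
  rw [profileEnergy, weightedKinetic] at hE
  have hK1 : 0 ≤ ∫ x in Ioc 0 ℓ, g x ^ 2 := integral_nonneg fun _ => sq_nonneg _
  have h4 : 1 / p * profilePotential p w ≤ ℓ * M ^ p + 1 / p * P := by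
    have hp1 : 1 / p ≤ 1 := by rw [div_le_one (by linarith)]; linarith
    calc 1 / p * profilePotential p w ≤ 1 / p * (ℓ * M ^ p + P) := by gcongr
      _ = 1 / p * (ℓ * M ^ p) + 1 / p * P := by ring
      _ ≤ 1 * (ℓ * M ^ p) + 1 / p * P := by gcongr
      _ = _ := by ring
  rw [div_le_iff₀ hMp]
  linarith

/-- The dilation w(r x) with r = ℓ'/ℓ moves the jump of the weight from ℓ' to ℓ. Mass decreases and
energy rises by O(r - 1), so the level at ℓ is approached arbitrarily well, hence attained. -/
theorem ProfileEnergyLE.of_forall_gt {ℓ : ℝ} (hℓ : 0 < ℓ)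
    (h : ∀ ε, 0 < ε → ∃ ℓ', ℓ ≤ ℓ' ∧ ℓ' < ℓ + ε ∧ ProfileEnergyLE p μ 1 9 ℓ' (lineLevel p μ)) :
    ProfileEnergyLE p μ 1 9 ℓ (lineLevel p μ) := by
  have hneg := lineLevel_neg hp hp6 hμ
  refine .of_forall_pos hp hp6 le_rfl (by norm_num) hℓ.le hneg fun ε hε => ?_
  -- The second bound keeps the energy negative, so that the mass can be scaled back up to μ.
  set ε' := min ε (-lineLevel p μ / 2) with hε'
  have hε'0 : 0 < ε' := lt_min hε (by linarith)
  set B := ((32 * μ ^ 2) ^ (1 / (6 - p))) ^ (p - 2) * μ with hB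
  have hB0 : 0 ≤ B := by positivity
  -- `B` bounds both half the kinetic energy and the potential energy, so 2B controls the rise of
  -- the energy per unit of r - 1.
  obtain ⟨ℓ', hle, hlt, w, g, hw, hm, hE⟩ := h (ℓ * (ε' / (2 * B + 1))) (by positivity)
  refine ProfileEnergyLE.mono (e := lineLevel p μ + ε') ?_
      (by linarith [min_le_left ε (-lineLevel p μ / 2)])
  set r := ℓ' / ℓ with hr
  have hr1 : 1 ≤ r := by rw [hr, one_le_div hℓ]; exact hle
  have hrε : (r - 1) * (2 * B + 1) < ε' := by
    rw [← lt_div_iff₀ (by positivity), hr, div_sub_one hℓ.ne', div_lt_iff₀ hℓ]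
    linarith
  have hr0 : 0 < r := by linarith
  obtain ⟨hk, hP⟩ := hw.weightedKinetic_le hp hp6 hm.le le_rfl (by norm_num)
    (hℓ.le.trans hle) (hE.trans hneg.le)
  refine (hw.comp_mul hr0).profileEnergyLE hp zero_le_one (by norm_num) ?_
    (by linarith [min_le_right ε (-lineLevel p μ / 2)]) ?_
  · rw [IsProfile.profileMass_comp_mul w hr0, hm]
    exact mul_le_of_le_one_left hμ.le (inv_le_one_of_one_le₀ hr1)
  · rw [IsProfile.energy_comp_mul p 1 9 hℓ.le w g hr0, hr, div_mul_cancel₀ _ hℓ.ne', ← hr]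
    rw [profileEnergy] at hE
    have hP0 := hw.potential_nonneg p
    have h1 : 1 / p * profilePotential p w ≤ B := by
      refine (mul_le_of_le_one_left hP0 ?_).trans hP
      rw [div_le_one (by linarith)]; linarith
    have h1' : 0 ≤ 1 / p * profilePotential p w := by positivity
    have h2 : 2 - r ≤ r⁻¹ := by
      rw [← one_div, le_div_iff₀ hr0]; nlinarith [sq_nonneg (r - 1)]
    have h3 : (2 - r) * (1 / p * profilePotential p w) ≤ r⁻¹ * (1 / p * profilePotential p w) := by
      gcongr
    have h4 : (r - 1) * (1 / 2 * weightedKinetic 1 9 ℓ' g + 1 / p * profilePotential p w) ≤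
        (r - 1) * (2 * B + 1) := by
      refine mul_le_mul_of_nonneg_left ?_ (by linarith)
      linarith
    linarith

/-- The lengths at which the star graph with a pendant beats the line form a closed halfline. -/
theorem exists_critical_length : ∃ ℓc, 0 < ℓc ∧ ∀ ℓ, 0 < ℓ →
    (ProfileEnergyLE p μ 1 9 ℓ (lineLevel p μ) ↔ ℓc ≤ ℓ) := by
  set S := {ℓ | 0 < ℓ ∧ ProfileEnergyLE p μ 1 9 ℓ (lineLevel p μ)} with hS
  obtain ⟨δ, hδ, hle⟩ := exists_pos_le_length hp hp6 hμ
  have hne : S.Nonempty := exists_length_profileEnergyLE hp hp6 hμ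
  have hbdd : BddBelow S := ⟨δ, fun ℓ h => hle ℓ h.1.le h.2⟩
  refine ⟨sInf S, hδ.trans_le (le_csInf hne fun ℓ h => hle ℓ h.1.le h.2), fun ℓ hℓ =>
    ⟨fun h => csInf_le hbdd ⟨hℓ, h⟩, fun h => ?_⟩⟩
  have hmono : ∀ ℓ', ℓ' ∈ S → ℓ' ≤ ℓ → ℓ ∈ S := by
    rintro ℓ' ⟨h0, w, g, hw, hm, hE⟩ hle
    exact ⟨hℓ, w, g, hw, hm, (hw.energy_antitone (by norm_num) h0.le hle).trans hE⟩
  -- Lengths slightly above the infimum belong to S; one below ℓ gives ℓ itself by monotonicity, one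
  -- above ℓ serves as an approximation from the right.
  refine ProfileEnergyLE.of_forall_gt hp hp6 hμ hℓ fun ε hε => ?_
  obtain ⟨ℓ', h', hlt⟩ := exists_lt_of_csInf_lt hne (h.trans_lt (lt_add_of_pos_right ℓ hε))
  rcases le_total ℓ ℓ' with hll | hll
  · exact ⟨ℓ', hll, hlt, h'.2⟩
  · exact ⟨ℓ, le_rfl, by linarith, (hmono ℓ' h' hll).2⟩

end CriticalLength

/-! ### Rearrangement and the Pólya–Szegő inequality with multiplicities -/

/-- The nonincreasing rearrangement of a function with distribution `ρ`. -/
noncomputable def rearrangement (ρ : Measure ℝ) (s : ℝ) : ℝ :=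
  sInf {t | 0 ≤ t ∧ ρ (Ioi t) ≤ ENNReal.ofReal s}

section Rearrangement

variable {ρ : Measure ℝ} {M : ℝ}

theorem rearrangement_nonneg (ρ : Measure ℝ) (s : ℝ) : 0 ≤ rearrangement ρ s :=
  Real.sInf_nonneg fun _ h => h.1

theorem rearrangement_antitone (hM0 : 0 ≤ M) (hM : ρ (Ioi M) = 0) :
    Antitone (rearrangement ρ) := fun _ _ hst =>
  csInf_le_csInf ⟨0, fun _ h => h.1⟩ ⟨M, hM0, by simp [hM]⟩
    fun _ h => ⟨h.1, h.2.trans (ENNReal.ofReal_le_ofReal hst)⟩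

/-- Right continuity of t ↦ ρ(t, ∞), in the form of a union of the sets (t + 1/(n+1), ∞). The bound
`M` makes the set in the infimum nonempty, so that its default value 0 plays no role. -/
theorem lt_rearrangement_iff (hM0 : 0 ≤ M) (hM : ρ (Ioi M) = 0) {s t : ℝ} (ht : 0 ≤ t) :
    t < rearrangement ρ s ↔ ENNReal.ofReal s < ρ (Ioi t) := by
  constructor
  · intro h
    by_contra hle
    exact not_le.2 h (csInf_le ⟨0, fun _ h => h.1⟩ ⟨ht, not_lt.1 hle⟩)
  · intro h
    have hU : Ioi t = ⋃ n : ℕ, Ioi (t + 1 / ((n : ℝ) + 1)) := by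
      ext x
      simp only [mem_iUnion, mem_Ioi]
      constructor
      · intro hx
        obtain ⟨n, hn⟩ := exists_nat_one_div_lt (sub_pos.2 hx)
        exact ⟨n, by linarith⟩
      · rintro ⟨n, hn⟩
        have : (0 : ℝ) < 1 / ((n : ℝ) + 1) := by positivity
        linarith
    have hmono : Monotone fun n : ℕ => Ioi (t + 1 / ((n : ℝ) + 1)) := fun m n hmn =>
      Ioi_subset_Ioi (by gcongr)
    rw [hU, hmono.measure_iUnion] at h
    obtain ⟨n, hn⟩ := lt_iSup_iff.1 h
    have hpos : (0 : ℝ) < 1 / ((n : ℝ) + 1) := by positivity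
    refine lt_of_lt_of_le (lt_add_of_pos_right t hpos) (le_csInf ⟨M, hM0, by simp [hM]⟩ ?_)
    rintro τ ⟨-, hτ⟩
    by_contra hlt
    exact not_lt.2 ((measure_mono (Ioi_subset_Ioi (not_le.1 hlt).le)).trans hτ) hn

theorem measure_Ioi_rearrangement_le (hM0 : 0 ≤ M) (hM : ρ (Ioi M) = 0) (s : ℝ) :
    ρ (Ioi (rearrangement ρ s)) ≤ ENNReal.ofReal s := by
  by_contra h
  exact lt_irrefl _ ((lt_rearrangement_iff hM0 hM (rearrangement_nonneg ρ s)).2 (not_le.1 h))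

theorem volume_lt_rearrangement (hM0 : 0 ≤ M) (hM : ρ (Ioi M) = 0) {t : ℝ} (ht : 0 ≤ t) :
    volume.restrict (Ioi 0) {s | t < rearrangement ρ s} = ρ (Ioi t) := by
  have hset : {s | t < rearrangement ρ s} = {s | ENNReal.ofReal s < ρ (Ioi t)} := by
    ext s; exact lt_rearrangement_iff hM0 hM ht
  have hmeas : MeasurableSet {s : ℝ | ENNReal.ofReal s < ρ (Ioi t)} :=
    measurableSet_lt (by fun_prop) measurable_const
  rw [hset, Measure.restrict_apply hmeas]
  rcases eq_or_ne (ρ (Ioi t)) ⊤ with h | h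
  · rw [h]; simp
  · have : {s : ℝ | ENNReal.ofReal s < ρ (Ioi t)} ∩ Ioi 0 = Ioo 0 (ρ (Ioi t)).toReal := by
      ext s
      simp only [mem_inter_iff, mem_ofPred_eq, mem_Ioi, mem_Ioo]
      rw [and_comm]
      refine and_congr_right fun hs => ?_
      rw [ENNReal.ofReal_lt_iff_lt_toReal hs.le h]
    rw [this, Real.volume_Ioo, sub_zero, ENNReal.ofReal_toReal h]

/-- By the layer cake formula both sides depend only on the measures of superlevel sets, and these
agree. -/
theorem lintegral_rearrangement_rpow (hM0 : 0 ≤ M) (hM : ρ (Ioi M) = 0) (h0 : ρ (Iio 0) = 0)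
    {q : ℝ} (hq : 0 < q) :
    ∫⁻ s in Ioi 0, ENNReal.ofReal (rearrangement ρ s ^ q) = ∫⁻ t, ENNReal.ofReal (t ^ q) ∂ρ := by
  rw [lintegral_rpow_eq_lintegral_meas_lt_mul _ (ae_of_all _ (rearrangement_nonneg ρ))
    (rearrangement_antitone hM0 hM).measurable.aemeasurable hq,
    lintegral_rpow_eq_lintegral_meas_lt_mul (f := fun t => t) _ ?_ aemeasurable_id hq]
  · congr 1
    refine setLIntegral_congr_fun measurableSet_Ioi fun t ht => ?_
    rw [volume_lt_rearrangement hM0 hM (le_of_lt ht)]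
    rfl
  · rw [EventuallyLE, ae_iff]
    convert h0 using 2
    ext x; simp

end Rearrangement

section Family

variable {ι : Type*} [Fintype ι]

/-- The distribution of a family of functions `U e` on the sets `I e`. -/
noncomputable def levelMeasure (I : ι → Set ℝ) (U : ι → ℝ → ℝ) : Measure ℝ :=
  ∑ e, (volume.restrict (I e)).map (U e)

variable {I : ι → Set ℝ} {U h : ι → ℝ → ℝ}

theorem levelMeasure_apply (hU : ∀ e, Measurable (U e)) {B : Set ℝ} (hB : MeasurableSet B) :
    levelMeasure I U B = ∑ e, volume.restrict (I e) (U e ⁻¹' B) := by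
  simp only [levelMeasure, Measure.coe_finsetSum, Finset.sum_apply]
  exact Finset.sum_congr rfl fun e _ => Measure.map_apply (hU e) hB

theorem levelMeasure_Ioi_eq_zero (hU : ∀ e, Measurable (U e)) {M : ℝ} (hUM : ∀ e, ∀ x, U e x ≤ M) :
    levelMeasure I U (Ioi M) = 0 := by
  rw [levelMeasure_apply hU measurableSet_Ioi]
  refine Finset.sum_eq_zero fun e _ => ?_
  have : U e ⁻¹' Ioi M = ∅ := by
    ext x; simpa using hUM e x
  rw [this, measure_empty]

theorem levelMeasure_Iio_eq_zero (hU : ∀ e, Measurable (U e)) (hU0 : ∀ e x, 0 ≤ U e x) :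
    levelMeasure I U (Iio 0) = 0 := by
  rw [levelMeasure_apply hU measurableSet_Iio]
  refine Finset.sum_eq_zero fun e _ => ?_
  have : U e ⁻¹' Iio 0 = ∅ := by
    ext x; simpa using hU0 e x
  rw [this, measure_empty]

theorem lintegral_levelMeasure (hU : ∀ e, Measurable (U e)) {f : ℝ → ℝ≥0∞} (hf : Measurable f) :
    ∫⁻ t, f t ∂levelMeasure I U = ∑ e, ∫⁻ x in I e, f (U e x) := by
  rw [levelMeasure, lintegral_finsetSum_measure]
  exact Finset.sum_congr rfl fun e _ => lintegral_map hf (hU e)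

/-- Cauchy–Schwarz on each edge, then for the sum over the edges. -/
theorem sq_sum_integral_le (hU : ∀ e, Measurable (U e))
    (hh : ∀ e, MemLp (h e) 2 (volume.restrict (I e))) {B : Set ℝ} (hB : MeasurableSet B)
    (hfin : levelMeasure I U B ≠ ⊤) :
    (∑ e, ∫ x in U e ⁻¹' B, h e x ∂volume.restrict (I e)) ^ 2 ≤
      (levelMeasure I U B).toReal * ∑ e, ∫ x in U e ⁻¹' B, h e x ^ 2 ∂volume.restrict (I e) := by
  have hBe : ∀ e, volume.restrict (I e) (U e ⁻¹' B) ≠ ⊤ := fun e => by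
    rw [levelMeasure_apply hU hB, ENNReal.sum_ne_top] at hfin
    exact hfin e (Finset.mem_univ e)
  have hnn : ∀ e, 0 ≤ ∫ x in U e ⁻¹' B, h e x ^ 2 ∂volume.restrict (I e) := fun e =>
    integral_nonneg fun _ => sq_nonneg _
  have habs : ∀ e, |∫ x in U e ⁻¹' B, h e x ∂volume.restrict (I e)| ≤
      √((volume.restrict (I e)).real (U e ⁻¹' B)) *
        √(∫ x in U e ⁻¹' B, h e x ^ 2 ∂volume.restrict (I e)) := fun e => by
    have : IsFiniteMeasure ((volume.restrict (I e)).restrict (U e ⁻¹' B)) :=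
      ⟨by rw [Measure.restrict_apply_univ]; exact (hBe e).lt_top⟩
    have := sq_integral_le_measure_mul_integral_sq ((hh e).restrict (U e ⁻¹' B))
    rw [measureReal_restrict_apply_univ] at this
    rw [← Real.sqrt_mul measureReal_nonneg]
    exact Real.abs_le_sqrt this
  have h1 := pow_le_pow_left₀ (abs_nonneg _)
    ((Finset.abs_sum_le_sum_abs _ _).trans
        (Finset.sum_le_sum fun e (_ : e ∈ Finset.univ) => habs e)) 2
  rw [sq_abs] at h1
  have h2 := h1.trans (Finset.sum_mul_sq_le_sq_mul_sq Finset.univ _ _)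
  simp only [Real.sq_sqrt measureReal_nonneg, Real.sq_sqrt (hnn _)] at h2
  rwa [levelMeasure_apply hU hB, ENNReal.toReal_sum fun e _ => hBe e]

theorem levelMeasure_Ioi_ne_top (hU : ∀ e, Measurable (U e))
    (hL : ∀ e, MemLp (U e) 2 (volume.restrict (I e))) {t : ℝ} (ht : 0 < t) :
    levelMeasure I U (Ioi t) ≠ ⊤ := by
  rw [levelMeasure_apply hU measurableSet_Ioi, ENNReal.sum_ne_top]
  intro e _
  have h1 := (hL e).integrable_sq.measure_ge_lt_top (ε := t ^ 2) (by positivity)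
  refine ((measure_mono fun x hx => ?_).trans_lt h1).ne
  exact pow_le_pow_left₀ ht.le (le_of_lt hx) 2

/-- The Pólya–Szegő inequality with multiplicities: if the family crosses every interval of levels
at least `m` times, and at least `n` times if the upper level is exceeded on a set of measure more
than `L`, then the kinetic energy of its rearrangement, weighted by `m ^ 2` and `n ^ 2`, is at most
the kinetic energy of the family. -/
theorem exists_weightedKinetic_rearrangement_le (hU : ∀ e, Measurable (U e))
    (hU0 : ∀ e x, 0 ≤ U e x) {M : ℝ} (hM0 : 0 ≤ M) (hUM : ∀ e, ∀ x, U e x ≤ M)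
    (hL : ∀ e, MemLp (U e) 2 (volume.restrict (I e)))
    (hh : ∀ e, MemLp (h e) 2 (volume.restrict (I e))) {m n L : ℝ} (hm : 0 < m) (hn : 0 < n)
    (hL0 : 0 ≤ L)
    (hcm : ∀ t' t'', 0 ≤ t' → t' < t'' → levelMeasure I U (Ioi t') ≠ ⊤ →
      0 < levelMeasure I U (Ioi t'') →
      m * (t'' - t') ≤ ∑ e, ∫ x in U e ⁻¹' Ioo t' t'', h e x ∂volume.restrict (I e))
    (hcn : ∀ t' t'', 0 ≤ t' → t' < t'' → levelMeasure I U (Ioi t') ≠ ⊤ →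
      ENNReal.ofReal L < levelMeasure I U (Ioi t'') →
      n * (t'' - t') ≤ ∑ e, ∫ x in U e ⁻¹' Ioo t' t'', h e x ∂volume.restrict (I e)) :
    ∃ g, IsProfile (rearrangement (levelMeasure I U)) g ∧
      weightedKinetic (m ^ 2) (n ^ 2) L g ≤ ∑ e, ∫ x in I e, h e x ^ 2 := by
  set ρ := levelMeasure I U with hρ
  set w := rearrangement ρ with hw
  have hM : ρ (Ioi M) = 0 := levelMeasure_Ioi_eq_zero hU hUM
  have h00 : ρ (Iio 0) = 0 := levelMeasure_Iio_eq_zero hU hU0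
  have hanti : Antitone w := rearrangement_antitone hM0 hM
  -- Φ s is the kinetic energy of the family where it exceeds the level w s; it bounds the
  -- increments of w as required for `exists_weightedKinetic_le`.
  set Φ : ℝ → ℝ := fun s => ∑ e, ∫ x in U e ⁻¹' Ioi (w s), h e x ^ 2 ∂volume.restrict (I e) with hΦ
  have hint : ∀ e, Integrable (fun x => h e x ^ 2) (volume.restrict (I e)) := fun e =>
    (hh e).integrable_sq
  have hmono : Monotone Φ := fun s t hst => Finset.sum_le_sum fun e _ =>
    setIntegral_mono_set (hint e).integrableOn (ae_of_all _ fun _ => sq_nonneg _)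
      (Eventually.of_forall fun x (hx : w s < U e x) => (hanti hst).trans_lt hx)
  have key : ∀ c, 0 < c → ∀ s t, 0 ≤ s → s ≤ t →
      (∀ t' t'', 0 ≤ t' → t' < t'' → ρ (Ioi t') ≠ ⊤ → ENNReal.ofReal s < ρ (Ioi t'') →
        c * (t'' - t') ≤ ∑ e, ∫ x in U e ⁻¹' Ioo t' t'', h e x ∂volume.restrict (I e)) →
      c ^ 2 * (w s - w t) ^ 2 ≤ (t - s) * (Φ t - Φ s) := by
    intro c hc s t hs hst hcross
    have ht := hs.trans hst
    rcases (hanti hst).eq_or_lt with heq | hlt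
    · rw [heq, sub_self, zero_pow two_ne_zero, mul_zero]
      exact mul_nonneg (sub_nonneg.2 hst) (sub_nonneg.2 (hmono hst))
    have ht0 : 0 ≤ w t := rearrangement_nonneg ρ t
    have hDt : ρ (Ioi (w t)) ≤ ENNReal.ofReal t := measure_Ioi_rearrangement_le hM0 hM t
    have hDt' : ρ (Ioi (w t)) ≠ ⊤ := (hDt.trans_lt ENNReal.ofReal_lt_top).ne
    -- Levels between w t and τ are taken on a set of measure at most t - s carrying energy at most
    -- Φ t - Φ s, and crossing them c times costs at least c (τ - w t). Cauchy–Schwarz links the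
    -- three. The level stays strictly below w s, where ρ(τ, ∞) > s is available; τ tends to w s
    -- afterwards.
    have hstep : ∀ τ ∈ Ioo (w t) (w s), (c * (τ - w t)) ^ 2 ≤ (t - s) * (Φ t - Φ s) := by
      intro τ hτ
      have hDτ : ENNReal.ofReal s < ρ (Ioi τ) :=
        (lt_rearrangement_iff hM0 hM (ht0.trans hτ.1.le)).1 hτ.2
      have hsub : Ioo (w t) τ ⊆ Ioi (w t) := fun x hx => hx.1
      have hfin : ρ (Ioo (w t) τ) ≠ ⊤ := ((measure_mono hsub).trans_lt hDt'.lt_top).ne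
      have hsum : ρ (Ioo (w t) τ) + ρ (Ioi τ) ≤ ENNReal.ofReal t := by
        have hd : Disjoint (Ioo (w t) τ) (Ioi τ) :=
            disjoint_left.2 fun x hx hx' => lt_asymm hx.2 hx'
        rw [← measure_union hd measurableSet_Ioi]
        exact (measure_mono (union_subset hsub (Ioi_subset_Ioi hτ.1.le))).trans hDt
      have hlen : (ρ (Ioo (w t) τ)).toReal ≤ t - s := by
        have h1 : ρ (Ioo (w t) τ) + ENNReal.ofReal s ≤ ENNReal.ofReal t :=
          (add_le_add_right hDτ.le _).trans hsum
        have h2 := ENNReal.toReal_mono ENNReal.ofReal_ne_top h1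
        rw [ENNReal.toReal_add hfin ENNReal.ofReal_ne_top, ENNReal.toReal_ofReal hs,
          ENNReal.toReal_ofReal ht] at h2
        linarith
      have hcs := sq_sum_integral_le hU hh measurableSet_Ioo hfin
      have hcr := hcross (w t) τ ht0 hτ.1 hDt' hDτ
      have hΦsub : ∑ e, ∫ x in U e ⁻¹' Ioo (w t) τ, h e x ^ 2 ∂volume.restrict (I e) ≤ Φ t - Φ s :=
          by
        rw [le_sub_iff_add_le, hΦ, ← Finset.sum_add_distrib]
        refine Finset.sum_le_sum fun e _ => ?_
        have hd : Disjoint (U e ⁻¹' Ioo (w t) τ) (U e ⁻¹' Ioi (w s)) :=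
          disjoint_left.2 fun x hx hx' => lt_asymm (hx.2.trans hτ.2) hx'
        rw [← setIntegral_union hd (hU e measurableSet_Ioi)
          (hint e).integrableOn (hint e).integrableOn]
        refine setIntegral_mono_set (hint e).integrableOn (ae_of_all _ fun _ => sq_nonneg _)
          (Eventually.of_forall ?_)
        rintro x (hx | hx)
        · exact hx.1
        · exact hlt.trans hx
      calc (c * (τ - w t)) ^ 2 ≤ _ := pow_le_pow_left₀
            (mul_nonneg hc.le (sub_nonneg.2 hτ.1.le)) hcr 2
        _ ≤ _ := hcs
        _ ≤ (t - s) * (Φ t - Φ s) := by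
            refine mul_le_mul hlen hΦsub ?_ (sub_nonneg.2 hst)
            exact Finset.sum_nonneg fun e _ => integral_nonneg fun _ => sq_nonneg _
    have hlim : Tendsto (fun τ => (c * (τ - w t)) ^ 2) (𝓝[<] (w s)) (𝓝 ((c * (w s - w t)) ^ 2)) :=
      (Continuous.tendsto (by fun_prop) _).mono_left nhdsWithin_le_nhds
    rw [← mul_pow]
    refine le_of_tendsto hlim ?_
    filter_upwards [Ioo_mem_nhdsLT hlt] with τ hτ using hstep τ hτ
  obtain ⟨g, hg1, hg2, hg3⟩ := exists_weightedKinetic_le (w := w) (Φ := Φ) (a := m ^ 2)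
    (b := n ^ 2) (ℓ := L) (K := ∑ e, ∫ x in I e, h e x ^ 2) hL0 (by positivity) (by positivity)
    (hmono.monotoneOn _) (Finset.sum_nonneg fun e _ => integral_nonneg fun _ => sq_nonneg _)
    (fun s _ => Finset.sum_le_sum fun e _ =>
      setIntegral_le_integral (hint e) (ae_of_all _ fun _ => sq_nonneg _))
    (fun s t hs hst _ => key m hm s t hs hst fun t' t'' h1 h2 h3 h4 =>
      hcm t' t'' h1 h2 h3 (bot_le.trans_lt h4))
    (fun s t hs hst => key n hn s t (hL0.trans hs) hst fun t' t'' h1 h2 h3 h4 =>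
      hcn t' t'' h1 h2 h3 ((ENNReal.ofReal_le_ofReal hs).trans_lt h4))
  refine ⟨g, ⟨hanti.antitoneOn _, fun x _ => rearrangement_nonneg ρ x, hg1, ?_, hg2⟩, hg3⟩
  rw [memLp_two_iff_integrable_sq hanti.measurable.aestronglyMeasurable]
  refine ⟨(hanti.measurable.pow_const 2).aestronglyMeasurable, ?_⟩
  have e1 := lintegral_rearrangement_rpow hM0 hM h00 (q := 2) two_pos
  rw [hρ, lintegral_levelMeasure hU (by fun_prop)] at e1
  rw [hasFiniteIntegral_iff_ofReal (ae_of_all _ fun _ => sq_nonneg _)]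
  simp only [Real.rpow_two] at e1
  rw [hw, hρ, e1, ENNReal.sum_lt_top]
  intro e _
  have := (hL e).integrable_sq.2
  rwa [hasFiniteIntegral_iff_ofReal (ae_of_all _ fun _ => sq_nonneg _)] at this

theorem integral_rearrangement_rpow (hU : ∀ e, Measurable (U e))
    (hU0 : ∀ e x, 0 ≤ U e x) {M : ℝ} (hM0 : 0 ≤ M) (hUM : ∀ e, ∀ x, U e x ≤ M) {q : ℝ} (hq : 0 < q)
    (hint : ∀ e, IntegrableOn (fun x => U e x ^ q) (I e)) :
    ∫ s in Ioi 0, rearrangement (levelMeasure I U) s ^ q = ∑ e, ∫ x in I e, U e x ^ q := by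
  have hM := levelMeasure_Ioi_eq_zero (I := I) hU hUM
  have h00 := levelMeasure_Iio_eq_zero (I := I) hU hU0
  have e1 := lintegral_rearrangement_rpow hM0 hM h00 hq
  rw [lintegral_levelMeasure hU (by fun_prop)] at e1
  have hnn : ∀ e x, 0 ≤ U e x ^ q := fun e x => Real.rpow_nonneg (hU0 e x) q
  rw [integral_eq_lintegral_of_nonneg_ae
    (ae_of_all _ fun s => Real.rpow_nonneg (rearrangement_nonneg _ s) q)
    (((rearrangement_antitone hM0 hM).measurable.pow_const q).aestronglyMeasurable), e1,
    ENNReal.toReal_sum fun e _ => ?_]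
  · refine Finset.sum_congr rfl fun e _ => ?_
    rw [integral_eq_lintegral_of_nonneg_ae (ae_of_all _ (hnn e)) (hint e).1]
  · have := (hint e).2
    rw [hasFiniteIntegral_iff_ofReal (ae_of_all _ (hnn e))] at this
    exact this.ne

end Family

/-- A continuous function whose increments are controlled by the integrals of `h` crosses the
levels between `c` and `d` at the expense of the integral of `h` over these levels. -/
theorem sub_le_integral_preimage_Ioo {f h : ℝ → ℝ} (hf : Continuous f) {x y c d : ℝ} (hxy : x ≤ y)
    (hx : f x ≤ c) (hy : d ≤ f y) (hh0 : ∀ z, 0 ≤ h z)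
    (hint : IntegrableOn h (Ioc x y))
    (hle : ∀ s t, x ≤ s → s ≤ t → t ≤ y → f t - f s ≤ ∫ z in Ioc s t, h z) :
    d - c ≤ ∫ z in Ioc x y ∩ f ⁻¹' Ioo c d, h z := by
  have hS : IsCompact (Icc x y ∩ f ⁻¹' Iic c) := isCompact_Icc.inter_right
      (isClosed_Iic.preimage hf)
  -- Between the last point s at or below level c and the first later point t at or above level d,
  -- the values lie strictly between c and d.
  obtain ⟨s, ⟨⟨hxs, hsy⟩, hsc⟩, hsmax⟩ := hS.exists_isGreatest ⟨x, ⟨le_rfl, hxy⟩, hx⟩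
  have hT : IsCompact (Icc s y ∩ f ⁻¹' Ici d) := isCompact_Icc.inter_right
      (isClosed_Ici.preimage hf)
  obtain ⟨t, ⟨⟨hst, hty⟩, htd⟩, htmin⟩ := hT.exists_isLeast ⟨y, ⟨hsy, le_rfl⟩, hy⟩
  have hsub : Ioo s t ⊆ Ioc x y ∩ f ⁻¹' Ioo c d := by
    intro z hz
    refine ⟨⟨hxs.trans_lt hz.1, hz.2.le.trans hty⟩, ?_, ?_⟩
    · by_contra hzc
      exact not_le.2 hz.1 (hsmax ⟨⟨hxs.trans hz.1.le, hz.2.le.trans hty⟩, not_lt.1 hzc⟩)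
    · by_contra hzd
      exact not_le.2 hz.2 (htmin ⟨⟨hz.1.le, hz.2.le.trans hty⟩, not_lt.1 hzd⟩)
  have h1 := hle s t hxs hst hty
  rw [integral_Ioc_eq_integral_Ioo] at h1
  have h2 : ∫ z in Ioo s t, h z ≤ ∫ z in Ioc x y ∩ f ⁻¹' Ioo c d, h z :=
    setIntegral_mono_set (hint.mono_set inter_subset_left) (ae_of_all _ hh0)
      (Eventually.of_forall hsub)
  have h3 : f s ≤ c := hsc
  have h4 : d ≤ f t := htd
  linarith

/-- The clamped value max c (min d (f x)) splits [c, d]. With x at the vertex, the levels above it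
must be crossed on the way to a point above d, and those below it on the way to infinity. -/
theorem sub_clamp_le_integral {f h : ℝ → ℝ} (hf : Continuous f) {x y c d : ℝ} (hxy : x ≤ y)
    (hcd : c < d) (hy : d ≤ f y) (hh0 : ∀ z, 0 ≤ h z) (hint : IntegrableOn h (Ioc x y))
    (hle : ∀ s t, x ≤ s → s ≤ t → t ≤ y → |f t - f s| ≤ ∫ z in Ioc s t, h z) :
    d - max c (min d (f x)) ≤ ∫ z in Ioc x y ∩ f ⁻¹' Ioo c d, h z := by
  have hle' : ∀ s t, x ≤ s → s ≤ t → t ≤ y → f t - f s ≤ ∫ z in Ioc s t, h z := fun s t h1 h2 h3 =>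
    (le_abs_self _).trans (hle s t h1 h2 h3)
  rcases lt_or_ge (f x) d with hx | hx
  · have h1 := sub_le_integral_preimage_Ioo hf hxy (le_max_right c (f x)) hy hh0
      hint hle'
    rw [min_eq_right hx.le]
    refine h1.trans (setIntegral_mono_set (hint.mono_set inter_subset_left) (ae_of_all _ hh0)
      (Eventually.of_forall fun z hz => ⟨hz.1, (le_max_left _ _).trans_lt hz.2.1, hz.2.2⟩))
  · rw [min_eq_left hx, max_eq_right hcd.le, sub_self]
    exact integral_nonneg hh0

theorem clamp_sub_le_integral {f h : ℝ → ℝ} (hf : Continuous f) {x y c d : ℝ} (hxy : x ≤ y)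
    (hcd : c < d) (hy : f y ≤ c) (hh0 : ∀ z, 0 ≤ h z) (hint : IntegrableOn h (Ioc x y))
    (hle : ∀ s t, x ≤ s → s ≤ t → t ≤ y → |f t - f s| ≤ ∫ z in Ioc s t, h z) :
    max c (min d (f x)) - c ≤ ∫ z in Ioc x y ∩ f ⁻¹' Ioo c d, h z := by
  have hle' : ∀ s t, x ≤ s → s ≤ t → t ≤ y → -f t - -f s ≤ ∫ z in Ioc s t, h z :=
    fun s t h1 h2 h3 => by
      have := (neg_le_abs _).trans (hle s t h1 h2 h3)
      linarith
  rcases lt_or_ge c (f x) with hx | hx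
  · have h1 := sub_le_integral_preimage_Ioo hf.neg hxy (neg_le_neg (min_le_right d (f x)))
      (neg_le_neg hy) hh0 hint hle'
    rw [max_eq_right (le_min hcd.le hx.le)]
    have h2 : min d (f x) - c = -c - -min d (f x) := by ring
    rw [h2]
    refine h1.trans (setIntegral_mono_set (hint.mono_set inter_subset_left) (ae_of_all _ hh0)
      (Eventually.of_forall fun z hz => ⟨hz.1, neg_lt_neg_iff.1 hz.2.2, ?_⟩))
    exact (neg_lt_neg_iff.1 hz.2.1).trans_le (min_le_left _ _)
  · rw [max_eq_left ((min_le_right _ _).trans hx), sub_self]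
    exact integral_nonneg hh0

/-! ### Counting level crossings on the star graph -/

/-- The edges of the star graph with three halflines and a pendant of length `ℓ`. -/
def starEdge (ℓ : ℝ) (e : Option (Fin 3)) : Set ℝ := e.elim (Icc 0 ℓ) fun _ => Ici 0

/-- The modulus `U` of a function in `H¹` of the star graph and the modulus `h` of its
derivative. -/
structure IsStarFunction (ℓ : ℝ) (U h : Option (Fin 3) → ℝ → ℝ) : Prop where
  continuous : ∀ e, Continuous (U e)
  nonneg : ∀ e x, 0 ≤ U e x
  nonneg_deriv : ∀ e x, 0 ≤ h e x
  vertex : ∀ e, U e 0 = U none 0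
  bdd : ∃ M, 0 ≤ M ∧ ∀ e x, U e x ≤ M
  memLp : ∀ e, MemLp (U e) 2 (volume.restrict (starEdge ℓ e))
  memLp_deriv : ∀ e, MemLp (h e) 2 (volume.restrict (starEdge ℓ e))
  abs_sub_le : ∀ e x y, x ∈ starEdge ℓ e → y ∈ starEdge ℓ e → x ≤ y →
    |U e y - U e x| ≤ ∫ z in Ioc x y, h e z

theorem ordConnected_starEdge (ℓ : ℝ) (e : Option (Fin 3)) : (starEdge ℓ e).OrdConnected := by
  cases e
  · exact ordConnected_Icc
  · exact ordConnected_Ici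

theorem zero_mem_starEdge {ℓ : ℝ} (hℓ : 0 ≤ ℓ) (e : Option (Fin 3)) : 0 ∈ starEdge ℓ e := by
  cases e
  · exact ⟨le_rfl, hℓ⟩
  · exact mem_Ici.2 le_rfl

theorem nonneg_of_mem_starEdge {ℓ x : ℝ} {e : Option (Fin 3)} (hx : x ∈ starEdge ℓ e) : 0 ≤ x := by
  cases e
  · exact hx.1
  · exact hx

namespace IsStarFunction

variable {ℓ : ℝ} {U h : Option (Fin 3) → ℝ → ℝ}

theorem measurable (H : IsStarFunction ℓ U h) (e : Option (Fin 3)) : Measurable (U e) :=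
  (H.continuous e).measurable

theorem integrableOn_deriv (H : IsStarFunction ℓ U h) {e : Option (Fin 3)} {x y : ℝ}
    (hx : x ∈ starEdge ℓ e) (hy : y ∈ starEdge ℓ e) : IntegrableOn (h e) (Icc x y) := by
  have h1 : MemLp (h e) 2 (volume.restrict (Icc x y)) :=
    (H.memLp_deriv e).mono_measure
        (Measure.restrict_mono ((ordConnected_starEdge ℓ e).out hx hy) le_rfl)
  exact h1.integrable (by norm_num)

/-- The part of the integral of `h` over the edge `e` at the levels of `U` between `c` and `d`. -/
noncomputable def crossing (ℓ : ℝ) (U h : Option (Fin 3) → ℝ → ℝ) (c d : ℝ) (e : Option (Fin 3)) :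
    ℝ :=
  ∫ x in U e ⁻¹' Ioo c d, h e x ∂volume.restrict (starEdge ℓ e)

theorem crossing_nonneg (H : IsStarFunction ℓ U h) (c d : ℝ) (e : Option (Fin 3)) :
    0 ≤ crossing ℓ U h c d e := integral_nonneg (H.nonneg_deriv e)

/-- Staying above c on [R, ∞) would make the superlevel set infinite. -/
theorem exists_far_le (H : IsStarFunction ℓ U h) {c : ℝ}
    (hc : levelMeasure (starEdge ℓ) U (Ioi c) ≠ ⊤)
    (i : Fin 3) {R : ℝ} (hR : 0 ≤ R) : ∃ x, R ≤ x ∧ U (some i) x ≤ c := by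
  by_contra! hcon
  rw [levelMeasure_apply H.measurable measurableSet_Ioi, ENNReal.sum_ne_top] at hc
  refine hc (some i) (Finset.mem_univ _) (top_le_iff.1 ?_)
  rw [Measure.restrict_apply (H.measurable _ measurableSet_Ioi)]
  calc ⊤ = volume (Ici R) := by simp
    _ ≤ volume (U (some i) ⁻¹' Ioi c ∩ Ici 0) :=
        measure_mono fun x hx => ⟨hcon x hx, hR.trans hx⟩

/-- On a halfline the derivative is only in L², but the levels above c are taken on a set of finite
measure. -/
theorem integrableOn_crossing (H : IsStarFunction ℓ U h) {e : Option (Fin 3)} {c d : ℝ}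
    (hfin : levelMeasure (starEdge ℓ) U (Ioi c) ≠ ⊤) :
    IntegrableOn (h e) (U e ⁻¹' Ioo c d) (volume.restrict (starEdge ℓ e)) := by
  have hle : volume.restrict (starEdge ℓ e) (U e ⁻¹' Ioo c d) ≠ ⊤ := by
    rw [levelMeasure_apply H.measurable measurableSet_Ioi, ENNReal.sum_ne_top] at hfin
    exact ((measure_mono fun x (hx : U e x ∈ Ioo c d) => hx.1).trans_lt
        (hfin e (Finset.mem_univ e)).lt_top).ne
  have : IsFiniteMeasure ((volume.restrict (starEdge ℓ e)).restrict (U e ⁻¹' Ioo c d)) :=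
    ⟨by rw [Measure.restrict_apply_univ]; exact hle.lt_top⟩
  exact ((H.memLp_deriv e).restrict _).integrable (by norm_num)

theorem setIntegral_le_crossing (H : IsStarFunction ℓ U h) {e : Option (Fin 3)} {c d : ℝ}
    (hfin : levelMeasure (starEdge ℓ) U (Ioi c) ≠ ⊤) {S : Set ℝ}
    (hS : S ⊆ starEdge ℓ e) :
    ∫ x in S ∩ U e ⁻¹' Ioo c d, h e x ≤ crossing ℓ U h c d e := by
  have hi := H.integrableOn_crossing (e := e) (d := d) hfin
  have hB := H.measurable e (measurableSet_Ioo (a := c) (b := d))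
  rw [crossing, Measure.restrict_restrict hB]
  rw [IntegrableOn, Measure.restrict_restrict hB] at hi
  exact setIntegral_mono_set hi (ae_of_all _ (H.nonneg_deriv e))
    (Eventually.of_forall fun x hx => ⟨hx.2, hS hx.1⟩)

/-- A part of an edge from the vertex up to a point above the level `d`. -/
theorem sub_clamp_le_crossing (H : IsStarFunction ℓ U h) {e : Option (Fin 3)} {c d y : ℝ}
    (hℓ : 0 ≤ ℓ) (hcd : c < d) (hfin : levelMeasure (starEdge ℓ) U (Ioi c) ≠ ⊤)
    (hy : y ∈ starEdge ℓ e) (hdy : d ≤ U e y) :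
    d - max c (min d (U none 0)) ≤ crossing ℓ U h c d e := by
  have h0 := zero_mem_starEdge hℓ e
  have hsub := (ordConnected_starEdge ℓ e).out h0 hy
  rw [← H.vertex e]
  exact (sub_clamp_le_integral (H.continuous e) (nonneg_of_mem_starEdge hy) hcd hdy
      (H.nonneg_deriv e)
    ((H.integrableOn_deriv h0 hy).mono_set Ioc_subset_Icc_self) fun s t h1 h2 h3 =>
      H.abs_sub_le e s t (hsub ⟨h1, h2.trans h3⟩) (hsub ⟨h1.trans h2, h3⟩) h2).trans
    (H.setIntegral_le_crossing hfin (Ioc_subset_Icc_self.trans hsub))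

theorem clamp_sub_le_crossing (H : IsStarFunction ℓ U h) (i : Fin 3) {c d : ℝ}
    (hℓ : 0 ≤ ℓ) (hcd : c < d) (hfin : levelMeasure (starEdge ℓ) U (Ioi c) ≠ ⊤) :
    max c (min d (U none 0)) - c ≤ crossing ℓ U h c d (some i) := by
  obtain ⟨R, hR0, hR⟩ := H.exists_far_le hfin i le_rfl
  have h0 := zero_mem_starEdge hℓ (some i)
  have hRe : R ∈ starEdge ℓ (some i) := hR0
  have hsub := (ordConnected_starEdge ℓ (some i)).out h0 hRe
  rw [← H.vertex (some i)]
  exact (clamp_sub_le_integral (H.continuous _) hR0 hcd hR (H.nonneg_deriv _)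
    ((H.integrableOn_deriv h0 hRe).mono_set Ioc_subset_Icc_self) fun s t h1 h2 h3 =>
      H.abs_sub_le _ s t (hsub ⟨h1, h2.trans h3⟩) (hsub ⟨h1.trans h2, h3⟩) h2).trans
    (H.setIntegral_le_crossing hfin (Ioc_subset_Icc_self.trans hsub))

/-- A halfline with a point above the level `d`. -/
theorem hump_le_crossing (H : IsStarFunction ℓ U h) {i : Fin 3} {c d y : ℝ}
    (hℓ : 0 ≤ ℓ) (hcd : c < d) (hfin : levelMeasure (starEdge ℓ) U (Ioi c) ≠ ⊤)
    (hy : 0 ≤ y) (hdy : d ≤ U (some i) y) :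
    (d - max c (min d (U none 0))) + (d - c) ≤ crossing ℓ U h c d (some i) := by
  obtain ⟨R, hyR, hR⟩ := H.exists_far_le hfin i hy
  have h0 := zero_mem_starEdge hℓ (some i)
  have hye : y ∈ starEdge ℓ (some i) := hy
  have hRe : R ∈ starEdge ℓ (some i) := hy.trans hyR
  have hsub := (ordConnected_starEdge ℓ (some i)).out h0 hRe
  have hi := (H.integrableOn_deriv h0 hRe)
  have h1 := sub_clamp_le_integral (H.continuous _) hy hcd hdy (H.nonneg_deriv _)
    (hi.mono_set fun z hz => ⟨hz.1.le, hz.2.trans hyR⟩) fun s t h1 h2 h3 =>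
      H.abs_sub_le _ s t (hsub ⟨h1, (h2.trans h3).trans hyR⟩) (hsub ⟨h1.trans h2, h3.trans hyR⟩) h2
  have h2 := clamp_sub_le_integral (H.continuous _) hyR hcd hR (H.nonneg_deriv _)
    (hi.mono_set fun z hz => ⟨hy.trans hz.1.le, hz.2⟩) fun s t h1 h2 h3 =>
      H.abs_sub_le _ s t (hsub ⟨hy.trans h1, h2.trans h3⟩) (hsub ⟨(hy.trans h1).trans h2, h3⟩) h2
  rw [min_eq_left hdy, max_eq_right hcd.le] at h2
  rw [H.vertex (some i)] at h1
  have h3 := H.setIntegral_le_crossing (d := d) hfin (Ioc_subset_Icc_self.trans hsub)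
  have hB := H.measurable (some i) (measurableSet_Ioo (a := c) (b := d))
  have hi' : IntegrableOn (h (some i)) (Ioc 0 R ∩ U (some i) ⁻¹' Ioo c d) :=
    hi.mono_set (inter_subset_left.trans Ioc_subset_Icc_self)
  rw [← Ioc_union_Ioc_eq_Ioc hy hyR, union_inter_distrib_right] at hi' h3
  have hd : Disjoint (Ioc 0 y ∩ U (some i) ⁻¹' Ioo c d) (Ioc y R ∩ U (some i) ⁻¹' Ioo c d) :=
    (Ioc_disjoint_Ioc_of_le le_rfl).mono inter_subset_left inter_subset_left
  rw [setIntegral_union hd (measurableSet_Ioc.inter hB) hi'.left_of_union hi'.right_of_union] at h3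
  linarith

theorem exists_lt_of_levelMeasure_pos (H : IsStarFunction ℓ U h) {d : ℝ}
    (hd : 0 < levelMeasure (starEdge ℓ) U (Ioi d)) : ∃ e, ∃ x ∈ starEdge ℓ e, d < U e x := by
  by_contra! hcon
  refine hd.ne' ?_
  rw [levelMeasure_apply H.measurable measurableSet_Ioi]
  refine Finset.sum_eq_zero fun e _ => ?_
  rw [Measure.restrict_apply (H.measurable _ measurableSet_Ioi)]
  convert measure_empty (μ := (volume : Measure ℝ))
  ext x
  simp only [mem_inter_iff, mem_preimage, mem_Ioi, mem_empty_iff_false, iff_false, not_and]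
  exact fun h1 h2 => not_lt.2 (hcon e x h2) h1

/-- The pendant has measure only ℓ, so a larger superlevel set meets a halfline. -/
theorem exists_halfline_lt (H : IsStarFunction ℓ U h) {d : ℝ}
    (hd : ENNReal.ofReal ℓ < levelMeasure (starEdge ℓ) U (Ioi d)) :
    ∃ i x, 0 ≤ x ∧ d < U (some i) x := by
  by_contra! hcon
  refine not_le.2 hd ?_
  rw [levelMeasure_apply H.measurable measurableSet_Ioi, Fintype.sum_option]
  have : ∑ i : Fin 3, volume.restrict (starEdge ℓ (some i)) (U (some i) ⁻¹' Ioi d) = 0 := by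
    refine Finset.sum_eq_zero fun i _ => ?_
    rw [Measure.restrict_apply (H.measurable _ measurableSet_Ioi)]
    convert measure_empty (μ := (volume : Measure ℝ))
    ext x
    simp only [mem_inter_iff, mem_preimage, mem_Ioi, mem_empty_iff_false, iff_false, not_and]
    exact fun h1 h2 => not_lt.2 (hcon i x h2) h1
  rw [this, add_zero]
  refine (measure_mono (subset_univ _)).trans ?_
  rw [Measure.restrict_apply_univ]
  simp [starEdge]

/-- Rearrangement of a function that attains its maximum on the pendant. -/
theorem exists_weightedKinetic_le_of_pendant (H : IsStarFunction ℓ U h) (hℓ : 0 ≤ ℓ)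
    (hmax : ∃ x₀ ∈ Icc 0 ℓ, ∀ i y, 0 ≤ y → U (some i) y ≤ U none x₀) :
    ∃ g, IsProfile (rearrangement (levelMeasure (starEdge ℓ) U)) g ∧
      weightedKinetic 1 9 ℓ g ≤ ∑ e, ∫ x in starEdge ℓ e, h e x ^ 2 := by
  obtain ⟨x₀, hx₀, hmax⟩ := hmax
  obtain ⟨M, hM0, hM⟩ := H.bdd
  have key := exists_weightedKinetic_rearrangement_le H.measurable H.nonneg hM0 hM H.memLp
    H.memLp_deriv (m := 1) (n := 3) (L := ℓ) one_pos (by norm_num) hℓ ?_ ?_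
  · norm_num at key
    exact key
  · intro c d _ hcd hfin hpos
    change _ ≤ ∑ e, crossing ℓ U h c d e
    rw [Fintype.sum_option, Fin.sum_univ_three]
    have n0 := H.crossing_nonneg c d none
    have n1 := H.crossing_nonneg c d (some 0)
    have n2 := H.crossing_nonneg c d (some 1)
    have n3 := H.crossing_nonneg c d (some 2)
    obtain ⟨e, x, hx, hdx⟩ := H.exists_lt_of_levelMeasure_pos hpos
    cases e with
    | none =>
      have h1 := H.sub_clamp_le_crossing hℓ hcd hfin hx hdx.le
      have h2 := H.clamp_sub_le_crossing 0 hℓ hcd hfin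
      linarith
    | some i =>
      have h1 := H.hump_le_crossing hℓ hcd hfin (y := x) hx hdx.le
      have h2 : max c (min d (U none 0)) ≤ d := max_le hcd.le (min_le_left _ _)
      fin_cases i <;> simp at h1 <;> linarith
  -- With v the vertex value clamped to [c, d]: the pendant contributes d - v, the halfline with a
  -- point above d contributes (d - v) + (d - c), and the two others v - c each. The sum is 3(d -
  -- c).
  · intro c d _ hcd hfin hpos
    change _ ≤ ∑ e, crossing ℓ U h c d e
    rw [Fintype.sum_option, Fin.sum_univ_three]
    obtain ⟨i, y, hy, hdy⟩ := H.exists_halfline_lt hpos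
    have h0 := H.sub_clamp_le_crossing hℓ hcd hfin (e := none) hx₀ (hdy.le.trans (hmax i y hy))
    have h1 := H.hump_le_crossing hℓ hcd hfin hy hdy.le
    have h2 := fun j => H.clamp_sub_le_crossing j hℓ hcd hfin
    have h20 := h2 0
    have h21 := h2 1
    have h22 := h2 2
    fin_cases i <;> simp at h1 <;> linarith

theorem exists_hump (H : IsStarFunction ℓ U h)
    (hmax : ∀ x₀ ∈ Icc 0 ℓ, ∃ i y, 0 ≤ y ∧ U none x₀ < U (some i) y) {d : ℝ}
    (hd : 0 < levelMeasure (starEdge ℓ) U (Ioi d)) : ∃ i y, 0 ≤ y ∧ d ≤ U (some i) y := by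
  obtain ⟨e, x, hx, hdx⟩ := H.exists_lt_of_levelMeasure_pos hd
  cases e with
  | none =>
    obtain ⟨i, y, hy, hlt⟩ := hmax x hx
    exact ⟨i, y, hy, (hdx.trans hlt).le⟩
  | some i => exact ⟨i, x, hx, hdx.le⟩

/-- A halfline exceeding level d contributes (d - v) + (d - c), where v is the clamped vertex value;
one other halfline supplies the missing v - c. -/
theorem two_mul_le_crossing (H : IsStarFunction ℓ U h) (hℓ : 0 ≤ ℓ)
    (hmax : ∀ x₀ ∈ Icc 0 ℓ, ∃ i y, 0 ≤ y ∧ U none x₀ < U (some i) y) {c d : ℝ}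
    (hcd : c < d) (hfin : levelMeasure (starEdge ℓ) U (Ioi c) ≠ ⊤)
    (hpos : 0 < levelMeasure (starEdge ℓ) U (Ioi d)) :
    2 * (d - c) ≤ ∑ e, ∫ x in U e ⁻¹' Ioo c d, h e x ∂volume.restrict (starEdge ℓ e) := by
  change _ ≤ ∑ e, crossing ℓ U h c d e
  rw [Fintype.sum_option, Fin.sum_univ_three]
  obtain ⟨i, y, hy, hdy⟩ := H.exists_hump hmax hpos
  have h0 := H.crossing_nonneg c d none
  have h1 := H.hump_le_crossing hℓ hcd hfin hy hdy
  have h2 := fun j => H.clamp_sub_le_crossing j hℓ hcd hfin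
  have h20 := h2 0
  have h21 := h2 1
  have h22 := h2 2
  have h3 : c ≤ max c (min d (U none 0)) := le_max_left _ _
  fin_cases i <;> simp at h1 <;> linarith

/-- Rearrangement of a function that does not attain its maximum on the pendant. -/
theorem exists_weightedKinetic_le_of_halfline (H : IsStarFunction ℓ U h) (hℓ : 0 ≤ ℓ)
    (hmax : ∀ x₀ ∈ Icc 0 ℓ, ∃ i y, 0 ≤ y ∧ U none x₀ < U (some i) y) :
    ∃ g, IsProfile (rearrangement (levelMeasure (starEdge ℓ) U)) g ∧
      weightedKinetic 4 4 0 g ≤ ∑ e, ∫ x in starEdge ℓ e, h e x ^ 2 := by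
  obtain ⟨M, hM0, hM⟩ := H.bdd
  have key := exists_weightedKinetic_rearrangement_le H.measurable H.nonneg hM0 hM H.memLp
    H.memLp_deriv (m := 2) (n := 2) (L := 0) two_pos two_pos le_rfl
    (fun c d _ hcd hfin hpos => H.two_mul_le_crossing hℓ hmax hcd hfin hpos)
    (fun c d _ hcd hfin hpos => H.two_mul_le_crossing hℓ hmax hcd hfin (bot_le.trans_lt hpos))
  norm_num at key
  exact key

/-- If moreover the function does not vanish at the vertex, its kinetic energy is strictly larger
than that of its symmetric rearrangement on the line. -/
theorem exists_weightedKinetic_lt_of_halfline (H : IsStarFunction ℓ U h) (hℓ : 0 ≤ ℓ)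
    (hmax : ∀ x₀ ∈ Icc 0 ℓ, ∃ i y, 0 ≤ y ∧ U none x₀ < U (some i) y) (ha : 0 < U none 0) :
    ∃ g, IsProfile (rearrangement (levelMeasure (starEdge ℓ) U)) g ∧
      weightedKinetic 4 4 0 g < ∑ e, ∫ x in starEdge ℓ e, h e x ^ 2 := by
  obtain ⟨M, hM0, hM⟩ := H.bdd
  set ρ := levelMeasure (starEdge ℓ) U with hρ
  set a := U none 0 with hadef
  have hDa : ρ (Ioi a) ≠ ⊤ := levelMeasure_Ioi_ne_top H.measurable H.memLp ha
  set L := (ρ (Ioi a)).toReal with hL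
  have hL0 : 0 ≤ L := ENNReal.toReal_nonneg
  have hLa : ENNReal.ofReal L = ρ (Ioi a) := ENNReal.ofReal_toReal hDa
  -- Levels below the vertex value a are crossed on all three halflines. They correspond to
  -- positions beyond L, the measure of the set above a, where the weight improves from 4 to 9.
  have key := exists_weightedKinetic_rearrangement_le H.measurable H.nonneg hM0 hM H.memLp
    H.memLp_deriv (m := 2) (n := 3) (L := L) two_pos (by norm_num) hL0
    (fun c d _ hcd hfin hpos => H.two_mul_le_crossing hℓ hmax hcd hfin hpos) ?_
  · norm_num at key
    obtain ⟨g, hg, hK⟩ := key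
    refine ⟨g, hg, lt_of_lt_of_le ?_ hK⟩
    rw [hg.weightedKinetic_eq 4 le_rfl, ← hg.weightedKinetic_eq 4 hL0, weightedKinetic,
      weightedKinetic]
    have hnn : 0 ≤ ∫ x in Ioi L, g x ^ 2 := integral_nonneg fun _ => sq_nonneg _
    suffices h0 : 0 < ∫ x in Ioi L, g x ^ 2 by linarith
    -- Without kinetic energy beyond L the rearrangement is constant there, hence zero since the
    -- mass is finite. Then values in (0, a) occur only on a null set, although each halfline must
    -- descend through them.
    refine hnn.lt_of_ne fun h0 => ?_
    have hconst : ∀ y, L ≤ y → rearrangement ρ L = rearrangement ρ y := fun y hy => by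
      have h1 := hg.sq_sub_le hL0 hy
      have h2 : ∫ t in Ioc L y, g t ^ 2 ≤ 0 := by
        rw [h0]
        exact setIntegral_mono_set (hg.integrable_deriv_sq.mono_set fun y hy => hL0.trans_lt hy)
          (ae_of_all _ fun _ => sq_nonneg _) (Eventually.of_forall fun y hy => hy.1)
      have h3 := mul_nonpos_of_nonneg_of_nonpos (sub_nonneg.2 hy) h2
      have h4 := pow_eq_zero_iff (two_ne_zero) |>.1 (le_antisymm (h1.trans h3) (sq_nonneg _))
      linarith
    have hz : rearrangement ρ L = 0 := by
      by_contra hne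
      have hpos : 0 < rearrangement ρ L ^ 2 := by positivity
      obtain ⟨y, hy⟩ := exists_gt (max L (profileMass (rearrangement ρ) / rearrangement ρ L ^ 2))
      have hLy : L ≤ y := (le_max_left _ _).trans hy.le
      have h1 := hg.mul_sq_le_mass (hL0.trans hLy)
      rw [← hconst y hLy] at h1
      have h2 := (le_max_right _ _).trans_lt hy
      rw [div_lt_iff₀ hpos] at h2
      linarith
    have hD0 : ρ (Ioi 0) ≤ ρ (Ioi a) := by
      have := measure_Ioi_rearrangement_le hM0
          (levelMeasure_Ioi_eq_zero (I := starEdge ℓ) H.measurable hM) L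
      rwa [← hρ, hz, hLa] at this
    have hfin0 : ρ (Ioi 0) ≠ ⊤ := (hD0.trans_lt hDa.lt_top).ne
    have hnull : ρ (Ioo 0 a) = 0 := by
      have hd : Disjoint (Ioo 0 a) (Ioi a) := disjoint_left.2 fun x hx hx' => lt_asymm hx.2 hx'
      have h1 : ρ (Ioo 0 a) + ρ (Ioi a) ≤ 0 + ρ (Ioi a) := by
        rw [← measure_union hd measurableSet_Ioi, zero_add]
        exact (measure_mono (union_subset (fun x hx => hx.1) (Ioi_subset_Ioi ha.le))).trans hD0
      exact le_bot_iff.1 ((ENNReal.add_le_add_iff_right hDa).1 h1)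
    have hcs := sq_sum_integral_le H.measurable H.memLp_deriv
        (measurableSet_Ioo (a := (0 : ℝ)) (b := a))
      (by rw [← hρ, hnull]; simp)
    rw [← hρ, hnull, ENNReal.toReal_zero, zero_mul] at hcs
    have hs0 := pow_eq_zero_iff (two_ne_zero) |>.1 (le_antisymm hcs (sq_nonneg _))
    change ∑ e, crossing ℓ U h 0 a e = 0 at hs0
    have h1 := H.clamp_sub_le_crossing 0 hℓ ha hfin0
    rw [min_self, max_eq_right ha.le] at h1
    have h2 := Finset.single_le_sum (fun e _ => H.crossing_nonneg 0 a e) (Finset.mem_univ (some 0))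
    linarith
  · intro c d _ hcd hfin hpos
    -- A level whose superlevel set has measure more than L cannot lie above a.
    have hda : d ≤ a := by
      by_contra hlt
      rw [hLa] at hpos
      exact not_le.2 hpos (measure_mono (Ioi_subset_Ioi (not_le.1 hlt).le))
    change _ ≤ ∑ e, crossing ℓ U h c d e
    rw [Fintype.sum_option, Fin.sum_univ_three]
    have h0 := H.crossing_nonneg c d none
    have h2 := fun j => H.clamp_sub_le_crossing j hℓ hcd hfin
    rw [← hadef, min_eq_left hda, max_eq_right hcd.le] at h2
    have h20 := h2 0
    have h21 := h2 1
    have h22 := h2 2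
    linarith

end IsStarFunction

/-! ### From H¹ of the star graph to profiles -/

namespace MetricGraph

variable {ℓ : ℝ}

theorem interval_star (hℓ : 0 ≤ ℓ) (e : Option (Fin 3)) : (threeHalflinesWithPendant ℓ).interval e =
    starEdge ℓ e := by
  cases e with
  | none =>
    ext x
    simp only [interval, threeHalflinesWithPendant, starEdge, Option.elim, mem_ofPred_eq, mem_Icc]
    rw [ENNReal.ofReal_le_ofReal_iff hℓ]
  | some i =>
    ext x
    simp [interval, threeHalflinesWithPendant, starEdge]

theorem isClosed_starEdge (ℓ : ℝ) (e : Option (Fin 3)) : IsClosed (starEdge ℓ e) := by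
  cases e
  · exact isClosed_Icc
  · exact isClosed_Ici

theorem interior_starEdge_nonempty (hℓ : 0 < ℓ) (e : Option (Fin 3)) :
    (interior (starEdge ℓ e)).Nonempty := by
  cases e
  · change (interior (Icc 0 ℓ)).Nonempty
    rw [interior_Icc]; exact nonempty_Ioo.2 hℓ
  · change (interior (Ici (0 : ℝ))).Nonempty
    rw [interior_Ici]; exact nonempty_Ioi

theorem integral_star (hℓ : 0 ≤ ℓ) (f : Option (Fin 3) → ℝ → ℝ) :
    (threeHalflinesWithPendant ℓ).integral f = ∑ e, ∫ x in starEdge ℓ e, f e x := by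
  change ∑ e : Option (Fin 3), ∫ x in (threeHalflinesWithPendant ℓ).interval e, f e x = _
  exact Finset.sum_congr rfl fun e _ => by rw [interval_star hℓ]

theorem _root_.MeasureTheory.MemLp.locallyIntegrableOn_of_two {f : ℝ → ℂ} {I : Set ℝ}
    (hf : MemLp f 2 (volume.restrict I)) : LocallyIntegrableOn f I :=
  locallyIntegrableOn_of_locallyIntegrable_restrict (hf.locallyIntegrable (by norm_num))

namespace H1

theorem continuousOn_star (hℓ : 0 < ℓ) (u : (threeHalflinesWithPendant ℓ).H1) (e : Option (Fin 3)) :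
    ContinuousOn (u.toFun e) (starEdge ℓ e) := by
  have := u.continuous.1 e
  rwa [interval_star hℓ.le] at this

theorem memLp_star (hℓ : 0 < ℓ) (u : (threeHalflinesWithPendant ℓ).H1) (e : Option (Fin 3)) : MemLp
    (u.toFun e) 2 (volume.restrict (starEdge ℓ e)) := by
  have := u.memLp e
  rwa [interval_star hℓ.le] at this

theorem memLp_weakDeriv_star (hℓ : 0 < ℓ) (u : (threeHalflinesWithPendant ℓ).H1)
    (e : Option (Fin 3)) :
    MemLp (u.weakDeriv e) 2 (volume.restrict (starEdge ℓ e)) := by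
  have := u.memLp_weakDeriv e
  rwa [interval_star hℓ.le] at this

theorem sub_eq_integral_star (hℓ : 0 < ℓ) (u : (threeHalflinesWithPendant ℓ).H1)
    (e : Option (Fin 3)) {x y : ℝ} (hx : x ∈ starEdge ℓ e)
    (hy : y ∈ starEdge ℓ e) : u.toFun e y - u.toFun e x = ∫ s in x..y, u.weakDeriv e s := by
  have := u.hasWeakDerivOn e
  rw [interval_star hℓ.le] at this
  have := ordConnected_starEdge ℓ e
  exact HasWeakDerivOn.sub_eq_integral (isClosed_starEdge ℓ e) (interior_starEdge_nonempty hℓ e)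
    (u.continuousOn_star hℓ e) (u.memLp_weakDeriv_star hℓ e).locallyIntegrableOn_of_two
    ‹HasWeakDerivOn _ _ _› hx hy

theorem toFun_zero (u : (threeHalflinesWithPendant ℓ).H1) (e : Option (Fin 3)) : u.toFun e 0 =
    u.toFun none 0 := by
  obtain ⟨value, hv⟩ := u.continuous.2
  exact (hv e).1.trans (hv none).1.symm

/-- The retraction of the real line onto an edge. -/
noncomputable def starProj (ℓ : ℝ) (e : Option (Fin 3)) (x : ℝ) : ℝ :=
  max 0 (e.elim (min x ℓ) fun _ => x)

theorem starProj_of_mem {e : Option (Fin 3)} {x : ℝ} (hx : x ∈ starEdge ℓ e) :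
    starProj ℓ e x = x := by
  cases e with
  | none =>
    have h1 : 0 ≤ x := hx.1
    have h2 : x ≤ ℓ := hx.2
    simp [starProj, h1, h2]
  | some i =>
    have h1 : 0 ≤ x := hx
    simp [starProj, h1]

theorem starProj_mem (hℓ : 0 ≤ ℓ) (e : Option (Fin 3)) (x : ℝ) : starProj ℓ e x ∈ starEdge ℓ e := by
  cases e with
  | none => exact ⟨le_max_left _ _, max_le hℓ (min_le_right _ _)⟩
  | some i => exact mem_Ici.2 (le_max_left _ _)

theorem continuous_starProj (e : Option (Fin 3)) : Continuous (starProj ℓ e) := by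
  cases e with
  | none => exact continuous_const.max (continuous_id.min continuous_const)
  | some i => exact continuous_const.max continuous_id

/-- The modulus of a function on the star graph, each edge being extended to the line. -/
noncomputable def modulus (u : (threeHalflinesWithPendant ℓ).H1) (e : Option (Fin 3)) (x : ℝ) : ℝ :=
  ‖u.toFun e (starProj ℓ e x)‖

noncomputable def modulusDeriv (u : (threeHalflinesWithPendant ℓ).H1) (e : Option (Fin 3)) (x : ℝ) :
    ℝ :=
  ‖u.weakDeriv e x‖

theorem modulus_of_mem (u : (threeHalflinesWithPendant ℓ).H1) {e : Option (Fin 3)} {x : ℝ}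
    (hx : x ∈ starEdge ℓ e) :
    u.modulus e x = ‖u.toFun e x‖ := by
  rw [modulus, starProj_of_mem hx]

theorem abs_modulus_sub_le (hℓ : 0 < ℓ) (u : (threeHalflinesWithPendant ℓ).H1) (e : Option (Fin 3))
    {x y : ℝ}
    (hx : x ∈ starEdge ℓ e) (hy : y ∈ starEdge ℓ e) (hxy : x ≤ y) :
    |u.modulus e y - u.modulus e x| ≤ ∫ z in Ioc x y, u.modulusDeriv e z := by
  rw [modulus_of_mem u hx, modulus_of_mem u hy]
  refine (abs_norm_sub_norm_le _ _).trans ?_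
  rw [u.sub_eq_integral_star hℓ e hx hy, intervalIntegral.integral_of_le hxy]
  exact norm_integral_le_integral_norm _

theorem memLp_modulus (hℓ : 0 < ℓ) (u : (threeHalflinesWithPendant ℓ).H1) (e : Option (Fin 3)) :
    MemLp (u.modulus e) 2 (volume.restrict (starEdge ℓ e)) :=
  (u.memLp_star hℓ e).norm.ae_eq ((ae_restrict_iff' (isClosed_starEdge ℓ e).measurableSet).2
    (ae_of_all _ fun _ hx => (u.modulus_of_mem hx).symm))

/-- On an interval of length one the modulus changes by at most the L² norm of the derivative. A
larger value would keep it above √m + 1 on such an interval, whose mass would then exceed m. -/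
theorem modulus_halfline_le (hℓ : 0 < ℓ) (u : (threeHalflinesWithPendant ℓ).H1) (i : Fin 3) {x : ℝ}
    (hx : 0 ≤ x) :
    u.modulus (some i) x ≤ √(∫ z in Ici 0, u.modulusDeriv (some i) z ^ 2) +
      (√(∫ z in Ici 0, u.modulus (some i) z ^ 2) + 1) := by
  by_contra! hlt
  set k := ∫ z in Ici 0, u.modulusDeriv (some i) z ^ 2
  set m := ∫ z in Ici 0, u.modulus (some i) z ^ 2
  have hsub : Ioc x (x + 1) ⊆ Ici 0 := fun z hz => hx.trans hz.1.le
  have hL : MemLp (u.modulus (some i)) 2 (volume.restrict (Ici 0)) := u.memLp_modulus hℓ (some i)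
  have hL' : MemLp (u.modulusDeriv (some i)) 2 (volume.restrict (Ici 0)) :=
    (u.memLp_weakDeriv_star hℓ (some i)).norm
  have hbd : ∀ y ∈ Ioc x (x + 1), √m + 1 ≤ u.modulus (some i) y := fun y hy => by
    have h1 := u.abs_modulus_sub_le hℓ (some i) (x := x) (y := y) hx (hx.trans hy.1.le) hy.1.le
    have h2 : ∫ z in Ioc x y, u.modulusDeriv (some i) z ≤ √k := by
      have hs : Ioc x y ⊆ Ici 0 := fun z hz => hx.trans hz.1.le
      have h3 := sq_integral_le_measure_mul_integral_sq
        (hL'.mono_measure (Measure.restrict_mono hs le_rfl))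
      rw [measureReal_restrict_apply_univ, Real.volume_real_Ioc_of_le hy.1.le] at h3
      refine Real.le_sqrt_of_sq_le (h3.trans ?_)
      have h4 : ∫ z in Ioc x y, u.modulusDeriv (some i) z ^ 2 ≤ k :=
        setIntegral_mono_set hL'.integrable_sq (ae_of_all _ fun _ => sq_nonneg _)
          (Eventually.of_forall hs)
      have h5 : 0 ≤ ∫ z in Ioc x y, u.modulusDeriv (some i) z ^ 2 :=
        integral_nonneg fun _ => sq_nonneg _
      have h6 : y - x ≤ 1 := by linarith [hy.2]
      exact (mul_le_of_le_one_left h5 h6).trans h4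
    have := (abs_le.1 h1).1
    linarith
  have h1 : ∫ _ in Ioc x (x + 1), (√m + 1) ^ 2 ≤ ∫ z in Ioc x (x + 1), u.modulus (some i) z ^ 2 :=
    setIntegral_mono_on (integrableOn_const (by simp))
      (IntegrableOn.mono_set (t := Ici 0) hL.integrable_sq hsub)
      measurableSet_Ioc fun y hy => pow_le_pow_left₀ (by positivity) (hbd y hy) 2
  have h2 : ∫ z in Ioc x (x + 1), u.modulus (some i) z ^ 2 ≤ m :=
    setIntegral_mono_set hL.integrable_sq (ae_of_all _ fun _ => sq_nonneg _)
      (Eventually.of_forall hsub)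
  have hm : √m ^ 2 = m := Real.sq_sqrt (integral_nonneg fun _ => sq_nonneg _)
  have : 0 ≤ √m := Real.sqrt_nonneg m
  rw [setIntegral_const, Real.volume_real_Ioc_of_le (by linarith)] at h1
  simp only [add_sub_cancel_left, smul_eq_mul, one_mul] at h1
  nlinarith

theorem isStarFunction (hℓ : 0 < ℓ) (u : (threeHalflinesWithPendant ℓ).H1) :
    IsStarFunction ℓ u.modulus u.modulusDeriv where
  continuous e := ((u.continuousOn_star hℓ e).comp_continuous (continuous_starProj e)
    (starProj_mem hℓ.le e)).norm
  nonneg _ _ := norm_nonneg _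
  nonneg_deriv _ _ := norm_nonneg _
  vertex e := by
    rw [u.modulus_of_mem (zero_mem_starEdge hℓ.le e),
      u.modulus_of_mem (zero_mem_starEdge hℓ.le none), u.toFun_zero]
  bdd := by
    obtain ⟨C, hC⟩ := (isCompact_Icc (a := (0 : ℝ)) (b := ℓ)).exists_bound_of_continuousOn
      (u.continuousOn_star hℓ none)
    set N : Fin 3 → ℝ := fun i => √(∫ z in Ici 0, u.modulusDeriv (some i) z ^ 2) +
      (√(∫ z in Ici 0, u.modulus (some i) z ^ 2) + 1) with hN
    have hN0 : ∀ i, 0 ≤ N i := fun i => by positivity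
    have hNle : ∀ i, N i ≤ ∑ i, N i := fun i =>
      Finset.single_le_sum (fun j _ => hN0 j) (Finset.mem_univ i)
    have hS : 0 ≤ ∑ i, N i := Finset.sum_nonneg fun i _ => hN0 i
    refine ⟨|C| + ∑ i, N i, by positivity, fun e x => ?_⟩
    cases e with
    | none =>
      have := (hC _ (starProj_mem hℓ.le none x)).trans (le_abs_self C)
      exact this.trans (le_add_of_nonneg_right hS)
    | some i =>
      have h1 : (0 : ℝ) ≤ starProj ℓ (some i) x := starProj_mem hℓ.le (some i) x
      have h2 := u.modulus_halfline_le hℓ i h1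
      rw [u.modulus_of_mem (show starProj ℓ (some i) x ∈ starEdge ℓ (some i) from h1)] at h2
      exact h2.trans ((hNle i).trans (le_add_of_nonneg_left (abs_nonneg C)))
  memLp := u.memLp_modulus hℓ
  memLp_deriv e := (u.memLp_weakDeriv_star hℓ e).norm
  abs_sub_le e _ _ hx hy hxy := u.abs_modulus_sub_le hℓ e hx hy hxy

theorem mass_eq (hℓ : 0 ≤ ℓ) (u : (threeHalflinesWithPendant ℓ).H1) :
    mass u = ∑ e, ∫ x in starEdge ℓ e, ‖u.toFun e x‖ ^ 2 := integral_star hℓ _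

theorem energy_eq (hℓ : 0 ≤ ℓ) (p : ℝ) (u : (threeHalflinesWithPendant ℓ).H1) :
    energy p u = 1 / 2 * (∑ e, ∫ x in starEdge ℓ e, ‖u.weakDeriv e x‖ ^ 2) -
      1 / p * ∑ e, ∫ x in starEdge ℓ e, ‖u.toFun e x‖ ^ p := by
  exact congrArg₂ (fun s t => 1 / 2 * s - 1 / p * t) (integral_star hℓ _) (integral_star hℓ _)

theorem integral_modulus_rpow (u : (threeHalflinesWithPendant ℓ).H1) (q : ℝ) (e : Option (Fin 3)) :
    ∫ x in starEdge ℓ e, u.modulus e x ^ q = ∫ x in starEdge ℓ e, ‖u.toFun e x‖ ^ q :=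
  setIntegral_congr_fun (isClosed_starEdge ℓ e).measurableSet fun x hx => by
    simp only [u.modulus_of_mem hx]

theorem integrableOn_modulus_rpow (hℓ : 0 < ℓ) (u : (threeHalflinesWithPendant ℓ).H1) {p : ℝ}
    (hp : 2 ≤ p)
    (e : Option (Fin 3)) : IntegrableOn (fun x => u.modulus e x ^ p) (starEdge ℓ e) := by
  have H := u.isStarFunction hℓ
  obtain ⟨M, hM0, hM⟩ := H.bdd
  refine Integrable.mono' ((H.memLp e).integrable_sq.const_mul (M ^ (p - 2)))
    ((H.measurable e).pow_const p).aestronglyMeasurable (ae_of_all _ fun x => ?_)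
  have h0 := H.nonneg e x
  rw [Real.norm_of_nonneg (Real.rpow_nonneg h0 p)]
  rcases h0.eq_or_lt with h0 | h0
  · rw [← h0, Real.zero_rpow (by linarith)]; simp
  · have : u.modulus e x ^ p = u.modulus e x ^ (p - 2) * u.modulus e x ^ 2 := by
      rw [← Real.rpow_natCast _ 2, ← Real.rpow_add h0]; norm_num
    rw [this]
    gcongr
    · exact hM e x

/-- The profile obtained by rearranging the modulus of a function on the star graph. -/
noncomputable def profile (u : (threeHalflinesWithPendant ℓ).H1) : ℝ → ℝ :=
  rearrangement (levelMeasure (starEdge ℓ) u.modulus)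

theorem profilePotential_profile (hℓ : 0 < ℓ) (u : (threeHalflinesWithPendant ℓ).H1) {p : ℝ}
    (hp : 2 ≤ p) :
    profilePotential p u.profile = ∑ e, ∫ x in starEdge ℓ e, ‖u.toFun e x‖ ^ p := by
  have H := u.isStarFunction hℓ
  obtain ⟨M, hM0, hM⟩ := H.bdd
  have := integral_rearrangement_rpow H.measurable H.nonneg hM0 hM (q := p) (by linarith)
    fun e => u.integrableOn_modulus_rpow hℓ hp e
  rw [profilePotential, profile, this]
  exact Finset.sum_congr rfl fun e _ => u.integral_modulus_rpow p e

theorem profileMass_profile (hℓ : 0 < ℓ) (u : (threeHalflinesWithPendant ℓ).H1) :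
    profileMass u.profile = mass u := by
  have := u.profilePotential_profile hℓ (p := 2) le_rfl
  simp only [profilePotential, Real.rpow_two] at this
  rw [profileMass, this, mass_eq hℓ.le]

theorem profileEnergy_profile_le (hℓ : 0 < ℓ) (u : (threeHalflinesWithPendant ℓ).H1) {p : ℝ}
    (hp : 2 ≤ p) {a b L : ℝ}
    {g : ℝ → ℝ} (hg : weightedKinetic a b L g ≤ ∑ e, ∫ x in starEdge ℓ e, u.modulusDeriv e x ^ 2) :
    profileEnergy p a b L u.profile g ≤ energy p u := by
  rw [profileEnergy, u.profilePotential_profile hℓ hp, energy_eq hℓ.le]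
  simp only [modulusDeriv] at hg
  linarith

theorem profileEnergy_profile_lt (hℓ : 0 < ℓ) (u : (threeHalflinesWithPendant ℓ).H1) {p : ℝ}
    (hp : 2 ≤ p) {a b L : ℝ}
    {g : ℝ → ℝ} (hg : weightedKinetic a b L g < ∑ e, ∫ x in starEdge ℓ e, u.modulusDeriv e x ^ 2) :
    profileEnergy p a b L u.profile g < energy p u := by
  rw [profileEnergy, u.profilePotential_profile hℓ hp, energy_eq hℓ.le]
  simp only [modulusDeriv] at hg
  linarith

theorem _root_.continuousOn_of_eq_integral {f g : ℝ → ℂ} {I : Set ℝ} [hI : I.OrdConnected]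
    (h0 : 0 ∈ I) (hI0 : ∀ x ∈ I, 0 ≤ x) (hg : LocallyIntegrableOn g I)
    (hf : ∀ x ∈ I, f x = f 0 + ∫ s in (0)..x, g s) : ContinuousOn f I := by
  have key : ∀ y ∈ I, ContinuousOn f (Icc 0 y) := fun y hy => by
    have hy0 := hI0 y hy
    have hsub : Icc 0 y ⊆ I := hI.out h0 hy
    have h1 := intervalIntegral.continuousOn_primitive_interval (μ := volume) (f := g)
      (a := 0) (b := y) (by
        rw [uIcc_of_le hy0]; exact hg.integrableOn_compact_subset hsub isCompact_Icc)
    rw [uIcc_of_le hy0] at h1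
    exact (continuousOn_const.add h1).congr fun x hx => hf x (hsub hx)
  intro x hx
  by_cases hmax : ∃ y ∈ I, x < y
  · obtain ⟨y, hy, hxy⟩ := hmax
    refine (key y hy x ⟨hI0 x hx, hxy.le⟩).mono_of_mem_nhdsWithin ?_
    filter_upwards [mem_nhdsWithin_of_mem_nhds (Iio_mem_nhds hxy), self_mem_nhdsWithin] with z h1 h2
    exact ⟨hI0 z h2, le_of_lt h1⟩
  · push Not at hmax
    exact (key x hx x ⟨hI0 x hx, le_rfl⟩).mono fun z hz => ⟨hI0 z hz, hmax z hz⟩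

/-- Functions on the star graph are constructed by means of their derivatives. -/
noncomputable def ofIntegral (hℓ : 0 < ℓ) (f g : Option (Fin 3) → ℝ → ℂ)
    (hvertex : ∀ e, f e 0 = f none 0)
    (hfg : ∀ e, ∀ x ∈ starEdge ℓ e, f e x = f e 0 + ∫ s in (0)..x, g e s)
    (hf : ∀ e, MemLp (f e) 2 (volume.restrict (starEdge ℓ e)))
    (hg : ∀ e, MemLp (g e) 2 (volume.restrict (starEdge ℓ e))) :
        (threeHalflinesWithPendant ℓ).H1 where
  toFun := f
  weakDeriv := g
  continuous := by
    have key (e : Option (Fin 3)) :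
        ContinuousOn (f e) ((threeHalflinesWithPendant ℓ).interval e) := by
      rw [interval_star hℓ.le e]
      have := ordConnected_starEdge ℓ e
      exact continuousOn_of_eq_integral (zero_mem_starEdge hℓ.le e)
        (fun x hx => nonneg_of_mem_starEdge hx) (hg e).locallyIntegrableOn_of_two (hfg e)
    refine ⟨key, fun v => v.elim (f none 0) fun _ => f none ℓ, fun e => ⟨hvertex e, fun he => ?_⟩⟩
    cases e with
    | none => simp [threeHalflinesWithPendant, hℓ.le]
    | some i => exact absurd ⟨i, rfl⟩ he
  memLp := by
    have key (e : Option (Fin 3)) :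
        MemLp (f e) 2 (volume.restrict ((threeHalflinesWithPendant ℓ).interval e)) := by
      rw [interval_star hℓ.le e]; exact hf e
    exact key
  memLp_weakDeriv := by
    have key (e : Option (Fin 3)) :
        MemLp (g e) 2 (volume.restrict ((threeHalflinesWithPendant ℓ).interval e)) := by
      rw [interval_star hℓ.le e]; exact hg e
    exact key
  hasWeakDerivOn := by
    have key (e : Option (Fin 3)) :
        HasWeakDerivOn (f e) (g e) ((threeHalflinesWithPendant ℓ).interval e) := by
      rw [interval_star hℓ.le e]
      have := ordConnected_starEdge ℓ e
      exact hasWeakDerivOn_of_eq_integral (isClosed_starEdge ℓ e).measurableSet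
        (hg e).locallyIntegrableOn_of_two (zero_mem_starEdge hℓ.le e) (hfg e)
    exact key

end H1

end MetricGraph

/-! ### Scaling and normalisation of the mass -/

namespace MetricGraph.H1

variable {G : MetricGraph}

noncomputable def kinetic (u : G.H1) : ℝ := G.integral fun e x => ‖u.weakDeriv e x‖ ^ 2

noncomputable def potential (p : ℝ) (u : G.H1) : ℝ := G.integral fun e x => ‖u.toFun e x‖ ^ p

theorem energy_eq_sub (p : ℝ) (u : G.H1) :
    energy p u = 1 / 2 * u.kinetic - 1 / p * u.potential p := rfl

theorem kinetic_nonneg (u : G.H1) : 0 ≤ u.kinetic :=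
  Finset.sum_nonneg fun _ _ => integral_nonneg fun _ => by positivity

theorem potential_nonneg (p : ℝ) (u : G.H1) : 0 ≤ u.potential p :=
  Finset.sum_nonneg fun _ _ => integral_nonneg fun _ => by positivity

theorem _root_.MetricGraph.integral_const_mul (c : ℝ) (f : G.Edge → ℝ → ℝ) :
    G.integral (fun e x => c * f e x) = c * G.integral f := by
  simp only [integral, MeasureTheory.integral_const_mul, Finset.mul_sum]

/-- The multiplication of a function by a real number. -/
noncomputable def scale (c : ℝ) (u : G.H1) : G.H1 where
  toFun e x := (c : ℂ) * u.toFun e x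
  weakDeriv e x := (c : ℂ) * u.weakDeriv e x
  continuous := by
    obtain ⟨h1, value, hv⟩ := u.continuous
    exact ⟨fun e => continuousOn_const.mul (h1 e), fun v => c * value v, fun e =>
      ⟨congrArg _ (hv e).1, fun he => congrArg _ ((hv e).2 he)⟩⟩
  memLp e := (u.memLp e).const_mul _
  memLp_weakDeriv e := (u.memLp_weakDeriv e).const_mul _
  hasWeakDerivOn e φ h1 h2 h3 := by
    have := u.hasWeakDerivOn e φ h1 h2 h3
    simp only [← mul_smul_comm, MeasureTheory.integral_const_mul, this, mul_neg]

theorem mass_scale (c : ℝ) (u : G.H1) : mass (u.scale c) = c ^ 2 * mass u := by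
  rw [mass, mass, ← integral_const_mul]
  simp [scale, mul_pow]

theorem kinetic_scale (c : ℝ) (u : G.H1) : (u.scale c).kinetic = c ^ 2 * u.kinetic := by
  rw [kinetic, kinetic, ← integral_const_mul]
  simp [scale, mul_pow]

theorem potential_scale (p : ℝ) {c : ℝ} (hc : 0 ≤ c) (u : G.H1) :
    (u.scale c).potential p = c ^ p * u.potential p := by
  rw [potential, potential, ← integral_const_mul]
  simp [scale, abs_of_nonneg hc, Real.mul_rpow hc (norm_nonneg _)]

/-- A small excess of mass can be removed at the expense of a small amount of energy. -/
theorem exists_mass_eq {p μ δ P : ℝ} (hp : 2 < p) (hμ : 0 < μ) (v : G.H1) (h1 : μ ≤ mass v)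
    (h2 : mass v ≤ μ + δ) (hP : 0 ≤ P) (hPv : P ≤ v.potential p) :
    ∃ v' : G.H1, mass v' = μ ∧
      energy p v' ≤ 1 / 2 * v.kinetic - 1 / p * P + P * δ / (2 * μ) := by
  have hm : 0 < mass v := hμ.trans_le h1
  set θ := μ / mass v with hθ
  have hθ0 : 0 < θ := by positivity
  have hθ1 : θ ≤ 1 := (div_le_one hm).2 h1
  have hc2 : √θ ^ 2 = θ := Real.sq_sqrt hθ0.le
  have hcp : √θ ^ p = θ ^ (p / 2) := by
    rw [Real.sqrt_eq_rpow, ← Real.rpow_mul hθ0.le]; congr 1; ring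
  -- Bernoulli's inequality: the potential term loses only a fraction of order 1 - θ. The error is
  -- expressed by the lower bound `P`, which can be kept fixed when v varies.
  have hB : 1 + p / 2 * (θ - 1) ≤ θ ^ (p / 2) := by
    have := one_add_mul_self_le_rpow_one_add (s := θ - 1) (by linarith) (p := p / 2) (by linarith)
    rwa [add_sub_cancel] at this
  have hδ : 1 - θ ≤ δ / μ := by
    rw [hθ, one_sub_div hm.ne']
    exact div_le_div₀ (by linarith) (by linarith) hμ h1
  refine ⟨v.scale √θ, by rw [mass_scale, hc2, hθ, div_mul_cancel₀ _ hm.ne'], ?_⟩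
  rw [energy_eq_sub, kinetic_scale, potential_scale p (Real.sqrt_nonneg _), hc2, hcp]
  have e1 : θ * v.kinetic ≤ v.kinetic := mul_le_of_le_one_left v.kinetic_nonneg hθ1
  have e2 : θ ^ (p / 2) * P ≤ θ ^ (p / 2) * v.potential p := by gcongr
  have e3 : (1 - p / 2 * (δ / μ)) * P ≤ θ ^ (p / 2) * P := by
    refine mul_le_mul_of_nonneg_right (le_trans ?_ hB) hP
    have := mul_le_mul_of_nonneg_left hδ (show 0 ≤ p / 2 by linarith)
    linarith
  have e4 : 1 / p * ((1 - p / 2 * (δ / μ)) * P) = 1 / p * P - P * δ / (2 * μ) := by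
    field_simp
  have e5 := mul_le_mul_of_nonneg_left (e3.trans e2) (show 0 ≤ 1 / p by positivity)
  linarith

end MetricGraph.H1

/-! ### Competitors on the star graph built from profiles -/

/-- The even extension of a function on the positive half line. -/
noncomputable def evenExtension (w : ℝ → ℝ) (x : ℝ) : ℝ := w |x|

noncomputable def oddExtension (g : ℝ → ℝ) (x : ℝ) : ℝ := if x < 0 then -g |x| else g |x|

theorem oddExtension_sq (g : ℝ → ℝ) (x : ℝ) : oddExtension g x ^ 2 = g |x| ^ 2 := by
  unfold oddExtension
  split_ifs <;> simp

theorem integrable_comp_abs_of_integrableOn {f : ℝ → ℝ} (hf : IntegrableOn f (Ioi 0)) :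
    Integrable fun x => f |x| := by
  have h1 : IntegrableOn (fun x => f |x|) (Ioi 0) :=
    hf.congr_fun (fun x hx => by rw [abs_of_pos hx]) measurableSet_Ioi
  have h2 : IntegrableOn (fun x => f |x|) (Iic 0) := by
    rw [integrableOn_Iic_iff_integrableOn_Iio]
    have := h1.comp_neg
    simp only [abs_neg] at this
    simpa using this
  rw [← integrableOn_univ, ← Iic_union_Ioi (a := (0 : ℝ))]
  exact h2.union h1

theorem integral_Ioi_comp_abs {f : ℝ → ℝ} (hf : IntegrableOn f (Ioi 0)) {c : ℝ} (hc : 0 ≤ c) :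
    ∫ x in Ioi (-c), f |x| = 2 * (∫ x in Ioi 0, f x) - ∫ x in Ioi c, f x := by
  have h1 := integrable_comp_abs_of_integrableOn hf
  have h2 := intervalIntegral.integral_Iic_add_Ioi (b := -c) h1.integrableOn h1.integrableOn
  rw [integral_comp_abs] at h2
  have h3 := integral_comp_neg_Iic (-c) fun x => f |x|
  simp only [abs_neg, neg_neg] at h3
  have h4 : ∫ x in Ioi c, f |x| = ∫ x in Ioi c, f x :=
    setIntegral_congr_fun measurableSet_Ioi fun x hx => by
      simp only [abs_of_pos (hc.trans_lt hx)]
  linarith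

theorem memLp_comp_affine {f : ℝ → ℝ} (hf : MemLp f 2) (a : ℝ) {r : ℝ} (hr : r ≠ 0) :
    MemLp (fun x => f (a + r * x)) 2 := by
  have hm : AEStronglyMeasurable (fun x => f (a + r * x)) := by
    have h1 : AEStronglyMeasurable (fun x => f (a + x)) :=
      hf.aestronglyMeasurable.comp_measurePreserving (measurePreserving_add_left volume a)
    refine h1.comp_quasiMeasurePreserving (f := fun x => r * x) ⟨by fun_prop, ?_⟩
    rw [Real.map_volume_mul_left hr]
    exact Measure.smul_absolutelyContinuous
  rw [memLp_two_iff_integrable_sq hm]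
  exact ((hf.integrable_sq.comp_add_left a).comp_mul_left' hr)

namespace IsProfile

variable {w g : ℝ → ℝ}

theorem memLp_evenExtension (h : IsProfile w g) : MemLp (evenExtension w) 2 := by
  have hm : AEStronglyMeasurable (evenExtension w) := by
    refine Continuous.aestronglyMeasurable ?_
    exact h.continuousOn.comp_continuous continuous_abs fun x => abs_nonneg x
  rw [memLp_two_iff_integrable_sq hm]
  exact integrable_comp_abs_of_integrableOn h.integrable_sq

theorem memLp_oddExtension (h : IsProfile w g) : MemLp (oddExtension g) 2 := by
  have h1 : AEStronglyMeasurable (oddExtension g) (volume.restrict (Ioi 0)) :=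
    h.memLp_deriv.aestronglyMeasurable.congr ((ae_restrict_iff' measurableSet_Ioi).2
      (ae_of_all _ fun x (hx : 0 < x) => by simp [oddExtension, hx.not_gt, abs_of_pos hx]))
  have h2 : AEStronglyMeasurable (oddExtension g) (volume.restrict (Iio 0)) := by
    have hmp : MeasurePreserving (fun x : ℝ => -x) (volume.restrict (Iio 0))
        (volume.restrict (Ioi 0)) := by
      have := (Measure.measurePreserving_neg (volume : Measure ℝ)).restrict_preimage
        (measurableSet_Ioi (a := 0))
      simpa using this
    refine (h.memLp_deriv.aestronglyMeasurable.comp_measurePreserving hmp).neg.congr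
      ((ae_restrict_iff' measurableSet_Iio).2 (ae_of_all _ fun x (hx : x < 0) => ?_))
    simp [oddExtension, hx, abs_of_neg hx]
  have hm : AEStronglyMeasurable (oddExtension g) := by
    have h3 : AEStronglyMeasurable (oddExtension g) (volume.restrict (Iic 0)) := by
      rwa [← restrict_Iio_eq_restrict_Iic]
    have := aestronglyMeasurable_union_iff.2 ⟨h3, h1⟩
    rwa [Iic_union_Ioi, Measure.restrict_univ] at this
  rw [memLp_two_iff_integrable_sq hm]
  simp only [oddExtension_sq]
  exact integrable_comp_abs_of_integrableOn h.integrable_deriv_sq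

theorem evenExtension_eq (h : IsProfile w g) (x : ℝ) :
    evenExtension w x = w 0 + ∫ s in (0)..x, oddExtension g s := by
  rcases le_or_gt 0 x with hx | hx
  · rw [evenExtension, abs_of_nonneg hx, h.eq_integral x hx]
    congr 1
    refine intervalIntegral.integral_congr fun s hs => ?_
    rw [uIcc_of_le hx] at hs
    simp [oddExtension, hs.1.not_gt, abs_of_nonneg hs.1]
  · rw [evenExtension, abs_of_neg hx, h.eq_integral (-x) (by linarith),
      intervalIntegral.integral_symm x 0]
    congr 1
    have := intervalIntegral.integral_comp_neg (a := x) (b := 0) g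
    rw [neg_zero] at this
    rw [← this, ← intervalIntegral.integral_neg]
    refine intervalIntegral.integral_congr_ae ?_
    filter_upwards [compl_mem_ae_iff.2 (measure_singleton (0 : ℝ))] with s hs0 hs
    rw [uIoc_of_le hx.le] at hs
    have hs' : s < 0 := hs.2.lt_of_ne hs0
    simp [oddExtension, hs', abs_of_neg hs']

theorem evenExtension_affine (h : IsProfile w g) (a : ℝ) {r : ℝ} (hr : r ≠ 0) (x : ℝ) :
    evenExtension w (a + r * x) =
      evenExtension w a + ∫ s in (0)..x, r * oddExtension g (a + r * s) := by
  have hi : ∀ s t, IntervalIntegrable (oddExtension g) volume s t := fun s t =>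
    ((h.memLp_oddExtension.locallyIntegrable (by norm_num)).integrableOn_isCompact
      isCompact_uIcc).intervalIntegrable
  rw [intervalIntegral.integral_const_mul, intervalIntegral.integral_comp_add_mul _ hr]
  rw [h.evenExtension_eq, h.evenExtension_eq, smul_eq_mul, ← mul_assoc, mul_inv_cancel₀ hr, one_mul,
    mul_zero, add_zero, add_assoc, intervalIntegral.integral_add_adjacent_intervals (hi _ _)
        (hi _ _)]

end IsProfile

namespace MetricGraph.H1

variable {ℓ : ℝ} {w g : ℝ → ℝ}

/-- The function on the star graph that is given on each edge by the even extension of a profile,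
composed with an affine map. -/
noncomputable def ofProfile (hℓ : 0 < ℓ) (h : IsProfile w g) (a r : Option (Fin 3) → ℝ)
    (hr : ∀ e, r e ≠ 0) (ha : ∀ e, evenExtension w (a e) = evenExtension w (a none)) :
    (threeHalflinesWithPendant ℓ).H1 :=
  ofIntegral hℓ (fun e x => (evenExtension w (a e + r e * x) : ℂ))
    (fun e x => ((r e * oddExtension g (a e + r e * x) : ℝ) : ℂ))
    (fun e => by simp only [mul_zero, add_zero, ha e])
    (fun e x _ => by
      rw [intervalIntegral.integral_ofReal, h.evenExtension_affine (a e) (hr e)]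
      simp)
    (fun e => (memLp_comp_affine h.memLp_evenExtension (a e) (hr e)).ofReal.restrict _)
    (fun e => ((memLp_comp_affine h.memLp_oddExtension (a e) (hr e)).const_mul
        (r e)).ofReal.restrict _)

variable {hℓ : 0 < ℓ} {h : IsProfile w g} {a r : Option (Fin 3) → ℝ} {hr : ∀ e, r e ≠ 0}
  {ha : ∀ e, evenExtension w (a e) = evenExtension w (a none)}

theorem mass_ofProfile : mass (ofProfile hℓ h a r hr ha) =
    ∑ e, ∫ x in starEdge ℓ e, w |a e + r e * x| ^ 2 := by
  rw [mass_eq hℓ.le]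
  simp [ofProfile, ofIntegral, evenExtension]

theorem kinetic_ofProfile : (ofProfile hℓ h a r hr ha).kinetic =
    ∑ e, r e ^ 2 * ∫ x in starEdge ℓ e, g |a e + r e * x| ^ 2 := by
  refine (integral_star hℓ.le _).trans ?_
  simp only [← MeasureTheory.integral_const_mul]
  simp [ofProfile, ofIntegral, mul_pow, oddExtension_sq]

theorem potential_ofProfile (p : ℝ) : (ofProfile hℓ h a r hr ha).potential p =
    ∑ e, ∫ x in starEdge ℓ e, w |a e + r e * x| ^ p := by
  refine (integral_star hℓ.le _).trans ?_
  simp [ofProfile, ofIntegral, evenExtension, abs_of_nonneg (h.nonneg _ (abs_nonneg _))]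

end MetricGraph.H1

theorem integral_Ici_affine (f : ℝ → ℝ) (a : ℝ) {r : ℝ} (hr : 0 < r) :
    ∫ x in Ici 0, f (a + r * x) = r⁻¹ * ∫ x in Ioi a, f x := by
  rw [integral_Ici_eq_integral_Ioi, integral_comp_mul_left_Ioi (fun x => f (a + x)) 0 hr, mul_zero,
    IsProfile.integral_Ioi_comp_add, smul_eq_mul]

theorem integral_Icc_affine (f : ℝ → ℝ) (a : ℝ) {r ℓ : ℝ} (hr : 0 < r) (hℓ : 0 ≤ ℓ) :
    ∫ x in Icc 0 ℓ, f (a + r * x) = r⁻¹ * ∫ x in Ioc a (a + r * ℓ), f x := by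
  rw [integral_Icc_eq_integral_Ioc, ← intervalIntegral.integral_of_le hℓ,
    intervalIntegral.integral_comp_add_mul _ hr.ne', mul_zero, add_zero,
    intervalIntegral.integral_of_le (by nlinarith), smul_eq_mul]

/-- The pendant carries the part of a profile next to its maximum, and the halflines share the
rest. -/
theorem exists_H1_pendant {ℓ : ℝ} (hℓ : 0 < ℓ) {w g : ℝ → ℝ} (h : IsProfile w g) {p : ℝ}
    (hp : 2 < p) : ∃ u : (MetricGraph.threeHalflinesWithPendant ℓ).H1,
      MetricGraph.mass u = profileMass w ∧ MetricGraph.energy p u = profileEnergy p 1 9 ℓ w g := by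
  set a : Option (Fin 3) → ℝ := fun _ => ℓ
  -- On the pendant w(ℓ - x), with the maximum at the tip; on each halfline w(ℓ + 3x), whose speed 3
  -- gives weight 9 while each takes a third of the rest. All edges start with the value w(ℓ).
  set r : Option (Fin 3) → ℝ := fun e => e.elim (-1) fun _ => 3 with hrdef
  have hr : ∀ e, r e ≠ 0 := by rintro (_ | i) <;> norm_num [hrdef]
  have hN : ∀ f : ℝ → ℝ, ∫ x in Icc 0 ℓ, f |ℓ + -1 * x| = ∫ x in Ioc 0 ℓ, f x := fun f => by
    have h1 : ∫ x in Icc 0 ℓ, f |ℓ + -1 * x| = ∫ x in Icc 0 ℓ, f (ℓ - x) :=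
      setIntegral_congr_fun measurableSet_Icc fun x hx => by
        have : ℓ + -1 * x = ℓ - x := by ring
        simp only [this, abs_of_nonneg (sub_nonneg.2 hx.2)]
    rw [h1, integral_Icc_eq_integral_Ioc, ← intervalIntegral.integral_of_le hℓ.le,
      intervalIntegral.integral_comp_sub_left, sub_self, sub_zero,
      intervalIntegral.integral_of_le hℓ.le]
  have hS : ∀ f : ℝ → ℝ, ∫ x in Ici 0, f |ℓ + 3 * x| = 3⁻¹ * ∫ x in Ioi ℓ, f x := fun f => by
    rw [integral_Ici_affine (fun y => f |y|) ℓ (by norm_num)]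
    congr 1
    exact setIntegral_congr_fun measurableSet_Ioi fun x hx => by
      simp only [abs_of_pos (hℓ.trans hx)]
  have hadd : ∀ f : ℝ → ℝ, IntegrableOn f (Ioi 0) →
      (∫ x in Ioc 0 ℓ, f x) + ∫ x in Ioi ℓ, f x = ∫ x in Ioi 0, f x := fun f hf => by
    rw [← setIntegral_union (Ioc_disjoint_Ioi le_rfl) measurableSet_Ioi
      (hf.mono_set fun y hy => hy.1) (hf.mono_set fun y hy => hℓ.trans hy),
      Ioc_union_Ioi_eq_Ioi hℓ.le]
  refine ⟨.ofProfile hℓ h a r hr fun _ => rfl, ?_, ?_⟩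
  · rw [MetricGraph.H1.mass_ofProfile, Fintype.sum_option]
    simp only [starEdge, hrdef, Option.elim, a]
    rw [hN fun y => w y ^ 2, hS fun y => w y ^ 2, profileMass, ← hadd _ h.integrable_sq]
    simp
  · rw [MetricGraph.H1.energy_eq_sub, MetricGraph.H1.kinetic_ofProfile,
      MetricGraph.H1.potential_ofProfile, Fintype.sum_option, Fintype.sum_option]
    simp only [starEdge, hrdef, Option.elim, a]
    rw [hN fun y => w y ^ p, hS fun y => w y ^ p, hN fun y => g y ^ 2, hS fun y => g y ^ 2,
      profileEnergy, weightedKinetic, profilePotential, ← hadd _ (h.integrable_rpow hp)]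
    simp
    ring

/-- A bump w(|2x - R|) centred at R/2 on one halfline, with tails w(R + 2x) on the other edges to
keep continuity. As R grows, the tails cost arbitrarily little. -/
theorem exists_H1_far {ℓ : ℝ} (hℓ : 0 < ℓ) {w g : ℝ → ℝ} (h : IsProfile w g) {p ε : ℝ}
    (hp : 2 < p) (hε : 0 < ε) : ∃ u : (MetricGraph.threeHalflinesWithPendant ℓ).H1,
      profileMass w ≤ MetricGraph.mass u ∧ MetricGraph.mass u ≤ profileMass w + ε ∧
      u.kinetic ≤ weightedKinetic 4 4 0 g + ε ∧ profilePotential p w ≤ u.potential p := by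
  have htail : ∀ f : ℝ → ℝ, IntegrableOn f (Ioi 0) →
      Tendsto (fun R => ∫ x in Ioi R, f x) atTop (𝓝 0) := fun f hf => by
    have h1 := intervalIntegral_tendsto_integral_Ioi 0 hf tendsto_id
    have h2 : Tendsto (fun R => (∫ x in Ioi 0, f x) - ∫ x in (0 : ℝ)..R, f x) atTop (𝓝 0) := by
      have := h1.const_sub (∫ x in Ioi 0, f x)
      rwa [sub_self] at this
    refine h2.congr' ?_
    filter_upwards [eventually_ge_atTop 0] with R hR
    rw [intervalIntegral.integral_of_le hR, sub_eq_iff_eq_add',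
      ← setIntegral_union (Ioc_disjoint_Ioi le_rfl) measurableSet_Ioi
      (hf.mono_set fun y hy => hy.1) (hf.mono_set fun y hy => hR.trans_lt hy),
      Ioc_union_Ioi_eq_Ioi hR]
  obtain ⟨R, ⟨hR1, hR2⟩, hR0⟩ := (((htail _ h.integrable_sq).eventually (gt_mem_nhds hε)).and
    ((htail _ h.integrable_deriv_sq).eventually
      (gt_mem_nhds (show 0 < ε / 4 by linarith)))).and (eventually_ge_atTop 0) |>.exists
  set a : Option (Fin 3) → ℝ := fun e => if e = some 0 then -R else R with hadef
  -- With T the integral of f over (R, ∞): the halfline with the bump gives the full integral minus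
  -- T/2, the two others T/2 each, and the pendant between 0 and T/2.
  have key : ∀ f : ℝ → ℝ, IntegrableOn f (Ioi 0) → (∀ x, 0 ≤ x → 0 ≤ f x) →
      (∫ x in Ioi 0, f x ≤ ∑ e, ∫ x in starEdge ℓ e, f |a e + 2 * x|) ∧
      ∑ e, ∫ x in starEdge ℓ e, f |a e + 2 * x| ≤ (∫ x in Ioi 0, f x) + ∫ x in Ioi R, f x := by
    intro f hf hf0
    have hT : ∫ x in Ioi R, f |x| = ∫ x in Ioi R, f x :=
      setIntegral_congr_fun measurableSet_Ioi fun x hx => by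
        simp only [abs_of_pos (hR0.trans_lt hx)]
    have hI := integrable_comp_abs_of_integrableOn hf
    have hE : 0 ≤ ∫ x in Ioc R (R + 2 * ℓ), f |x| := integral_nonneg fun x => hf0 _ (abs_nonneg x)
    have hE' : ∫ x in Ioc R (R + 2 * ℓ), f |x| ≤ ∫ x in Ioi R, f |x| :=
      setIntegral_mono_set hI.integrableOn (ae_of_all _ fun x => hf0 _ (abs_nonneg x))
        (Eventually.of_forall fun x hx => hx.1)
    rw [Fintype.sum_option, Fin.sum_univ_three]
    simp only [starEdge, Option.elim, hadef]
    simp only [reduceCtorEq, ↓reduceIte, Option.some.injEq, one_ne_zero, Fin.reduceEq]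
    rw [integral_Icc_affine (fun x => f |x|) R two_pos hℓ.le,
      integral_Ici_affine (fun x => f |x|) R two_pos, integral_Ici_affine (fun x => f |x|)
          (-R) two_pos,
      integral_Ioi_comp_abs hf hR0]
    constructor <;> linarith
  refine ⟨.ofProfile hℓ h a (fun _ => 2) (fun _ => two_ne_zero) (fun e => ?_), ?_, ?_, ?_, ?_⟩
  · simp only [evenExtension, hadef]
    split_ifs <;> simp
  · rw [MetricGraph.H1.mass_ofProfile]
    exact (key (fun y => w y ^ 2) h.integrable_sq fun _ _ => sq_nonneg _).1
  · rw [MetricGraph.H1.mass_ofProfile]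
    refine (key (fun y => w y ^ 2) h.integrable_sq fun _ _ => sq_nonneg _).2.trans ?_
    rw [profileMass]; linarith
  · rw [MetricGraph.H1.kinetic_ofProfile, ← Finset.mul_sum, h.weightedKinetic_eq _ le_rfl]
    have := (key (fun y => g y ^ 2) h.integrable_deriv_sq fun _ _ => sq_nonneg _).2
    linarith
  · rw [MetricGraph.H1.potential_ofProfile]
    exact (key (fun y => w y ^ p) (h.integrable_rpow hp)
      fun x hx => Real.rpow_nonneg (h.nonneg x hx) p).1

/-! ### Stretching a halfline; ground states that vanish at the vertex -/

section Splice

variable {E : Type*}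

/-- The function `f₁`, slowed down by the factor `2` until it reaches `s`, followed by `f₂`. -/
noncomputable def splice (s : ℝ) (f₁ f₂ : ℝ → E) : ℝ → E :=
  (Iic (2 * s)).piecewise (fun x => f₁ (2⁻¹ * x)) fun x => f₂ (x - s)

theorem splice_of_le {s x : ℝ} (f₁ f₂ : ℝ → E) (hx : x ≤ 2 * s) : splice s f₁ f₂ x = f₁ (2⁻¹ * x) :=
  piecewise_eq_of_mem _ _ _ hx

theorem splice_of_lt {s x : ℝ} (f₁ f₂ : ℝ → E) (hx : 2 * s < x) : splice s f₁ f₂ x = f₂ (x - s) :=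
  piecewise_eq_of_notMem _ _ _ hx.not_ge

theorem comp_splice {F : Type*} (φ : E → F) (s : ℝ) (f₁ f₂ : ℝ → E) (x : ℝ) :
    φ (splice s f₁ f₂ x) = splice s (fun x => φ (f₁ x)) (fun x => φ (f₂ x)) x := by
  rcases le_or_gt x (2 * s) with hx | hx
  · rw [splice_of_le _ _ hx, splice_of_le _ _ hx]
  · rw [splice_of_lt _ _ hx, splice_of_lt _ _ hx]

theorem measurePreserving_sub_Ioi (s : ℝ) : MeasurePreserving (fun x : ℝ => x - s)
    (volume.restrict (Ioi (2 * s))) (volume.restrict (Ioi s)) := by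
  have := (measurePreserving_sub_right (volume : Measure ℝ) s).restrict_preimage
    (measurableSet_Ioi (a := s))
  simpa [two_mul] using this

theorem memLp_splice [NormedAddCommGroup E] {s : ℝ} (hs : 0 ≤ s) {f₁ f₂ : ℝ → E}
    (h₁ : MemLp f₁ 2 (volume.restrict (Ici 0))) (h₂ : MemLp f₂ 2 (volume.restrict (Ici 0))) :
    MemLp (splice s f₁ f₂) 2 (volume.restrict (Ici 0)) := by
  rw [← restrict_Ioi_eq_restrict_Ici] at h₁ h₂ ⊢
  refine MemLp.piecewise measurableSet_Iic ?_ ?_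
  · exact (IsProfile.memLp_comp_mul h₁ (by norm_num)).mono_measure Measure.restrict_le_self
  · rw [Measure.restrict_restrict measurableSet_Iic.compl, compl_Iic, Ioi_inter_Ioi,
      max_eq_left (by linarith)]
    exact (h₂.mono_measure (Measure.restrict_mono
        (Ioi_subset_Ioi hs) le_rfl)).comp_measurePreserving
      (measurePreserving_sub_Ioi s)

theorem integral_splice {s : ℝ} (hs : 0 ≤ s) {A B : ℝ → ℝ} (hA : IntegrableOn A (Ici 0))
    (hB : IntegrableOn B (Ici 0)) :
    ∫ x in Ici 0, splice s A B x = 2 * (∫ x in Ioc 0 s, A x) + ∫ x in Ioi s, B x := by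
  have hs2 : 0 ≤ 2 * s := by linarith
  have hA0 : IntegrableOn A (Ioi 0) := hA.mono_set Ioi_subset_Ici_self
  have hBs : IntegrableOn B (Ioi s) := hB.mono_set fun x hx => hs.trans (le_of_lt hx)
  have h1 : IntegrableOn (fun x => A (2⁻¹ * x)) (Ioi 0) :=
    (integrableOn_Ioi_comp_mul_left_iff A 0 (by norm_num)).2 (by rwa [mul_zero])
  have h2 : IntegrableOn (fun x => B (x - s)) (Ioi (2 * s)) :=
    (measurePreserving_sub_Ioi s).integrable_comp_of_integrable hBs
  rw [integral_Ici_eq_integral_Ioi, ← Ioc_union_Ioi_eq_Ioi hs2,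
    setIntegral_union (Ioc_disjoint_Ioi le_rfl) measurableSet_Ioi
      ((h1.mono_set fun x hx => hx.1).congr_fun (fun x hx => (splice_of_le _ _ hx.2).symm)
        measurableSet_Ioc)
      (h2.congr_fun (fun x hx => (splice_of_lt _ _ hx).symm) measurableSet_Ioi),
    setIntegral_congr_fun measurableSet_Ioc fun x hx => splice_of_le A B hx.2,
    setIntegral_congr_fun measurableSet_Ioi fun x hx => splice_of_lt A B hx]
  congr 1
  · rw [IsProfile.integral_Ioc_comp_mul A (by norm_num) hs2, inv_inv,
      inv_mul_cancel_left₀ two_ne_zero]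
  · exact (measurePreserving_sub_Ioi s).integral_comp (measurableEmbedding_subRight s) B

theorem splice_eq_integral {s : ℝ} (hs : 0 ≤ s) {f g : ℝ → ℂ} (hg : LocallyIntegrableOn g (Ici 0))
    (hf : ∀ x y, 0 ≤ x → 0 ≤ y → f y - f x = ∫ t in x..y, g t) {x : ℝ} (hx : 0 ≤ x) :
    splice s f f x = splice s f f 0 + ∫ t in (0)..x, splice s (fun t => 2⁻¹ * g t) g t := by
  have hi : ∀ x y, 0 ≤ x → 0 ≤ y → IntervalIntegrable g volume x y := fun x y hx hy =>
    (hg.integrableOn_compact_subset (fun t ht => (le_min hx hy).trans ht.1)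
      isCompact_uIcc).intervalIntegrable
  have hs2 : 0 ≤ 2 * s := by linarith
  have hleft : ∀ y, 0 ≤ y → y ≤ 2 * s →
      ∫ t in (0)..y, splice s (fun t => 2⁻¹ * g t) g t = f (2⁻¹ * y) - f 0 := fun y hy hys => by
    have : ∫ t in (0)..y, splice s (fun t => 2⁻¹ * g t) g t = ∫ t in (0)..y, 2⁻¹ * g (2⁻¹ * t) :=
      intervalIntegral.integral_congr fun t ht => by
        rw [uIcc_of_le hy] at ht
        exact splice_of_le _ _ (ht.2.trans hys)
    rw [this, intervalIntegral.integral_const_mul,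
      intervalIntegral.integral_comp_mul_left g (by norm_num), hf _ _ le_rfl (by positivity)]
    simp
  rw [splice_of_le f f hs2, mul_zero]
  rcases le_or_gt x (2 * s) with hxs | hxs
  · rw [hleft x hx hxs, splice_of_le f f hxs]
    ring
  · have e1 : ∫ t in (2 * s)..x, splice s (fun t => 2⁻¹ * g t) g t = ∫ t in (2 * s)..x, g (t - s) :=
      intervalIntegral.integral_congr_ae (ae_of_all _ fun t ht => by
        rw [uIoc_of_le hxs.le] at ht
        exact splice_of_lt _ _ ht.1)
    have e2 := intervalIntegral.integral_comp_sub_right (a := 2 * s) (b := x) g s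
    have i1 : IntervalIntegrable (splice s (fun t => 2⁻¹ * g t) g) volume 0 (2 * s) := by
      have := ((hi 0 s le_rfl hs).comp_mul_left (c := 2⁻¹)).const_mul (2⁻¹ : ℂ)
      have h3 : s / 2⁻¹ = 2 * s := by ring
      rw [zero_div, h3] at this
      refine this.congr fun t ht => ?_
      rw [uIoc_of_le hs2] at ht
      exact (splice_of_le (fun t => 2⁻¹ * g t) g ht.2).symm
    have i2 : IntervalIntegrable (splice s (fun t => 2⁻¹ * g t) g) volume (2 * s) x := by
      have := (hi s (x - s) hs (by linarith)).comp_sub_right s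
      rw [sub_add_cancel, ← two_mul] at this
      refine this.congr fun t ht => ?_
      rw [uIoc_of_le hxs.le] at ht
      exact (splice_of_lt _ _ ht.1).symm
    have e3 : 2 * s - s = s := by ring
    rw [← intervalIntegral.integral_add_adjacent_intervals i1 i2, e1, e2, hleft _ hs2 le_rfl,
      splice_of_lt f f hxs, e3, ← hf _ _ hs (by linarith), inv_mul_cancel_left₀ two_ne_zero]
    ring

end Splice

theorem integral_Ioc_add_Ioi {f : ℝ → ℝ} (hf : IntegrableOn f (Ici 0)) {s : ℝ} (hs : 0 ≤ s) :
    (∫ x in Ioc 0 s, f x) + ∫ x in Ioi s, f x = ∫ x in Ici 0, f x := by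
  rw [← setIntegral_union (Ioc_disjoint_Ioi le_rfl) measurableSet_Ioi
    (hf.mono_set fun y hy => hy.1.le) (hf.mono_set fun y hy => hs.trans (le_of_lt hy)),
    Ioc_union_Ioi_eq_Ioi hs, integral_Ici_eq_integral_Ioi]

namespace MetricGraph.H1

variable {ℓ : ℝ}

theorem sum_ite_edge (F : (Option (Fin 3)) → ℝ) (i : Fin 3) (c : ℝ) :
    ∑ e, (if e = some i then F e + c else F e) = (∑ e, F e) + c := by
  have : ∀ e, (if e = some i then F e + c else F e) = F e + if e = some i then c else 0 :=
      fun e => by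
    split_ifs <;> simp
  simp [this, Finset.sum_add_distrib]

/-- Slowing down a function on the first part of a halfline. -/
theorem exists_stretch (hℓ : 0 < ℓ) (u : (threeHalflinesWithPendant ℓ).H1) (i : Fin 3) {s p : ℝ}
    (hs : 0 ≤ s) (hp : 2 ≤ p) : ∃ v : (threeHalflinesWithPendant ℓ).H1,
      mass v = mass u + (∫ x in Ioc 0 s, ‖u.toFun (some i) x‖ ^ 2) ∧
      v.kinetic = u.kinetic - 1 / 2 * ∫ x in Ioc 0 s, ‖u.weakDeriv (some i) x‖ ^ 2 ∧
      u.potential p ≤ v.potential p := by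
  set f := u.toFun (some i)
  set g := u.weakDeriv (some i)
  have hf : MemLp f 2 (volume.restrict (Ici 0)) := u.memLp_star hℓ (some i)
  have hg : MemLp g 2 (volume.restrict (Ici 0)) := u.memLp_weakDeriv_star hℓ (some i)
  have hf2 : IntegrableOn (fun x => ‖f x‖ ^ 2) (Ici 0) :=
    (memLp_two_iff_integrable_sq_norm hf.aestronglyMeasurable).1 hf
  have hg2 : IntegrableOn (fun x => ‖g x‖ ^ 2) (Ici 0) :=
    (memLp_two_iff_integrable_sq_norm hg.aestronglyMeasurable).1 hg
  have hfp : IntegrableOn (fun x => ‖f x‖ ^ p) (Ici 0) :=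
    (u.integrableOn_modulus_rpow hℓ hp (some i)).congr_fun (fun x hx => by
      simp only [u.modulus_of_mem hx]; rfl) measurableSet_Ici
  let F : Option (Fin 3) → ℝ → ℂ := fun e => if e = some i then splice s f f else u.toFun e
  let D : Option (Fin 3) → ℝ → ℂ := fun e =>
    if e = some i then splice s (fun t => 2⁻¹ * g t) g else u.weakDeriv e
  have hF : ∀ e, F e 0 = F none 0 := fun e => by
    by_cases he : e = some i
    · simp only [F, he, ↓reduceIte, reduceCtorEq]
      rw [splice_of_le f f (by linarith), mul_zero]
      exact u.toFun_zero (some i)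
    · simp only [F, he, ↓reduceIte, reduceCtorEq]
      exact u.toFun_zero e
  have hFD : ∀ e, ∀ x ∈ starEdge ℓ e, F e x = F e 0 + ∫ t in (0)..x, D e t := fun e x hx => by
    by_cases he : e = some i
    · subst he
      simp only [F, D, ↓reduceIte]
      exact splice_eq_integral hs hg.locallyIntegrableOn_of_two
        (fun x y hx hy => u.sub_eq_integral_star hℓ (some i) hx hy) hx
    · simp only [F, D, he, ↓reduceIte]
      rw [← u.sub_eq_integral_star hℓ e (zero_mem_starEdge hℓ.le e) hx]
      ring
  have hFL : ∀ e, MemLp (F e) 2 (volume.restrict (starEdge ℓ e)) := fun e => by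
    by_cases he : e = some i
    · subst he
      simp only [F, ↓reduceIte]
      exact memLp_splice hs hf hf
    · simp only [F, he, ↓reduceIte]
      exact u.memLp_star hℓ e
  have hDL : ∀ e, MemLp (D e) 2 (volume.restrict (starEdge ℓ e)) := fun e => by
    by_cases he : e = some i
    · subst he
      simp only [D, ↓reduceIte]
      exact memLp_splice hs (hg.const_mul _) hg
    · simp only [D, he, ↓reduceIte]
      exact u.memLp_weakDeriv_star hℓ e
  have hpow : ∀ q : ℝ, IntegrableOn (fun x => ‖f x‖ ^ q) (Ici 0) →
      ∑ e, ∫ x in starEdge ℓ e, ‖F e x‖ ^ q =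
        (∑ e, ∫ x in starEdge ℓ e, ‖u.toFun e x‖ ^ q) + ∫ x in Ioc 0 s, ‖f x‖ ^ q := fun q hq => by
    rw [← sum_ite_edge _ i]
    refine Finset.sum_congr rfl fun e _ => ?_
    by_cases he : e = some i
    · subst he
      simp only [F, ↓reduceIte]
      change ∫ x in Ici 0, ‖splice s f f x‖ ^ q = (∫ x in Ici 0, ‖f x‖ ^ q) + _
      simp only [comp_splice (fun z : ℂ => ‖z‖ ^ q)]
      rw [integral_splice hs hq hq, ← integral_Ioc_add_Ioi hq hs]
      ring
    · simp only [F, he, ↓reduceIte]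
  refine ⟨ofIntegral hℓ F D hF hFD hFL hDL, ?_, ?_, ?_⟩
  · have := hpow 2 (by simpa only [Real.rpow_two] using hf2)
    simp only [Real.rpow_two] at this
    rw [mass_eq hℓ.le, mass_eq hℓ.le]
    exact this
  · have h1 : u.kinetic = _ := integral_star hℓ.le _
    have h2 : (ofIntegral hℓ F D hF hFD hFL hDL).kinetic = _ := integral_star hℓ.le _
    rw [h1, h2]
    change ∑ e : Option (Fin 3), ∫ x in starEdge ℓ e, ‖D e x‖ ^ 2 =
      (∑ e : Option (Fin 3), ∫ x in starEdge ℓ e, ‖u.weakDeriv e x‖ ^ 2) -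
        1 / 2 * ∫ x in Ioc 0 s, ‖g x‖ ^ 2
    rw [sub_eq_add_neg, ← sum_ite_edge _ i]
    refine Finset.sum_congr rfl fun e _ => ?_
    by_cases he : e = some i
    · subst he
      simp only [D, ↓reduceIte]
      change ∫ x in Ici 0, ‖splice s (fun t => 2⁻¹ * g t) g x‖ ^ 2 = (∫ x in Ici 0, ‖g x‖ ^ 2) + _
      simp only [comp_splice (fun z : ℂ => ‖z‖ ^ 2)]
      -- Halving the derivative on a doubled length leaves half the kinetic energy of the stretched
      -- part.
      have h4 : ∀ x, ‖2⁻¹ * g x‖ ^ 2 = 4⁻¹ * ‖g x‖ ^ 2 := fun x => by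
        rw [norm_mul, mul_pow]; norm_num
      simp only [h4]
      rw [integral_splice hs (hg2.const_mul _) hg2, ← integral_Ioc_add_Ioi hg2 hs,
        MeasureTheory.integral_const_mul]
      ring
    · simp only [D, he, ↓reduceIte]
  · have h1 := hpow p hfp
    have h2 : 0 ≤ ∫ x in Ioc 0 s, ‖f x‖ ^ p := integral_nonneg fun x => by positivity
    have h3 : u.potential p = _ := integral_star hℓ.le _
    have h4 : (ofIntegral hℓ F D hF hFD hFL hDL).potential p = _ := integral_star hℓ.le _
    rw [h3, h4]
    change _ ≤ ∑ e, ∫ x in starEdge ℓ e, ‖F e x‖ ^ p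
    linarith

/-- The kinetic energy of a ground state near the vertex is controlled by its mass. -/
theorem integral_weakDeriv_le (hℓ : 0 < ℓ) (u : (threeHalflinesWithPendant ℓ).H1) {p : ℝ}
    (hp : 2 < p) (hu0 : 0 < mass u)
    (hu : ∀ v : (threeHalflinesWithPendant ℓ).H1, mass v = mass u → energy p u ≤ energy p v)
    (i : Fin 3) {s : ℝ} (hs : 0 ≤ s) :
    ∫ x in Ioc 0 s, ‖u.weakDeriv (some i) x‖ ^ 2 ≤
      2 * u.potential p / mass u * ∫ x in Ioc 0 s, ‖u.toFun (some i) x‖ ^ 2 := by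
  obtain ⟨v, hv1, hv2, hv3⟩ := u.exists_stretch hℓ i hs hp.le
  have h0 : 0 ≤ ∫ x in Ioc 0 s, ‖u.toFun (some i) x‖ ^ 2 := integral_nonneg fun x => by positivity
  -- Stretching saves a quarter of ∫|u'|² over (0, s) in energy; normalising the mass costs at most
  -- its excess times potential / (2 mass). Minimality compares the two.
  obtain ⟨v', hv', hE⟩ := v.exists_mass_eq hp hu0 (by linarith) hv1.le (u.potential_nonneg p) hv3
  have := (hu v' hv').trans hE
  rw [energy_eq_sub, hv2] at this
  have h5 : 2 * u.potential p / mass u * ∫ x in Ioc 0 s, ‖u.toFun (some i) x‖ ^ 2 =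
    4 * (u.potential p * (∫ x in Ioc 0 s, ‖u.toFun (some i) x‖ ^ 2) / (2 * mass u)) := by
    field_simp; ring
  rw [h5]
  linarith

/-- A ground state that vanishes at the vertex vanishes on the halflines. -/
theorem eq_zero_of_zero (hℓ : 0 < ℓ) (u : (threeHalflinesWithPendant ℓ).H1) {p : ℝ}
    (hp : 2 < p) (hu0 : 0 < mass u)
    (hu : ∀ v : (threeHalflinesWithPendant ℓ).H1, mass v = mass u → energy p u ≤ energy p v)
    (h0 : u.toFun none 0 = 0) (i : Fin 3) {x : ℝ} (hx : 0 ≤ x) : u.toFun (some i) x = 0 := by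
  set f := u.toFun (some i) with hf
  set g := u.weakDeriv (some i) with hg
  set C := 2 * u.potential p / mass u with hC
  have hC0 : 0 ≤ C := by have := u.potential_nonneg p; positivity
  have hgL : MemLp g 2 (volume.restrict (Ici 0)) := u.memLp_weakDeriv_star hℓ (some i)
  have hgn : IntegrableOn (fun x => ‖g x‖ ^ 2) (Ici 0) :=
    (memLp_two_iff_integrable_sq_norm hgL.aestronglyMeasurable).1 hgL
  have hfL : MemLp f 2 (volume.restrict (Ici 0)) := u.memLp_star hℓ (some i)
  have hfn : IntegrableOn (fun x => ‖f x‖ ^ 2) (Ici 0) :=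
    (memLp_two_iff_integrable_sq_norm hfL.aestronglyMeasurable).1 hfL
  -- Chosen so that C r < 1 and r ≤ 1; the step does not depend on the position d, so finitely many
  -- steps reach any point.
  set r := 1 / (1 + C) with hr
  have hr0 : 0 < r := by positivity
  have hr1 : r ≤ 1 := (div_le_one (by positivity)).2 (by linarith)
  have hCr : C * r < 1 := by rw [hr, mul_one_div, div_lt_one (by positivity)]; linarith
  -- A discrete unique continuation: if f = 0 on [0, d], then |f|² ≤ r k on the next interval of
  -- length r, so its mass up to d + r is at most r² k. The bound from minimality gives k ≤ C r² k ≤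
  -- C r k, which forces k = 0.
  have step : ∀ d, 0 ≤ d → (∀ x, 0 ≤ x → x ≤ d → f x = 0) → ∀ x, 0 ≤ x → x ≤ d + r → f x = 0 := by
    intro d hd hfd
    set k := ∫ x in Ioc 0 (d + r), ‖g x‖ ^ 2
    have hk0 : 0 ≤ k := integral_nonneg fun x => by positivity
    have hpt : ∀ x, 0 ≤ x → x ≤ d + r → ‖f x‖ ^ 2 ≤ r * k := fun x hx hxd => by
      rcases le_total x d with h | h
      · rw [hfd x hx h]; simp; positivity
      · have e1 := u.sub_eq_integral_star hℓ (some i) (x := d) (y := x) hd hx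
        rw [← hf, ← hg, hfd d hd le_rfl, sub_zero, intervalIntegral.integral_of_le h] at e1
        have e2 : ‖f x‖ ≤ ∫ t in Ioc d x, ‖g t‖ := by
          rw [e1]; exact norm_integral_le_integral_norm _
        have hsub : Ioc d x ⊆ Ici 0 := fun t ht => hd.trans ht.1.le
        have e3 := sq_integral_le_measure_mul_integral_sq
          (hgL.norm.mono_measure (Measure.restrict_mono hsub le_rfl))
        rw [measureReal_restrict_apply_univ, Real.volume_real_Ioc_of_le h] at e3
        have e4 : ∫ t in Ioc d x, ‖g t‖ ^ 2 ≤ k :=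
          setIntegral_mono_set (hgn.mono_set fun t ht => ht.1.le)
            (ae_of_all _ fun _ => by positivity)
            (Eventually.of_forall fun t ht => ⟨hd.trans_lt ht.1, ht.2.trans hxd⟩)
        calc ‖f x‖ ^ 2 ≤ (∫ t in Ioc d x, ‖g t‖) ^ 2 := pow_le_pow_left₀ (norm_nonneg _) e2 2
          _ ≤ (x - d) * ∫ t in Ioc d x, ‖g t‖ ^ 2 := e3
          _ ≤ r * k := mul_le_mul (by linarith) e4 (integral_nonneg fun _ => by positivity) hr0.le
    have hm : ∫ x in Ioc 0 (d + r), ‖f x‖ ^ 2 ≤ r * (r * k) := by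
      have e1 : ∫ x in Ioc 0 (d + r), ‖f x‖ ^ 2 = ∫ x in Ioc d (d + r), ‖f x‖ ^ 2 := by
        refine setIntegral_eq_of_subset_of_forall_sdiff_eq_zero measurableSet_Ioc
          (Ioc_subset_Ioc_left hd) fun x hx => ?_
        have : x ≤ d := by
          by_contra! h
          exact hx.2 ⟨h, hx.1.2⟩
        rw [hfd x hx.1.1.le this]; simp
      rw [e1]
      have e2 : ∫ x in Ioc d (d + r), ‖f x‖ ^ 2 ≤ ∫ _ in Ioc d (d + r), r * k :=
        setIntegral_mono_on (hfn.mono_set fun t ht => hd.trans ht.1.le)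
          (integrableOn_const (by simp)) measurableSet_Ioc
          fun x hx => hpt x (hd.trans hx.1.le) hx.2
      rwa [setIntegral_const, Real.volume_real_Ioc_of_le (by linarith), add_sub_cancel_left,
        smul_eq_mul] at e2
    have hk := u.integral_weakDeriv_le hℓ hp hu0 hu i (s := d + r) (by linarith)
    rw [← hf, ← hg, ← hC] at hk
    have hk' : k ≤ C * r * k := by
      have e1 : k ≤ C * (r * (r * k)) := hk.trans (mul_le_mul_of_nonneg_left hm hC0)
      have e2 : r * (r * k) ≤ r * k := by
        have := mul_le_mul_of_nonneg_right hr1 (mul_nonneg hr0.le hk0)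
        linarith
      have := mul_le_mul_of_nonneg_left e2 hC0
      linarith
    have hk1 : k = 0 := by nlinarith
    intro x hx hxd
    have := hpt x hx hxd
    rw [hk1, mul_zero] at this
    exact norm_eq_zero.1 (pow_eq_zero_iff two_ne_zero |>.1 (le_antisymm this (by positivity)))
  have all : ∀ n : ℕ, ∀ x, 0 ≤ x → x ≤ n * r → f x = 0 := by
    intro n
    induction n with
    | zero =>
      intro x hx hx'
      have : x = 0 := by simp at hx'; exact le_antisymm hx' hx
      rw [this, hf, u.toFun_zero (some i), h0]
    | succ n ih =>
      have := step (n * r) (by positivity) ih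
      push_cast
      rwa [add_mul, one_mul]
  obtain ⟨n, hn⟩ := exists_nat_ge (x / r)
  exact all n x hx ((div_le_iff₀ hr0).1 hn)

end MetricGraph.H1

/-! ### Existence of ground states in terms of profiles -/

namespace MetricGraph.H1

variable {ℓ p μ : ℝ}

/-- Either the modulus attains its maximum on the pendant, or every value on the pendant is exceeded
somewhere on the halflines. -/
theorem pendant_or_halfline (u : (threeHalflinesWithPendant ℓ).H1) :
    (∃ x₀ ∈ Icc 0 ℓ, ∀ i y, 0 ≤ y → u.modulus (some i) y ≤ u.modulus none x₀) ∨
      ∀ x₀ ∈ Icc 0 ℓ, ∃ i y, 0 ≤ y ∧ u.modulus none x₀ < u.modulus (some i) y := by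
  by_cases h : ∃ x₀ ∈ Icc 0 ℓ, ∀ i y, 0 ≤ y → u.modulus (some i) y ≤ u.modulus none x₀
  · exact Or.inl h
  · push Not at h
    exact Or.inr h

theorem profileEnergyLE_of_pendant (u : (threeHalflinesWithPendant ℓ).H1) (hℓ : 0 < ℓ) (hp : 2 < p)
    (h : ∃ x₀ ∈ Icc 0 ℓ, ∀ i y, 0 ≤ y → u.modulus (some i) y ≤ u.modulus none x₀) :
    ProfileEnergyLE p (mass u) 1 9 ℓ (energy p u) := by
  obtain ⟨g, hg, hk⟩ := (u.isStarFunction hℓ).exists_weightedKinetic_le_of_pendant hℓ.le h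
  exact ⟨_, g, hg, u.profileMass_profile hℓ, u.profileEnergy_profile_le hℓ hp.le hk⟩

theorem lineLevel_le_of_halfline (u : (threeHalflinesWithPendant ℓ).H1) (hℓ : 0 < ℓ) (hp : 2 < p)
    (hp6 : p < 6) (hu : 0 < mass u)
    (h : ∀ x₀ ∈ Icc 0 ℓ, ∃ i y, 0 ≤ y ∧ u.modulus none x₀ < u.modulus (some i) y) :
    lineLevel p (mass u) ≤ energy p u := by
  obtain ⟨g, hg, hk⟩ := (u.isStarFunction hℓ).exists_weightedKinetic_le_of_halfline hℓ.le h
  exact (lineLevel_le hp hp6 hu hg (u.profileMass_profile hℓ).le).trans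
    (u.profileEnergy_profile_le hℓ hp.le hk)

theorem lineLevel_lt_of_halfline (u : (threeHalflinesWithPendant ℓ).H1) (hℓ : 0 < ℓ) (hp : 2 < p)
    (hp6 : p < 6) (hu : 0 < mass u)
    (h : ∀ x₀ ∈ Icc 0 ℓ, ∃ i y, 0 ≤ y ∧ u.modulus none x₀ < u.modulus (some i) y)
    (h0 : 0 < u.modulus none 0) : lineLevel p (mass u) < energy p u := by
  obtain ⟨g, hg, hk⟩ := (u.isStarFunction hℓ).exists_weightedKinetic_lt_of_halfline hℓ.le h h0
  exact (lineLevel_le hp hp6 hu hg (u.profileMass_profile hℓ).le).trans_lt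
    (u.profileEnergy_profile_lt hℓ hp.le hk)

/-- The infimum of the energy on the star graph is at most that on the line. -/
theorem exists_energy_le_lineLevel_add (hℓ : 0 < ℓ) (hp : 2 < p) (hp6 : p < 6) (hμ : 0 < μ) {ε : ℝ}
    (hε : 0 < ε) : ∃ v : (threeHalflinesWithPendant ℓ).H1, mass v = μ ∧
      energy p v ≤ lineLevel p μ + ε := by
  obtain ⟨w, g, hw, hm, hE⟩ :=
    profileEnergyLE_of_lineLevel_lt hp hp6 hμ (lt_add_of_pos_right (lineLevel p μ) (half_pos hε))
  set P := profilePotential p w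
  have hP : 0 ≤ P := hw.potential_nonneg p
  -- An error δ in mass and kinetic energy costs at most D δ: 1/2 from the kinetic term, P/(2μ) from
  -- normalising the mass. Hence δ = (ε/2)/D.
  set D := 1 / 2 + P / (2 * μ) with hD
  have hD0 : 0 < D := by positivity
  obtain ⟨u, h1, h2, h3, h4⟩ := exists_H1_far hℓ hw hp (div_pos (half_pos hε) hD0)
  rw [hm] at h1 h2
  obtain ⟨v, hv, hEv⟩ := u.exists_mass_eq hp hμ h1 h2 hP h4
  refine ⟨v, hv, hEv.trans ?_⟩
  rw [profileEnergy] at hE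
  have e1 : 1 / 2 * (ε / 2 / D) + P * (ε / 2 / D) / (2 * μ) = ε / 2 := by
    have : 1 / 2 * (ε / 2 / D) + P * (ε / 2 / D) / (2 * μ) = D * (ε / 2 / D) := by
      rw [hD]; ring
    rw [this, mul_div_cancel₀ _ hD0.ne']
  linarith

/-- A ground state exists if some profile reaches the energy level of the line. -/
theorem _root_.MetricGraph.hasGroundState_of_profileEnergyLE (hℓ : 0 < ℓ) (hp : 2 < p) (hp6 : p < 6)
    (hμ : 0 < μ) (h : ProfileEnergyLE p μ 1 9 ℓ (lineLevel p μ)) :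
    (threeHalflinesWithPendant ℓ).HasGroundState p μ := by
  set J := sInf {e | ProfileEnergyLE p μ 1 9 ℓ e} with hJ
  have hbdd : BddBelow {e | ProfileEnergyLE p μ 1 9 ℓ e} :=
    ⟨_, fun e ⟨w, g, hw, hm, hE⟩ => (hw.le_energy hp hp6 hm.le le_rfl (by norm_num) hℓ.le).trans hE⟩
  have hJle : J ≤ lineLevel p μ := csInf_le hbdd h
  have hatt : ProfileEnergyLE p μ 1 9 ℓ J := by
    refine .of_forall_pos hp hp6 le_rfl (by norm_num) hℓ.le
      (hJle.trans_lt (lineLevel_neg hp hp6 hμ)) fun ε hε => ?_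
    have hne : {e | ProfileEnergyLE p μ 1 9 ℓ e}.Nonempty := ⟨_, h⟩
    obtain ⟨e, he, hlt⟩ := exists_lt_of_csInf_lt hne (lt_add_of_pos_right J hε)
    exact ProfileEnergyLE.mono he hlt.le
  obtain ⟨w, g, hw, hm, hE⟩ := hatt
  obtain ⟨u, hu, hEu⟩ := exists_H1_pendant hℓ hw hp
  refine ⟨u, hu.trans hm, fun v hv => (hEu.le.trans hE).trans ?_⟩
  -- A competitor with maximum on the pendant has energy at least J by rearrangement; any other has
  -- energy at least that of the line, which is at least J.
  rcases v.pendant_or_halfline with hv' | hv'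
  · exact csInf_le hbdd (hv ▸ v.profileEnergyLE_of_pendant hℓ hp hv')
  · exact hJle.trans (hv ▸ v.lineLevel_le_of_halfline hℓ hp hp6 (hv ▸ hμ) hv')

/-- The maximum of a ground state is attained on the pendant. -/
theorem _root_.MetricGraph.HasGroundState.profileEnergyLE (hℓ : 0 < ℓ) (hp : 2 < p) (hp6 : p < 6)
    (hμ : 0 < μ) (h : (threeHalflinesWithPendant ℓ).HasGroundState p μ) :
    ProfileEnergyLE p μ 1 9 ℓ (lineLevel p μ) := by
  obtain ⟨u, rfl, hu⟩ := h
  have hE : energy p u ≤ lineLevel p (mass u) := le_of_forall_pos_le_add fun ε hε => by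
    obtain ⟨v, hv, hEv⟩ := exists_energy_le_lineLevel_add hℓ hp hp6 hμ hε
    exact (hu v hv).trans hEv
  rcases u.pendant_or_halfline with hmax | hmax
  · exact (u.profileEnergyLE_of_pendant hℓ hp hmax).mono hE
  · exfalso
    have hm0 : (0 : ℝ) ∈ starEdge ℓ none := zero_mem_starEdge hℓ.le none
    have h0 : u.modulus none 0 = ‖u.toFun none 0‖ := u.modulus_of_mem hm0
    -- Zero at the vertex forces u = 0 on all halflines, which then cannot exceed the pendant;
    -- nonzero there, the energy lies strictly above the level of the line.
    rcases (norm_nonneg (u.toFun none 0)).eq_or_lt with hz | hpos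
    · obtain ⟨i, y, hy, hlt⟩ := hmax 0 hm0
      rw [h0, ← hz, u.modulus_of_mem (e := some i) hy,
        u.eq_zero_of_zero hℓ hp hμ hu (norm_eq_zero.1 hz.symm) i hy, norm_zero] at hlt
      exact lt_irrefl _ hlt
    · exact absurd hE (u.lineLevel_lt_of_halfline hℓ hp hp6 hμ hmax (h0 ▸ hpos)).not_ge

end MetricGraph.H1

theorem theorem6p5 (p μ : ℝ) (hp₂ : 2 < p) (hp₆ : p < 6) (hμ : 0 < μ) :
    ∃ ℓcrit : ℝ, 0 < ℓcrit ∧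
      ∀ ℓ : ℝ, 0 < ℓ →
        ((MetricGraph.threeHalflinesWithPendant ℓ).HasGroundState p μ ↔ ℓcrit ≤ ℓ) := by
  obtain ⟨ℓc, hc, h⟩ := exists_critical_length hp₂ hp₆ hμ
  exact ⟨ℓc, hc, fun ℓ hℓ => ⟨fun hG => (h ℓ hℓ).1 (hG.profileEnergyLE hℓ hp₂ hp₆ hμ),
    fun hle => MetricGraph.hasGroundState_of_profileEnergyLE hℓ hp₂ hp₆ hμ ((h ℓ hℓ).2 hle)⟩⟩
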